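/- **Setting.** Fix $\tau\in\mathbb C$ with $\operatorname{Im}\tau>0$, put ${\rm p}=e^{2\pi i\tau}$, ${\rm p}^{1/8}=e^{\pi i\tau/4}$, and $$[u]=i\,{\rm p}^{1/8}\sin(\pi u)\prod_{m\ge1}(1-2{\rm p}^m\cos 2\pi u+{\rm p}^{2m})(1-{\rm p}^m)\qquad(u\in\mathbb C).$$ Let $\hbar\in\mathbb C$ be generic, meaning $[k\hbar]\neq0$ for every nonzero integer $k$, and put $c=-3\hbar$. Let $\mathfrak h^*=\mathbb C\varepsilon_1\oplus\mathbb C\varepsilon_2$ with the bilinear form $(\varepsilon_j,\varepsilon_k)=\frac12\delta_{jk}$, let $R=\{\pm(\varepsilon_1\pm\varepsilon_2),\pm2\varepsilon_1,\pm2\varepsilon_2\}$ be the root system of type $C_2$, and let $\mathcal P_1=\{\pm\varepsilon_1,\pm\varepsilon_2\}$, $\mathcal P_2=\{\pm(\varepsilon_1\pm\varepsilon_2),0\}$. For $\lambda\in\mathfrak h^*$ write $\lambda_p=(\lambda,p)$, $\widehat p=2\hbar p$ and $(T_{\widehat p}f)(\lambda)=f(\lambda+\widehat p)$. Call $\lambda$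 regular if $[(\lambda,\alpha)+k\hbar]\ne0$ for all $\alpha\in R$ and $k\in\mathbb Z$; the set of regular $\lambda$ is stable under all $\lambda\mapsto\lambda+\widehat p$. *Weights of type $(1,1)$.* For $p,q,r,s\in\mathcal P_1$ with $p+q=s+r$ let $w_\lambda(p,q;s,r|u)=W_{11}(\lambda,\lambda+\widehat p;\lambda+\widehat s,\lambda+\widehat p+\widehat q\,|\,u)$ be given by (in each line $p\ne\pm q$, except that only $p\ne q$ is required in the fourth; $r$ in the products runs over $\mathcal P_1$) $$w_\lambda(p,p;p,p|u)=\frac{[c-u][u+\hbar]}{[c][\hbar]},\qquad w_\lambda(p,q;p,q|u)=\frac{[c-u][\lambda_{p-q}-u]}{[c][\lambda_{p-q}]},$$ $$w_\lambda(q,p;p,q|u)=\frac{[c-u][u][\lambda_{p-q}+\hbar]}{[c][\hbar][\lambda_{p-q}]},$$ $$w_\lambda(q,-q;p,-p|u)=-\frac{[u][\lambda_{p+q}+\hbar+c-u]}{[c][\lambda_{p+q}+\hbar]}\frac{[2\lambda_p+2\hbar]}{[2\lambda_q]}\frac{\prod_{r\neq\pm p}[\lambda_{p+r}+\hbar]}{\prod_{r\ne\pm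 q}[\lambda_{q+r}]}\quad(p\neq q),$$ $$w_\lambda(p,-p;p,-p|u)=\frac{[c-u][2\lambda_p+\hbar-u]}{[c][2\lambda_p+\hbar]}-\frac{[u][2\lambda_p+\hbar+c-u]}{[c][2\lambda_p+\hbar]}\frac{[2\lambda_p+2\hbar]}{[2\lambda_p]}\prod_{r\ne\pm p}\frac{[\lambda_{p+r}+\hbar]}{[\lambda_{p+r}]}.$$ All other weights of type $(1,1)$ are $0$. *Fusion.* Consider the complex vector space with basis the paths $e_{p_1}\otimes\cdots\otimes e_{p_k}$ ($p_i\in\mathcal P_1$) starting at $\lambda$ with successive vertices $\lambda,\lambda+\widehat p_1,\lambda+\widehat p_1+\widehat p_2,\dots$. Let $W^{j,j+1}(u)$ be the operator which replaces $e_p\otimes e_q$ in positions $j,j+1$ by $\sum_{s+r=p+q}w_\mu(p,q;s,r|u)\,e_s\otimes e_r$, where $\mu$ is the vertex reached after the first $j-1$ steps. Put $$\widetilde W_{12}(u)=W^{2,3}(u+\hbar)W^{1,2}(u),\qquad \widetilde W_{22}(u)=W^{2,3}(u+\hbar)W^{3,4}(u)W^{1,2}(u)W^{2,3}(u-\hbar).$$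 For paths starting at $\lambda$ let $$\bar f_{p+q}=[\lambda_{p-q}+\hbar]\,e_p\otimes e_q+[\lambda_{q-p}+\hbar]\,e_q\otimes e_p\quad(p=\pm\varepsilon_1,\ q=\pm\varepsilon_2),\qquad \bar f_0=\sum_{p\in\mathcal P_1}[2\lambda_p+2\hbar]\,e_p\otimes e_{-p}.$$ Write $g^{(1)}_p=e_p$ for $p\in\mathcal P_1$ and $g^{(2)}_p=\bar f_p$ for $p\in\mathcal P_2$; in a tensor product the second factor is formed at the end point of the first. For $d=1,2$ the fused Boltzmann weights are the coefficients in $$\widetilde W_{d2}(u)\,\bigl(g^{(d)}_p\otimes g^{(2)}_q\bigr)=\sum_{s\in\mathcal P_2,\;r\in\mathcal P_d,\;s+r=p+q}W_{d2}(\lambda,\lambda+\widehat p;\lambda+\widehat s,\lambda+\widehat p+\widehat q\,|\,u)\;g^{(2)}_s\otimes g^{(d)}_r .$$ **Theorem.** For $d=1,2$ and $u\in\mathbb C$ let $M_d(u)$ be the difference operator on functions on $\mathfrak h^*$ given by $$(M_d(u)f)(\lambda)=\sum_{p\in\mathcal P_d}W_{d2}(\lambda,\lambda+2\hbar p;\lambda,\lambda+2\hbar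 p\,|\,u)\,f(\lambda+2\hbar p).$$ The following operator identities hold, in the sense that for every function $f:\mathfrak h^*\to\mathbb C$ both sides applied to $f$ agree at every regular $\lambda$. (i) $M_d(u)M_{d'}(v)=M_{d'}(v)M_d(u)$ for all $u,v\in\mathbb C$ and $d,d'\in\{1,2\}$. (ii) For all $u\in\mathbb C$, $M_1(u)=F(u)\widetilde M_1$ and $M_2(u)=G(u)\bigl(\widetilde M_2-H(u)\bigr)$, where $$\widetilde M_1=\sum_{p\in\mathcal P_1}\ \prod_{q\in\mathcal P_1,\,q\ne\pm p}\frac{[\lambda_{p+q}-\hbar]}{[\lambda_{p+q}]}\,T_{\widehat p},$$ $$\widetilde M_2=\sum_{p=\pm\varepsilon_1,\ q=\pm\varepsilon_2}\left(\frac{[\lambda_{p+q}-\hbar]}{[\lambda_{p+q}+\hbar]}T_{\widehat p}T_{\widehat q}+\frac{[2\hbar]}{[6\hbar]}\frac{[2\lambda_p+2\hbar]}{[2\lambda_p]}\frac{[2\lambda_q+2\hbar]}{[2\lambda_q]}\frac{[\lambda_{p+q}-5\hbar]}{[\lambda_{p+q}+\hbar]}\frac{[\lambda_{p+q}+2\hbar]}{[\lambda_{p+q}]}\right),$$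 $$F(u)=\frac{[u][u+2\hbar]^2[u+4\hbar]}{[-3\hbar]^2[\hbar]^2},\qquad G(u)=\frac{[u-\hbar][u]^2[u+\hbar][u+2\hbar][u+3\hbar]^2[u+4\hbar]}{[-3\hbar]^4[\hbar]^4},$$ $$H(u)=\frac{[u+6\hbar][u-3\hbar][2\hbar]}{[u][u+3\hbar][6\hbar]}.$$ At the zeros of $[u][u+3\hbar]$, which are poles of $H$, the product $G(u)H(u)$ is read as its holomorphic continuation, whose value there is $0$. -/

import Mathlib

namespace C2Face

/-- The theta function `[u] = i p^(1/8) sin(π u) ∏_{m ≥ 1} (1 - 2 p^m cos(2 π u) + p^(2m)) (1 - p^m)`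
with nome `p = exp(2 π i τ)`; here `p^(1/8) = exp(π i τ / 4)`. -/
noncomputable def theta (τ u : ℂ) : ℂ :=
  Complex.I * Complex.exp (Real.pi * Complex.I * τ / 4) * Complex.sin (Real.pi * u) *
    ∏' m : ℕ,
      (1 - 2 * Complex.exp (2 * Real.pi * Complex.I * τ) ^ (m + 1) * Complex.cos (2 * Real.pi * u)
          + Complex.exp (2 * Real.pi * Complex.I * τ) ^ (2 * (m + 1))) *
        (1 - Complex.exp (2 * Real.pi * Complex.I * τ) ^ (m + 1))

/-- The dual `𝔥*` of the Cartan subalgebra of `sp(4, ℂ)`, in coordinates with respect to the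
basis `ε₁, ε₂`. -/
abbrev Space : Type := ℂ × ℂ

/-- The lattice `ℤ ε₁ + ℤ ε₂` of integral weights, in coordinates with respect to `ε₁, ε₂`. -/
abbrev Wt : Type := ℤ × ℤ

/-- The pairing `λ_p = (λ, p)`, for the bilinear form with `(ε_j, ε_k) = δ_{jk} / 2`. -/
noncomputable def pair (lam : Space) (p : Wt) : ℂ := (lam.1 * p.1 + lam.2 * p.2) / 2

/-- The shifted point `λ + 2 ℏ p`. -/
def shift (ℏ : ℂ) (lam : Space) (p : Wt) : Space := (lam.1 + 2 * ℏ * p.1, lam.2 + 2 * ℏ * p.2)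

/-- The weights `± ε₁, ± ε₂` of the first fundamental representation. -/
def P1 : Finset Wt := {(1, 0), (-1, 0), (0, 1), (0, -1)}

/-- The weights `± ε₁ ± ε₂, 0` of the second fundamental representation. -/
def P2 : Finset Wt := {(1, 1), (1, -1), (-1, 1), (-1, -1), (0, 0)}

/-- The roots `± (ε₁ ± ε₂), ± 2 ε₁, ± 2 ε₂`. -/
def roots : Finset Wt :=
  {(1, 1), (1, -1), (-1, 1), (-1, -1), (2, 0), (-2, 0), (0, 2), (0, -2)}

/-- The label `d ∈ {1, 2}` of a fundamental weight. -/
inductive Fund : Type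
  | one
  | two

/-- The weight set `P_d`. -/
def P : Fund → Finset Wt
  | .one => P1
  | .two => P2

/-- Genericity of the step: no nonzero integer multiple of `ℏ` is a zero of `[·]`. -/
def GenericStep (τ ℏ : ℂ) : Prop := ∀ k : ℤ, k ≠ 0 → theta τ (k * ℏ) ≠ 0

/-- The points of `𝔥*` off all hyperplanes `[(λ, α) + k ℏ] = 0` (`α` a root, `k` an integer) on
which the coefficients below, and their translates, may have poles. -/
def Regular (τ ℏ : ℂ) (lam : Space) : Prop :=
  ∀ α ∈ roots, ∀ k : ℤ, theta τ (pair lam α + k * ℏ) ≠ 0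

/-- The crossing parameter `c = - (n + 1) ℏ` with `n = 2`. -/
def crossing (ℏ : ℂ) : ℂ := -3 * ℏ

/-- The Boltzmann weight `W₁₁ (λ, λ + 2ℏp; λ + 2ℏs, λ + 2ℏ(p + q) | u)` of the `C₂⁽¹⁾` face model:
`p` is the top, `q` the right, `s` the left and `r` the bottom edge of the square. -/
noncomputable def W11 (τ ℏ : ℂ) (lam : Space) (p q s r : Wt) (u : ℂ) : ℂ :=
  if ¬ (p ∈ P1 ∧ q ∈ P1 ∧ s ∈ P1 ∧ r ∈ P1 ∧ p + q = s + r) then 0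
  else if q = p then
    theta τ (crossing ℏ - u) * theta τ (u + ℏ) / (theta τ (crossing ℏ) * theta τ ℏ)
  else if q ≠ -p then
    if s = p then
      theta τ (crossing ℏ - u) * theta τ (pair lam (p - q) - u) /
        (theta τ (crossing ℏ) * theta τ (pair lam (p - q)))
    else
      theta τ (crossing ℏ - u) * theta τ u * theta τ (pair lam (s - p) + ℏ) /
        (theta τ (crossing ℏ) * theta τ ℏ * theta τ (pair lam (s - p)))
  else if s ≠ p then
    - (theta τ u * theta τ (pair lam (s + p) + ℏ + crossing ℏ - u) /
        (theta τ (crossing ℏ) * theta τ (pair lam (s + p) + ℏ))) *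
      (theta τ (2 * pair lam s + 2 * ℏ) / theta τ (2 * pair lam p)) *
      ((∏ t ∈ P1 with t ≠ s ∧ t ≠ -s, theta τ (pair lam (s + t) + ℏ)) /
        (∏ t ∈ P1 with t ≠ p ∧ t ≠ -p, theta τ (pair lam (p + t))))
  else
    theta τ (crossing ℏ - u) * theta τ (2 * pair lam p + ℏ - u) /
        (theta τ (crossing ℏ) * theta τ (2 * pair lam p + ℏ)) -
      theta τ u * theta τ (2 * pair lam p + ℏ + crossing ℏ - u) /
        (theta τ (crossing ℏ) * theta τ (2 * pair lam p + ℏ)) *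
      (theta τ (2 * pair lam p + 2 * ℏ) / theta τ (2 * pair lam p)) *
      ∏ t ∈ P1 with t ≠ p ∧ t ≠ -p, theta τ (pair lam (p + t) + ℏ) / theta τ (pair lam (p + t))

/-- Vectors of the space of paths with `k` steps from a fixed initial point: `φ x` is the
coefficient of the path with successive steps `2ℏ x₀, 2ℏ x₁, …`. -/
abbrev PathVec (k : ℕ) : Type := (Fin k → Wt) → ℂ

/-- The operator `id ⊗ W₁₁(u) ⊗ id` acting on the steps `j` and `j + 1` (counted from `0`) of
paths that start at `λ`. -/
noncomputable def faceOp (τ ℏ : ℂ) {k : ℕ} (j : Fin (k + 1)) (u : ℂ) (lam : Space) :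
    PathVec (k + 2) →ₗ[ℂ] PathVec (k + 2) where
  toFun φ := fun x =>
    ∑ p ∈ P1, ∑ q ∈ P1,
      W11 τ ℏ (shift ℏ lam (∑ i with i < j.castSucc, x i)) p q (x j.castSucc) (x j.succ) u *
        φ (Function.update (Function.update x j.castSucc p) j.succ q)
  map_add' φ ψ := by
    funext x
    simp only [Pi.add_apply, mul_add, Finset.sum_add_distrib]
  map_smul' a φ := by
    funext x
    simp only [Pi.smul_apply, smul_eq_mul, RingHom.id_apply, Finset.mul_sum, mul_left_comm]

/-- The basis path `e` with the single step `p`. -/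
def eVec (p : Wt) : Wt → ℂ := fun a => if a = p then 1 else 0

/-- The vector `f̄` from `λ` to `λ + 2ℏr`, `r ∈ P₂`, by its coefficients at the two-step paths with
steps `a, b`: for `r = 0` the coefficient at `(a, -a)` is `[2 λ_a + 2ℏ]`, and for `r = p + q` with
`p = ± ε₁`, `q = ± ε₂` the coefficients at `(p, q)` and `(q, p)` are `[λ_{p-q} + ℏ]` and
`[λ_{q-p} + ℏ]`. -/
noncomputable def fVec (τ ℏ : ℂ) (lam : Space) (r : Wt) : Wt → Wt → ℂ := fun a b =>
  if a ∈ P1 ∧ b ∈ P1 ∧ a + b = r then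
    if r = 0 then theta τ (2 * pair lam a + 2 * ℏ) else theta τ (pair lam (a - b) + ℏ)
  else 0

/-- `e ⊗ f̄`, with successive steps `p ∈ P₁` and `q ∈ P₂`, starting at `λ`. -/
noncomputable def efVec (τ ℏ : ℂ) (lam : Space) (p q : Wt) : PathVec 3 := fun x =>
  eVec p (x 0) * fVec τ ℏ (shift ℏ lam p) q (x 1) (x 2)

/-- `f̄ ⊗ e`, with successive steps `p ∈ P₂` and `q ∈ P₁`, starting at `λ`. -/
noncomputable def feVec (τ ℏ : ℂ) (lam : Space) (p q : Wt) : PathVec 3 := fun x =>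
  fVec τ ℏ lam p (x 0) (x 1) * eVec q (x 2)

/-- `f̄ ⊗ f̄`, with successive steps `p, q ∈ P₂`, starting at `λ`. -/
noncomputable def ffVec (τ ℏ : ℂ) (lam : Space) (p q : Wt) : PathVec 4 := fun x =>
  fVec τ ℏ lam p (x 0) (x 1) * fVec τ ℏ (shift ℏ lam p) q (x 2) (x 3)

/-- The composite operator `W(ϖ₁^u, ϖ₁^v ⊗ ϖ₁^(v-ℏ))`, as a function of the difference `u` of the
spectral parameters. -/
noncomputable def fusedOp12 (τ ℏ u : ℂ) (lam : Space) : PathVec 3 →ₗ[ℂ] PathVec 3 :=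
  faceOp τ ℏ (k := 1) 1 (u + ℏ) lam ∘ₗ faceOp τ ℏ (k := 1) 0 u lam

/-- The composite operator `W(ϖ₁^u ⊗ ϖ₁^(u-ℏ), ϖ₁^v ⊗ ϖ₁^(v-ℏ))`, as a function of the difference
`u` of the spectral parameters. -/
noncomputable def fusedOp22 (τ ℏ u : ℂ) (lam : Space) : PathVec 4 →ₗ[ℂ] PathVec 4 :=
  (faceOp τ ℏ (k := 2) 1 (u + ℏ) lam ∘ₗ faceOp τ ℏ (k := 2) 2 u lam) ∘ₗ
    (faceOp τ ℏ (k := 2) 0 u lam ∘ₗ faceOp τ ℏ (k := 2) 1 (u - ℏ) lam)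

/-- `c` gives the coefficients of the restricted operator `W₁₂(u)` on `e ⊗ f̄`:
`W₁₂(u) (e_p ⊗ f̄_q) = ∑ c s • f̄_s ⊗ e_{p+q-s}`. -/
def IsCoeff12 (τ ℏ : ℂ) (lam : Space) (p q : Wt) (u : ℂ) (c : Wt → ℂ) : Prop :=
  fusedOp12 τ ℏ u lam (efVec τ ℏ lam p q) =
    ∑ s ∈ P2 with p + q - s ∈ P1, c s • feVec τ ℏ lam s (p + q - s)

/-- `c` gives the coefficients of the restricted operator `W₂₂(u)` on `f̄ ⊗ f̄`:
`W₂₂(u) (f̄_p ⊗ f̄_q) = ∑ c s • f̄_s ⊗ f̄_{p+q-s}`. -/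
def IsCoeff22 (τ ℏ : ℂ) (lam : Space) (p q : Wt) (u : ℂ) (c : Wt → ℂ) : Prop :=
  fusedOp22 τ ℏ u lam (ffVec τ ℏ lam p q) =
    ∑ s ∈ P2 with p + q - s ∈ P2, c s • ffVec τ ℏ lam s (p + q - s)

/-- The coefficients in the expansion of `W_{d2}(u)` on the basis vector with steps `p, q`. -/
def IsCoeff (τ ℏ : ℂ) : Fund → Space → Wt → Wt → ℂ → (Wt → ℂ) → Prop
  | .one => IsCoeff12 τ ℏ
  | .two => IsCoeff22 τ ℏ

open Classical in
/-- The fused Boltzmann weight `W_{d2} (λ, λ + 2ℏp; λ + 2ℏs, λ + 2ℏ(p + q) | u)`, with top edge `p`,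
right edge `q`, left edge `s` and bottom edge `r`: the matrix coefficient of `W_{d2}(u)`. -/
noncomputable def W (τ ℏ : ℂ) (d : Fund) (lam : Space) (p q s r : Wt) (u : ℂ) : ℂ :=
  if h : (p ∈ P d ∧ q ∈ P2 ∧ s ∈ P2 ∧ r ∈ P d ∧ p + q = s + r) ∧
      ∃ c : Wt → ℂ, IsCoeff τ ℏ d lam p q u c then
    h.2.choose s
  else 0

/-- The difference operator `M_d(u)` on functions on `𝔥*`. -/
noncomputable def M (τ ℏ : ℂ) (d : Fund) (u : ℂ) (f : Space → ℂ) : Space → ℂ := fun lam =>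
  ∑ p ∈ P d, W τ ℏ d lam p 0 0 p u * f (shift ℏ lam p)

/-- The difference operator `M̃₁`. -/
noncomputable def Mtilde1 (τ ℏ : ℂ) (f : Space → ℂ) : Space → ℂ := fun lam =>
  ∑ p ∈ P1,
    (∏ q ∈ P1 with q ≠ p ∧ q ≠ -p,
      theta τ (pair lam (p + q) - ℏ) / theta τ (pair lam (p + q))) * f (shift ℏ lam p)

/-- The difference operator `M̃₂`; the sum is over `p = ± ε₁`, `q = ± ε₂`. -/
noncomputable def Mtilde2 (τ ℏ : ℂ) (f : Space → ℂ) : Space → ℂ := fun lam =>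
  ∑ p ∈ ({(1, 0), (-1, 0)} : Finset Wt), ∑ q ∈ ({(0, 1), (0, -1)} : Finset Wt),
    (theta τ (pair lam (p + q) - ℏ) / theta τ (pair lam (p + q) + ℏ) *
        f (shift ℏ (shift ℏ lam p) q) +
      theta τ (2 * ℏ) / theta τ (6 * ℏ) *
        (theta τ (2 * pair lam p + 2 * ℏ) / theta τ (2 * pair lam p)) *
        (theta τ (2 * pair lam q + 2 * ℏ) / theta τ (2 * pair lam q)) *
        (theta τ (pair lam (p + q) - 5 * ℏ) / theta τ (pair lam (p + q) + ℏ)) *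
        (theta τ (pair lam (p + q) + 2 * ℏ) / theta τ (pair lam (p + q))) * f lam)

/-- The scalar `F(u)`. -/
noncomputable def F (τ ℏ u : ℂ) : ℂ :=
  theta τ u * theta τ (u + 2 * ℏ) ^ 2 * theta τ (u + 4 * ℏ) /
    (theta τ (-3 * ℏ) ^ 2 * theta τ ℏ ^ 2)

/-- The scalar `G(u)`. -/
noncomputable def G (τ ℏ u : ℂ) : ℂ :=
  theta τ (u - ℏ) * theta τ u ^ 2 * theta τ (u + ℏ) * theta τ (u + 2 * ℏ) *
      theta τ (u + 3 * ℏ) ^ 2 * theta τ (u + 4 * ℏ) /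
    (theta τ (-3 * ℏ) ^ 4 * theta τ ℏ ^ 4)

/-- The scalar `H(u)`. -/
noncomputable def H (τ ℏ u : ℂ) : ℂ :=
  theta τ (u + 6 * ℏ) * theta τ (u - 3 * ℏ) * theta τ (2 * ℏ) /
    (theta τ u * theta τ (u + 3 * ℏ) * theta τ (6 * ℏ))

end C2Face

/-! The difference operators involve only the fused weights whose left and right edges are 0, and
these can be computed in closed form. The result is that M₁(u) is a scalar multiple of a fixed
operator M̃₁ and M₂(u) is a scalar multiple of M̃₂ − H(u), so that all commutation relations reduce
to the single one between M̃₁ and M̃₂. That one is checked coefficient by coefficient; no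
Yang-Baxter equation is invoked.

The only facts used about [·] are its oddness, the non-vanishing assumptions and Weierstrass'
three-term identity (`threeTerm_theta`). For all y the functions x ↦ [x+y][x−y] lie in one space of
theta functions of degree two. A two-step recursion for Fourier coefficients shows that any three
elements of this space are dependent. Hence the alternating kernel [x+y][x−y] has rank two, and the
three-term identity is its Plücker relation. Every further theta identity is an explicit polynomial
combination of instances of it; encoding arguments as integer vectors (`LatticeTheta`) makes these
combinations checkable by `ring`.

For the fusion, fix weights p, q of P₁ on different axes and put a = λ_p, b = λ_q. Expanding the
images of e_p ⊗ f̄ over basis paths gives one theta identity per path. Together they say that the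
image is again a combination of vectors f̄ ⊗ e, with the coefficients named `c00`, `c0p`, `cm0`,
`cmm`, `cmp` (`fusedOp12_add`, `fusedOp12_zero`, `fusedOp12_sub`). Since faces on disjoint steps
commute, W̃₂₂(u) is W̃₁₂(u−ħ) on the last three steps followed by W̃₁₂(u) on the first three. Its
action is therefore governed by identities between the coefficients already found
(`fusedOp22_addZero`, `fusedOp22_zeroZero`).

In the commutator of M̃₁ and M̃₂, a shift by p + 2q is reached by one route in either order, and the
two products agree (`wM_mul_wN`). A shift by q is reached through p, through −p, or through the
potential, and the sum cancels (`wM_commute`). The latter uses a two-term form of the potential,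
supplied by `sum_kTerm`. -/

namespace C2Face

open Filter Topology

/-! ### Product formula and quasi-periodicity of the theta function -/

/-- The product `∏ (1 - q^(m+1) e)`. -/
noncomputable def eulerProd (q e : ℂ) : ℂ := ∏' m : ℕ, (1 - q ^ (m + 1) * e)

theorem multipliable_eulerProd {q : ℂ} (hq : ‖q‖ < 1) (e : ℂ) :
    Multipliable fun m : ℕ => 1 - q ^ (m + 1) * e := by
  have hs : Summable fun m : ℕ => ‖-(q ^ (m + 1) * e)‖ := by
    simp only [norm_neg, norm_mul, norm_pow]
    exact ((summable_nat_add_iff 1).mpr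
      (summable_geometric_of_lt_one (norm_nonneg _) hq)).mul_right ‖e‖
  simpa only [sub_eq_add_neg] using multipliable_one_add_of_summable hs

theorem eulerProd_step {q : ℂ} (hq : ‖q‖ < 1) (e : ℂ) :
    (1 - q * e) * eulerProd q (q * e) = eulerProd q e := by
  have e1 : ∀ m : ℕ, 1 - q ^ (m + 1) * (q * e) = 1 - q ^ (m + 1 + 1) * e := fun m => by ring
  have h := multipliable_eulerProd hq (q * e)
  simp only [e1] at h
  have h2 := tprod_eq_zero_mul' (f := fun m : ℕ => 1 - q ^ (m + 1) * e) h
  simp only [zero_add, pow_one] at h2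
  simp only [eulerProd, e1]
  exact h2.symm

theorem differentiable_eulerProd {q : ℂ} (hq : ‖q‖ < 1) : Differentiable ℂ (eulerProd q) := by
  have hu : Summable fun m : ℕ => ‖q‖ ^ (m + 1) :=
    (summable_nat_add_iff 1).mpr (summable_geometric_of_lt_one (norm_nonneg _) hq)
  intro z
  -- Differentiability is local: on this ball the factors are dominated by ‖q‖^(m+1) (‖z‖ + 1), a
  -- summable geometric majorant.
  have hz : z ∈ Metric.ball (0 : ℂ) (‖z‖ + 1) := by simp
  have key := (Summable.hasProdLocallyUniformlyOn_nat_one_add (f := fun m e => -(q ^ (m + 1) * e))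
    (K := Metric.ball (0 : ℂ) (‖z‖ + 1)) Metric.isOpen_ball (hu.mul_right (‖z‖ + 1))
    (.of_forall fun m x hx => by
      simp only [norm_neg, norm_mul, norm_pow]
      gcongr
      simpa using (Metric.mem_ball.mp hx).le) (fun m => by fun_prop)).differentiableOn
    (.of_forall fun _ => by
      simpa [Finset.prod_fn] using DifferentiableOn.finsetProd (fun _ _ => by fun_prop))
    Metric.isOpen_ball
  have hE : eulerProd q = fun e => ∏' m : ℕ, (1 + -(q ^ (m + 1) * e)) := by
    ext e; simp only [eulerProd, sub_eq_add_neg]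
  rw [hE]
  exact key.differentiableAt (Metric.isOpen_ball.mem_nhds hz)

theorem norm_nome_lt_one {τ : ℂ} (hτ : 0 < τ.im) :
    ‖Complex.exp (2 * Real.pi * Complex.I * τ)‖ < 1 := by
  rw [Complex.norm_exp, Real.exp_lt_one_iff]
  simp
  positivity

/-- With e = exp(2πiu), each quadratic factor splits as (1 − q^m e)(1 − q^m / e). Holomorphy and
behaviour under u ↦ u + τ can then be read off from a single Euler product. -/
theorem theta_eq_eulerProd {τ : ℂ} (hτ : 0 < τ.im) (u : ℂ) :
    theta τ u = Complex.I * Complex.exp (Real.pi * Complex.I * τ / 4) *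
      eulerProd (Complex.exp (2 * Real.pi * Complex.I * τ)) 1 * Complex.sin (Real.pi * u) *
      eulerProd (Complex.exp (2 * Real.pi * Complex.I * τ)) (Complex.exp (2 * Real.pi * Complex.I * u)) *
      eulerProd (Complex.exp (2 * Real.pi * Complex.I * τ))
        (Complex.exp (2 * Real.pi * Complex.I * u))⁻¹ := by
  have hq := norm_nome_lt_one hτ
  have h1 := multipliable_eulerProd hq 1
  have h2 := multipliable_eulerProd hq (Complex.exp (2 * Real.pi * Complex.I * u))
  have h3 := multipliable_eulerProd hq (Complex.exp (2 * Real.pi * Complex.I * u))⁻¹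
  have key : eulerProd (Complex.exp (2 * Real.pi * Complex.I * τ))
        (Complex.exp (2 * Real.pi * Complex.I * u)) *
      eulerProd (Complex.exp (2 * Real.pi * Complex.I * τ))
        (Complex.exp (2 * Real.pi * Complex.I * u))⁻¹ *
      eulerProd (Complex.exp (2 * Real.pi * Complex.I * τ)) 1 =
      ∏' m : ℕ, (1 - 2 * Complex.exp (2 * Real.pi * Complex.I * τ) ^ (m + 1) *
            Complex.cos (2 * Real.pi * u)
          + Complex.exp (2 * Real.pi * Complex.I * τ) ^ (2 * (m + 1))) *
        (1 - Complex.exp (2 * Real.pi * Complex.I * τ) ^ (m + 1)) := by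
    rw [eulerProd, eulerProd, eulerProd, ← h2.tprod_mul h3, ← (h2.mul h3).tprod_mul h1]
    refine tprod_congr fun m => ?_
    rw [Complex.cos, show 2 * Real.pi * u * Complex.I = 2 * Real.pi * Complex.I * u by ring,
      show -(2 * Real.pi * u) * Complex.I = -(2 * Real.pi * Complex.I * u) by ring, Complex.exp_neg]
    have := Complex.exp_ne_zero (2 * Real.pi * Complex.I * u)
    field_simp
    ring
  rw [theta, ← key]
  ring

theorem theta_neg {τ : ℂ} (u : ℂ) : theta τ (-u) = -theta τ u := by
  simp only [theta, mul_neg, Complex.sin_neg, Complex.cos_neg, neg_mul]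

theorem theta_add_one {τ : ℂ} (u : ℂ) : theta τ (u + 1) = -theta τ u := by
  simp only [theta, mul_add, mul_one, Complex.sin_add_pi, Complex.cos_add_two_pi, mul_neg, neg_mul]

theorem differentiable_theta {τ : ℂ} (hτ : 0 < τ.im) : Differentiable ℂ (theta τ) := by
  rw [funext (theta_eq_eulerProd hτ)]
  have h := differentiable_eulerProd (norm_nome_lt_one hτ)
  have h1 := h.comp (f := fun u : ℂ => Complex.exp (2 * Real.pi * Complex.I * u)) (by fun_prop)
  have h2 := h.comp (f := fun u : ℂ => (Complex.exp (2 * Real.pi * Complex.I * u))⁻¹)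
    (by simp only [← Complex.exp_neg]; fun_prop)
  simp only [Function.comp_def] at h1 h2
  fun_prop

/-- Adding τ multiplies e = exp(2πiu) by q, so one Euler product loses its first factor and the
other gains one, by `eulerProd_step`. What remains is a rational identity in s = exp(πiu) and t =
exp(πiτ). -/
theorem theta_add_tau {τ : ℂ} (hτ : 0 < τ.im) (u : ℂ) :
    theta τ (u + τ) =
      -Complex.exp (-(Real.pi * Complex.I * τ) - 2 * Real.pi * Complex.I * u) * theta τ u := by
  have hq := norm_nome_lt_one hτ
  rw [theta_eq_eulerProd hτ, theta_eq_eulerProd hτ]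
  have hs := Complex.exp_ne_zero (Real.pi * Complex.I * u)
  have ht := Complex.exp_ne_zero (Real.pi * Complex.I * τ)
  have e1 : Complex.exp (2 * Real.pi * Complex.I * u) = Complex.exp (Real.pi * Complex.I * u) ^ 2 := by
    rw [← Complex.exp_nat_mul]; congr 1; push_cast; ring
  have e2 : Complex.exp (2 * Real.pi * Complex.I * τ) = Complex.exp (Real.pi * Complex.I * τ) ^ 2 := by
    rw [← Complex.exp_nat_mul]; congr 1; push_cast; ring
  have e3 : Complex.exp (2 * Real.pi * Complex.I * (u + τ)) =
      Complex.exp (Real.pi * Complex.I * τ) ^ 2 * Complex.exp (Real.pi * Complex.I * u) ^ 2 := by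
    rw [← e1, ← e2, ← Complex.exp_add]; congr 1; ring
  have e4 : Complex.exp (-(Real.pi * Complex.I * τ) - 2 * Real.pi * Complex.I * u) =
      (Complex.exp (Real.pi * Complex.I * τ))⁻¹ * (Complex.exp (Real.pi * Complex.I * u) ^ 2)⁻¹ := by
    rw [← e1, ← Complex.exp_neg, ← Complex.exp_neg, ← Complex.exp_add]; rfl
  have s1 : Complex.sin (Real.pi * u) = ((Complex.exp (Real.pi * Complex.I * u))⁻¹ -
      Complex.exp (Real.pi * Complex.I * u)) * Complex.I / 2 := by
    rw [Complex.sin, ← Complex.exp_neg]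
    congr 4 <;> ring_nf
  have s2 : Complex.sin (Real.pi * (u + τ)) = ((Complex.exp (Real.pi * Complex.I * τ) *
      Complex.exp (Real.pi * Complex.I * u))⁻¹ - Complex.exp (Real.pi * Complex.I * τ) *
      Complex.exp (Real.pi * Complex.I * u)) * Complex.I / 2 := by
    rw [Complex.sin, ← Complex.exp_add, ← Complex.exp_neg]
    congr 4 <;> ring_nf
  rw [e2] at hq
  rw [e1, e2, e3, e4, s1, s2]
  generalize Complex.exp (Real.pi * Complex.I * u) = s at hs
  generalize Complex.exp (Real.pi * Complex.I * τ) = t at hq ht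
  have k1 := eulerProd_step hq (s ^ 2)
  have k2 := eulerProd_step hq (t ^ 2 * s ^ 2)⁻¹
  rw [show t ^ 2 * (t ^ 2 * s ^ 2)⁻¹ = (s ^ 2)⁻¹ by field_simp] at k2
  rw [← k2, ← k1]
  field_simp
  ring

/-! ### Fourier coefficients of periodic entire functions -/

/-- The integral over a period of a 1-periodic entire function is invariant under translation. -/
theorem integral_translate {F : ℂ → ℂ} (hF : Differentiable ℂ F) (h1 : ∀ x, F (x + 1) = F x)
    (s : ℂ) : ∫ x : ℝ in 0..1, F (x + s) = ∫ x : ℝ in 0..1, F x := by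
  -- Cauchy's theorem on the rectangle with corners 0 and 1 + i Im s: the vertical sides cancel by
  -- periodicity. The real part of s is then absorbed by translating over a full period.
  have rect := Complex.integral_boundary_rect_eq_zero_of_differentiableOn F 0 (1 + s.im * Complex.I)
    hF.differentiableOn
  have e : ∀ y : ℝ, F (1 + y * Complex.I) = F (y * Complex.I) := fun y => by
    rw [add_comm, h1]
  simp [e] at rect
  have hper : Function.Periodic (fun x : ℝ => F (x + s.im * Complex.I)) 1 := fun x => by
    simp only
    rw [← h1 (x + s.im * Complex.I)]; push_cast; ring_nf
  have hsh : ∫ x : ℝ in 0..1, F (x + s) = ∫ x : ℝ in 0..1, F (x + s.im * Complex.I) := by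
    have e2 : ∀ x : ℝ, F (x + s) = (fun x : ℝ => F (x + s.im * Complex.I)) (x + s.re) := fun x => by
      conv_lhs => rw [← Complex.re_add_im s]
      simp only; push_cast; ring_nf
    simp only [e2]
    rw [intervalIntegral.integral_comp_add_right (fun x : ℝ => F (x + s.im * Complex.I))]
    have := hper.intervalIntegral_add_eq s.re 0
    simpa [add_comm] using this
  rw [hsh]
  exact (sub_eq_zero.mp rect).symm

/-- The `n`-th Fourier coefficient of a 1-periodic function. -/
noncomputable def coeffFourier (f : ℂ → ℂ) (n : ℤ) : ℂ :=
  ∫ x : ℝ in 0..1, f x * Complex.exp (-(2 * Real.pi * Complex.I * n * x))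

/-- On the circle the function is continuous with zero Fourier series, hence zero on [0, 1); the
identity theorem carries this to the whole plane. -/
theorem eq_zero_of_coeffFourier {f : ℂ → ℂ} (hf : Differentiable ℂ f) (h1 : ∀ x, f (x + 1) = f x)
    (h0 : ∀ n, coeffFourier f n = 0) : f = 0 := by
  have : Fact (0 < (1 : ℝ)) := ⟨one_pos⟩
  let g : C(AddCircle (1 : ℝ), ℂ) := ⟨AddCircle.liftIco 1 0 (fun x : ℝ => f x),
    AddCircle.liftIco_zero_continuous (by simpa using (h1 0).symm)
      (by have := hf.continuous; fun_prop)⟩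
  have hg : ∀ n, fourierCoeff g n = 0 := fun n => by
    have : fourierCoeff g n = fourierCoeffOn (lt_add_of_pos_right (0 : ℝ) one_pos) (fun x : ℝ => f x) n :=
      fourierCoeff_liftIco_eq (fun x : ℝ => f x) n
    rw [this, fourierCoeffOn_eq_integral]
    have e := h0 n
    rw [coeffFourier] at e
    simp only [fourier_coe_apply, smul_eq_mul]
    convert smul_zero _ using 2
    rw [zero_add, ← e]
    congr 1
    ext x
    rw [mul_comm]
    congr 2
    push_cast
    field_simp
    ring
  have hs := hasSum_fourier_series_of_summable (f := g)
    (by rw [funext hg]; exact summable_zero)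
  have hz : g = 0 := by
    simp only [hg, zero_smul] at hs
    exact hs.unique hasSum_zero
  have hI : ∀ x ∈ Set.Ico (0 : ℝ) (0 + 1), f x = 0 := fun x hx => by
    have := AddCircle.liftIco_coe_apply (f := fun x : ℝ => f x) hx
    rw [← this]
    exact congrArg (fun k : C(AddCircle (1 : ℝ), ℂ) => k (x : AddCircle (1 : ℝ))) hz
  have han : AnalyticOnNhd ℂ f Set.univ := fun z _ => hf.analyticAt z
  have hfreq : ∃ᶠ z in 𝓝[≠] (0 : ℂ), f z = 0 := by
    -- The points 1/(n+2) lie in (0, 1) and accumulate at 0 without reaching it.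
    have ht : Tendsto (fun n : ℕ => ((1 / ((n : ℝ) + 2) : ℝ) : ℂ)) atTop (𝓝[≠] (0 : ℂ)) := by
      refine tendsto_nhdsWithin_iff.mpr ⟨?_, .of_forall fun n => ?_⟩
      · rw [← Complex.ofReal_zero]
        refine (Complex.continuous_ofReal.tendsto 0).comp ?_
        have := (tendsto_add_atTop_iff_nat 1).mpr (tendsto_one_div_add_atTop_nhds_zero_nat (𝕜 := ℝ))
        refine this.congr fun n => ?_
        push_cast; ring_nf
      · simp only [Set.mem_compl_iff, Set.mem_singleton_iff, Complex.ofReal_eq_zero]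
        positivity
    refine ht.frequently (Eventually.frequently (.of_forall fun n => hI _ ⟨by positivity, ?_⟩))
    rw [zero_add, div_lt_one (by positivity)]
    have : (0 : ℝ) ≤ n := by positivity
    linarith
  have := han.eqOn_zero_of_preconnected_of_frequently_eq_zero isPreconnected_univ (Set.mem_univ 0) hfreq
  ext z
  exact this (Set.mem_univ z)

/-! ### Theta functions of degree two -/

/-- The space of theta functions of degree two and characteristic zero. -/
def thetaTwo (τ : ℂ) : Submodule ℂ (ℂ → ℂ) where
  carrier := {f | Differentiable ℂ f ∧ (∀ x, f (x + 1) = f x) ∧ ∀ x, f (x + τ) =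
    Complex.exp (-(2 * Real.pi * Complex.I * τ) - 4 * Real.pi * Complex.I * x) * f x}
  add_mem' := fun ⟨a1, a2, a3⟩ ⟨b1, b2, b3⟩ => ⟨a1.add b1, fun x => by simp [a2, b2],
    fun x => by simp only [Pi.add_apply, a3, b3]; ring⟩
  zero_mem' := ⟨differentiable_const 0, fun x => rfl, fun x => by simp⟩
  smul_mem' := fun c f ⟨a1, a2, a3⟩ => ⟨a1.const_smul c, fun x => by simp [a2],
    fun x => by simp only [Pi.smul_apply, smul_eq_mul, a3]; ring⟩

/-- Moving the contour by τ leaves the integral unchanged, while the multiplier of f contributes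
exp(−4πix), which raises the frequency by two. -/
theorem coeffFourier_recursion {τ : ℂ} {f : ℂ → ℂ} (hf : f ∈ thetaTwo τ) (n : ℤ) :
    coeffFourier f n = Complex.exp (-(2 * Real.pi * Complex.I * (n + 1) * τ)) *
      coeffFourier f (n + 2) := by
  obtain ⟨h0, h1, h2⟩ := hf
  have hper : ∀ x : ℂ, Complex.exp (-(2 * Real.pi * Complex.I * n * (x + 1))) =
      Complex.exp (-(2 * Real.pi * Complex.I * n * x)) := fun x => by
    rw [Complex.exp_eq_exp_iff_exists_int]
    exact ⟨-n, by push_cast; ring⟩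
  have := integral_translate (F := fun x => f x * Complex.exp (-(2 * Real.pi * Complex.I * n * x)))
    (by fun_prop) (fun x => by rw [h1, hper]) τ
  rw [coeffFourier, ← this, coeffFourier, ← intervalIntegral.integral_const_mul]
  congr 1
  ext x
  rw [h2]
  have e : Complex.exp (-(2 * Real.pi * Complex.I * τ) - 4 * Real.pi * Complex.I * x) *
      Complex.exp (-(2 * Real.pi * Complex.I * n * (x + τ))) =
      Complex.exp (-(2 * Real.pi * Complex.I * (n + 1) * τ)) *
      Complex.exp (-(2 * Real.pi * Complex.I * (n + 2 : ℤ) * x)) := by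
    rw [← Complex.exp_add, ← Complex.exp_add]
    congr 1
    push_cast
    ring
  linear_combination f x * e

/-- The recursion links indices of equal parity, so one even and one odd coefficient determine all
others, upwards and downwards. This bounds the dimension of the space by two. -/
theorem thetaTwo_eq_zero {τ : ℂ} {f : ℂ → ℂ} (hf : f ∈ thetaTwo τ) (h0 : coeffFourier f 0 = 0)
    (h1 : coeffFourier f 1 = 0) : f = 0 := by
  refine eq_zero_of_coeffFourier hf.1 hf.2.1 ?_
  have up : ∀ n : ℕ, coeffFourier f n = 0 ∧ coeffFourier f (n + 1) = 0 := fun n => by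
    induction n with
    | zero => simpa using ⟨h0, h1⟩
    | succ k ih =>
      refine ⟨by simpa using ih.2, ?_⟩
      have := coeffFourier_recursion hf k
      rw [ih.1, eq_comm, mul_eq_zero] at this
      have h := this.resolve_left (Complex.exp_ne_zero _)
      rw [← h]; rfl
  have down : ∀ n : ℕ, coeffFourier f (-n) = 0 ∧ coeffFourier f (-n + 1) = 0 := fun n => by
    induction n with
    | zero => simpa using ⟨h0, h1⟩
    | succ k ih =>
      have := coeffFourier_recursion hf (-(k + 1 : ℕ))
      rw [show (-(k + 1 : ℕ) : ℤ) + 2 = -k + 1 by push_cast; ring, ih.2, mul_zero] at this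
      refine ⟨this, ?_⟩
      rw [← ih.1]; congr 1; push_cast; ring
  intro n
  obtain ⟨m, rfl | rfl⟩ := n.eq_nat_or_neg
  exacts [(up m).1, (down m).1]

/-- The contributions of y to the two multipliers cancel, so that all these products lie in the same
space. -/
theorem mul_theta_mem_thetaTwo {τ : ℂ} (hτ : 0 < τ.im) (y : ℂ) :
    (fun x => theta τ (x + y) * theta τ (x - y)) ∈ thetaTwo τ := by
  have h := differentiable_theta hτ
  refine ⟨by fun_prop, fun x => ?_, fun x => ?_⟩
  · simp only
    rw [show x + 1 + y = x + y + 1 by ring, show x + 1 - y = x - y + 1 by ring, theta_add_one,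
      theta_add_one]
    ring
  · simp only
    rw [show x + τ + y = x + y + τ by ring, show x + τ - y = x - y + τ by ring, theta_add_tau hτ,
      theta_add_tau hτ, show ∀ a b c d : ℂ, -a * b * (-c * d) = (a * c) * (b * d) from
      fun a b c d => by ring, ← Complex.exp_add]
    congr 2
    ring

/-- Any three elements of `thetaTwo` are linearly dependent. -/
theorem thetaTwo_dependent {τ : ℂ} {f g k : ℂ → ℂ} (hf : f ∈ thetaTwo τ) (hg : g ∈ thetaTwo τ)
    (hk : k ∈ thetaTwo τ) : ∃ a b c : ℂ, (a ≠ 0 ∨ b ≠ 0 ∨ c ≠ 0) ∧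
      ∀ x, a * f x + b * g x + c * k x = 0 := by
  have hlin : ∀ (f g : ℂ → ℂ) (a b : ℂ) (n : ℤ), f ∈ thetaTwo τ → g ∈ thetaTwo τ →
      coeffFourier (a • f + b • g) n = a * coeffFourier f n + b * coeffFourier g n := by
    intro f g a b n hf hg
    have cf := hf.1.continuous
    have cg := hg.1.continuous
    rw [coeffFourier, coeffFourier, coeffFourier, ← intervalIntegral.integral_const_mul,
      ← intervalIntegral.integral_const_mul, ← intervalIntegral.integral_add]
    · congr 1; ext x; simp only [Pi.add_apply, Pi.smul_apply, smul_eq_mul]; ring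
    · exact Continuous.intervalIntegrable (by fun_prop) _ _
    · exact Continuous.intervalIntegrable (by fun_prop) _ _
  -- Two linear conditions on three unknowns; the zero third row makes the matrix square and its
  -- determinant zero.
  have hdep : ∃ v : Fin 3 → ℂ, v ≠ 0 ∧ (!![coeffFourier f 0, coeffFourier g 0, coeffFourier k 0;
      coeffFourier f 1, coeffFourier g 1, coeffFourier k 1; 0, 0, 0] : Matrix (Fin 3) (Fin 3) ℂ).mulVec v
      = 0 :=
    Matrix.exists_mulVec_eq_zero_iff.mpr (by simp [Matrix.det_fin_three])
  obtain ⟨v, hv, hv0⟩ := hdep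
  refine ⟨v 0, v 1, v 2, ?_, fun x => ?_⟩
  · by_contra hc
    push Not at hc
    exact hv (by ext i; fin_cases i <;> simp [hc])
  have e0 := congrFun hv0 0
  have e1 := congrFun hv0 1
  simp [Matrix.mulVec, dotProduct, Fin.sum_univ_three] at e0 e1
  -- The scalar 1 gives the threefold sum the two-term shape to which `hlin` applies twice.
  have hm : (1 : ℂ) • (v 0 • f + v 1 • g) + v 2 • k ∈ thetaTwo τ :=
    (thetaTwo τ).add_mem ((thetaTwo τ).smul_mem _ ((thetaTwo τ).add_mem ((thetaTwo τ).smul_mem _ hf)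
      ((thetaTwo τ).smul_mem _ hg))) ((thetaTwo τ).smul_mem _ hk)
  have hfg := (thetaTwo τ).add_mem ((thetaTwo τ).smul_mem (v 0) hf) ((thetaTwo τ).smul_mem (v 1) hg)
  have := thetaTwo_eq_zero hm
    (by rw [hlin _ _ _ _ _ hfg hk, hlin _ _ _ _ _ hf hg]; linear_combination e0)
    (by rw [hlin _ _ _ _ _ hfg hk, hlin _ _ _ _ _ hf hg]; linear_combination e1)
  simpa using congrFun this x

/-! ### Weierstrass' three-term identity -/

/-- Weierstrass' three-term identity, parametrized by `α = x + z`, `p = x + w`, `r = x + y`,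
`m = 2 x`. -/
def ThreeTerm (t : ℂ → ℂ) : Prop := ∀ α p r m : ℂ,
  t α * t (m - α) * t (r + p - m) * t (r - p) - t p * t (m - p) * t (r + α - m) * t (r - α) -
    t r * t (m - r) * t (α + p - m) * t (α - p) = 0

/-- The kernel g(y, x) = [x+y][x−y] is alternating, and its sections lie in a space where any three
elements are dependent. It is thus a 2×2 determinant in the values of two fixed sections (`interp`),
and the claim is the Plücker relation for the four points x, y, z, w. -/
theorem threeTerm_theta {τ : ℂ} (hτ : 0 < τ.im) : ThreeTerm (theta τ) := by
  have h0 : theta τ 0 = 0 := by have := theta_neg (τ := τ) 0; rw [neg_zero] at this; linear_combination this / 2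
  -- An identically vanishing function satisfies the identity trivially; otherwise a non-zero value
  -- at x0 gives g(0, x0) = [x0]² ≠ 0.
  by_cases hne : ∀ x, theta τ x = 0
  · intro α p r m; simp [hne]
  push Not at hne
  obtain ⟨x0, hx0⟩ := hne
  -- `g y x = [x + y][x - y]` does not vanish at `(y0, z0)`
  obtain ⟨g, hg⟩ : ∃ g : ℂ → ℂ → ℂ, g = fun y x => theta τ (x + y) * theta τ (x - y) := ⟨_, rfl⟩
  have anti : ∀ x y, g y x = - g x y := fun x y => by
    simp only [hg]
    rw [show x - y = -(y - x) by ring, theta_neg, add_comm]; ring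
  have self : ∀ x, g x x = 0 := fun x => by simp [hg, h0]
  obtain ⟨y0, z0, hc⟩ : ∃ y0 z0, g y0 z0 ≠ 0 := ⟨0, x0, by simp [hg, hx0]⟩
  have interp : ∀ x y, g y0 z0 * g y x = g z0 x * g y0 y - g y0 x * g z0 y := fun x y => by
    obtain ⟨a, b, c, habc, h⟩ := thetaTwo_dependent (mul_theta_mem_thetaTwo hτ y)
      (mul_theta_mem_thetaTwo hτ y0) (mul_theta_mem_thetaTwo hτ z0)
    replace h : ∀ x, a * g y x + b * g y0 x + c * g z0 x = 0 := by simpa only [hg] using h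
    have hy := h y0
    have hz := h z0
    rw [self] at hy hz
    -- If a were 0, evaluation at z0 and at y0 would force b = 0 and c = 0, because g vanishes on
    -- the diagonal but not at (y0, z0).
    have ha : a ≠ 0 := by
      rintro rfl
      have hb : b = 0 := by
        rw [zero_mul, mul_zero, add_zero, zero_add] at hz
        exact (mul_eq_zero.mp hz).resolve_right hc
      have hcc : c = 0 := by
        rw [zero_mul, mul_zero, add_zero, zero_add, anti y0 z0, mul_neg, neg_eq_zero] at hy
        exact (mul_eq_zero.mp hy).resolve_right hc
      simp [hb, hcc] at habc
    have hx := h x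
    apply mul_left_cancel₀ ha
    linear_combination g y0 z0 * hx - g y0 x * hz + g z0 x * hy - c * g z0 x * anti y0 z0 +
      a * g y0 x * anti z0 y - a * g z0 x * anti y0 y
  intro α p r m
  -- The four points are m/2, r − m/2, α − m/2 and p − m/2. Each of the six pairs of theta factors
  -- is a value of g at two of them, and each monomial of the identity collects two such values,
  -- hence the square of g(y0, z0) below.
  have E : ∀ x y X Y, x + y = X → x - y = Y → g y0 z0 * (theta τ X * theta τ Y) =
      g z0 x * g y0 y - g y0 x * g z0 y := fun x y X Y h1 h2 => by
    rw [← interp, hg, ← h1, ← h2]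
  have i1 := E (m / 2) (α - m / 2) α (m - α) (by ring) (by ring)
  have i2 := E (r - m / 2) (p - m / 2) (r + p - m) (r - p) (by ring) (by ring)
  have i3 := E (m / 2) (p - m / 2) p (m - p) (by ring) (by ring)
  have i4 := E (r - m / 2) (α - m / 2) (r + α - m) (r - α) (by ring) (by ring)
  have i5 := E (m / 2) (r - m / 2) r (m - r) (by ring) (by ring)
  have i6 := E (α - m / 2) (p - m / 2) (α + p - m) (α - p) (by ring) (by ring)
  refine (mul_eq_zero.mp ?_).resolve_left (pow_ne_zero 2 hc)
  linear_combination g y0 z0 * theta τ (r + p - m) * theta τ (r - p) * i1 +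
    (g z0 (m / 2) * g y0 (α - m / 2) - g y0 (m / 2) * g z0 (α - m / 2)) * i2 -
    g y0 z0 * theta τ (r + α - m) * theta τ (r - α) * i3 -
    (g z0 (m / 2) * g y0 (p - m / 2) - g y0 (m / 2) * g z0 (p - m / 2)) * i4 -
    g y0 z0 * theta τ (α + p - m) * theta τ (α - p) * i5 -
    (g z0 (m / 2) * g y0 (r - m / 2) - g y0 (m / 2) * g z0 (r - m / 2)) * i6

/-! ### Orthogonal pairs of weights -/

/-- `p` and `q` are weights in `P₁` on different axes. -/
def Orth (p q : Wt) : Prop := p ∈ P1 ∧ q ∈ P1 ∧ q ≠ p ∧ q ≠ -p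

/-- All combinatorics of weights is reduced to eight decidable cases here. Afterwards computations
are done for a general orthogonal pair, so that one identity serves all its images under sign
changes and exchange of axes. -/
theorem orth_cases {p q : Wt} (h : Orth p q) {C : Wt → Wt → Prop}
    (h1 : C (1, 0) (0, 1)) (h2 : C (1, 0) (0, -1)) (h3 : C (-1, 0) (0, 1)) (h4 : C (-1, 0) (0, -1))
    (h5 : C (0, 1) (1, 0)) (h6 : C (0, 1) (-1, 0)) (h7 : C (0, -1) (1, 0))
    (h8 : C (0, -1) (-1, 0)) : C p q := by
  obtain ⟨hp, hq, h1, h2⟩ := h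
  simp only [P1, Finset.mem_insert, Finset.mem_singleton] at hp hq
  rcases hp with rfl | rfl | rfl | rfl <;> rcases hq with rfl | rfl | rfl | rfl <;>
    first | assumption | simp at h1 h2

instance (p q : Wt) : Decidable (Orth p q) := by unfold Orth; infer_instance

namespace Orth

variable {p q : Wt}

theorem symm (h : Orth p q) : Orth q p :=
  orth_cases h (C := fun p q => Orth q p) (by decide) (by decide) (by decide) (by decide)
    (by decide) (by decide) (by decide) (by decide)

theorem neg_right (h : Orth p q) : Orth p (-q) :=
  orth_cases h (C := fun p q => Orth p (-q)) (by decide) (by decide) (by decide) (by decide)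
    (by decide) (by decide) (by decide) (by decide)

theorem neg_left (h : Orth p q) : Orth (-p) q := h.symm.neg_right.symm

theorem P1_eq (h : Orth p q) : P1 = {p, -p, q, -q} :=
  orth_cases h (C := fun p q => P1 = {p, -p, q, -q}) (by decide) (by decide) (by decide) (by decide)
    (by decide) (by decide) (by decide) (by decide)

theorem sum_P1 {A : Type*} [AddCommMonoid A] (h : Orth p q) (F : Wt → A) :
    ∑ x ∈ P1, F x = F p + (F (-p) + (F q + F (-q))) := by
  have hd : p ≠ -p ∧ p ≠ q ∧ p ≠ -q ∧ -p ≠ q ∧ -p ≠ -q ∧ q ≠ -q :=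
    orth_cases h (C := fun p q => p ≠ -p ∧ p ≠ q ∧ p ≠ -q ∧ -p ≠ q ∧ -p ≠ -q ∧ q ≠ -q)
      (by decide) (by decide) (by decide) (by decide)
      (by decide) (by decide) (by decide) (by decide)
  obtain ⟨h1, h2, h3, h4, h5, h6⟩ := hd
  rw [h.P1_eq, Finset.sum_insert (by simp [h1, h2, h3]), Finset.sum_insert (by simp [h4, h5]),
    Finset.sum_insert (by simp [h6]), Finset.sum_singleton]

theorem prod_P1 (h : Orth p q) (F : Wt → ℂ) :
    ∏ t ∈ P1 with t ≠ p ∧ t ≠ -p, F t = F q * F (-q) := by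
  have hf : (P1.filter fun t => t ≠ p ∧ t ≠ -p) = {q, -q} :=
    orth_cases h (C := fun p q => (P1.filter fun t => t ≠ p ∧ t ≠ -p) = {q, -q})
      (by decide) (by decide) (by decide) (by decide)
      (by decide) (by decide) (by decide) (by decide)
  have hn : q ≠ -q := orth_cases h (C := fun _ q => q ≠ -q) (by decide) (by decide) (by decide)
    (by decide) (by decide) (by decide) (by decide) (by decide)
  rw [hf, Finset.prod_pair hn]

end Orth

/-! ### The pairing and its behaviour under shifts -/

theorem pair_add (lam : Space) (p q : Wt) : pair lam (p + q) = pair lam p + pair lam q := by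
  simp only [pair, Prod.fst_add, Prod.snd_add]; push_cast; ring

theorem pair_neg (lam : Space) (p : Wt) : pair lam (-p) = -pair lam p := by
  simp only [pair, Prod.fst_neg, Prod.snd_neg]; push_cast; ring

theorem pair_sub (lam : Space) (p q : Wt) : pair lam (p - q) = pair lam p - pair lam q := by
  rw [sub_eq_add_neg, pair_add, pair_neg, sub_eq_add_neg]

theorem shift_zero (ℏ : ℂ) (lam : Space) : shift ℏ lam 0 = lam := by
  simp [shift]

theorem shift_shift (ℏ : ℂ) (lam : Space) (p q : Wt) :
    shift ℏ (shift ℏ lam p) q = shift ℏ lam (p + q) := by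
  simp only [shift, Prod.fst_add, Prod.snd_add]; push_cast; ext <;> simp only <;> ring

theorem pair_shift_self (ℏ : ℂ) (lam : Space) {p : Wt} (hp : p ∈ P1) :
    pair (shift ℏ lam p) p = pair lam p + ℏ := by
  simp only [P1, Finset.mem_insert, Finset.mem_singleton] at hp
  rcases hp with rfl | rfl | rfl | rfl <;> simp [pair, shift] <;> ring

theorem pair_shift_orth (ℏ : ℂ) (lam : Space) {p q : Wt} (h : Orth p q) :
    pair (shift ℏ lam p) q = pair lam q :=
  orth_cases h (C := fun p q => pair (shift ℏ lam p) q = pair lam q) (by simp [pair, shift])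
    (by simp [pair, shift]) (by simp [pair, shift]) (by simp [pair, shift]) (by simp [pair, shift])
    (by simp [pair, shift]) (by simp [pair, shift]) (by simp [pair, shift])

/-! ### The weights of type `(1, 1)` in coordinates `a = λ_p`, `b = λ_q` -/

section weights

variable (t : ℂ → ℂ) (h : ℂ)

/-- The weight of `e_p ⊗ e_p`. -/
noncomputable def wA (u : ℂ) : ℂ := t (u + 3 * h) * t (u + h) / (t (3 * h) * t h)

/-- The weight `e_p ⊗ e_q ↦ e_p ⊗ e_q`. -/
noncomputable def wD (a b u : ℂ) : ℂ := t (u + 3 * h) * t (a - b - u) / (t (3 * h) * t (a - b))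

/-- The weight `e_p ⊗ e_q ↦ e_q ⊗ e_p`. -/
noncomputable def wE (a b u : ℂ) : ℂ :=
  t (u + 3 * h) * t u * t (b - a + h) / (t (3 * h) * t h * t (b - a))

/-- The weight `e_p ⊗ e_{-p} ↦ e_q ⊗ e_{-q}`. -/
noncomputable def wX (a b u : ℂ) : ℂ :=
  t u * t (a + b - 2 * h - u) * t (2 * b + 2 * h) * t (b - a + h) /
    (t (3 * h) * t (2 * a) * t (a + b) * t (a - b))

/-- The weight `e_p ⊗ e_{-p} ↦ e_{-p} ⊗ e_p`. -/
noncomputable def wZ (a b u : ℂ) : ℂ :=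
  t u * t (-2 * h - u) * t (2 * h - 2 * a) * t (h - a + b) * t (h - a - b) /
    (t (3 * h) * t h * t (2 * a) * t (a + b) * t (a - b))

/-- The weight `e_p ⊗ e_{-p} ↦ e_p ⊗ e_{-p}`. -/
noncomputable def wY (a b u : ℂ) : ℂ :=
  t (u + 3 * h) * t (2 * a + h - u) / (t (3 * h) * t (2 * a + h)) +
    t u * t (2 * a - 2 * h - u) * t (2 * a + 2 * h) * t (a + b + h) * t (a - b + h) /
      (t (3 * h) * t (2 * a + h) * t (2 * a) * t (a + b) * t (a - b))

end weights

section W11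

variable {τ ℏ : ℂ} {lam : Space} {p q : Wt}

theorem W11_eq_zero {p q s r : Wt} (u : ℂ) (h : r ∉ P1) : W11 τ ℏ lam p q s r u = 0 := by
  simp [W11, h]

theorem theta_crossing_sub (u : ℂ) : theta τ (crossing ℏ - u) = -theta τ (u + 3 * ℏ) := by
  rw [← theta_neg, crossing]; congr 1; ring

theorem theta_crossing : theta τ (crossing ℏ) = -theta τ (3 * ℏ) := by
  rw [← theta_neg, crossing]; congr 1; ring

theorem W11_same (hp : p ∈ P1) (u : ℂ) : W11 τ ℏ lam p p p p u = wA (theta τ) ℏ u := by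
  rw [W11, if_neg (by simp [hp]), if_pos rfl, theta_crossing_sub, theta_crossing, wA]
  rw [neg_mul, neg_mul, neg_div_neg_eq]

theorem W11_diag (h : Orth p q) (u : ℂ) :
    W11 τ ℏ lam p q p q u = wD (theta τ) ℏ (pair lam p) (pair lam q) u := by
  rw [W11, if_neg (by simp [h.1, h.2.1]), if_neg h.2.2.1, if_pos h.2.2.2, if_pos rfl,
    theta_crossing_sub, theta_crossing, wD, pair_sub]
  rw [neg_mul, neg_mul, neg_div_neg_eq]

theorem W11_exch (h : Orth p q) (u : ℂ) :
    W11 τ ℏ lam p q q p u = wE (theta τ) ℏ (pair lam p) (pair lam q) u := by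
  rw [W11, if_neg (by simp [h.1, h.2.1, add_comm]), if_neg h.2.2.1, if_pos h.2.2.2,
    if_neg h.2.2.1, theta_crossing_sub, theta_crossing, wE, pair_sub]
  simp only [neg_mul, neg_div_neg_eq]

theorem neg_ne_self_of_mem_P1 (hp : p ∈ P1) : -p ≠ p := by
  simp only [P1, Finset.mem_insert, Finset.mem_singleton] at hp
  rcases hp with rfl | rfl | rfl | rfl <;> decide

/-- The factor [λ_{p+q} + ħ] in the denominator reappears in the product over the weights orthogonal
to q; the non-vanishing hypothesis is what allows it to be cancelled. -/
theorem W11_cross (h : Orth p q) (u : ℂ)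
    (h0 : theta τ (pair lam p + pair lam q + ℏ) ≠ 0) :
    W11 τ ℏ lam p (-p) q (-q) u = wX (theta τ) ℏ (pair lam p) (pair lam q) u := by
  rw [W11, if_neg (by simp [h.1, h.2.1, h.neg_left.1, h.neg_right.2.1]),
    if_neg (neg_ne_self_of_mem_P1 h.1), if_neg (by simp), if_pos h.2.2.1, h.prod_P1,
    h.symm.prod_P1, theta_crossing, wX]
  simp only [pair_add, pair_neg]
  rw [show pair lam q + pair lam p + ℏ + crossing ℏ - u = pair lam p + pair lam q - 2 * ℏ - u by
    rw [crossing]; ring, show pair lam q + pair lam p = pair lam p + pair lam q by ring,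
    ← sub_eq_add_neg, ← sub_eq_add_neg]
  field_simp

/-- This is the same branch of the weight as for two different axes, but with s = −p, where [λ_{s+p}
+ ħ] degenerates to [ħ]. Hence no such cancellation takes place. -/
theorem W11_flip (h : Orth p q) (u : ℂ) :
    W11 τ ℏ lam p (-p) (-p) p u = wZ (theta τ) ℏ (pair lam p) (pair lam q) u := by
  have hn := neg_ne_self_of_mem_P1 h.1
  rw [W11, if_neg (by simp [h.1, h.neg_left.1, add_comm]), if_neg hn, if_neg (by simp), if_pos hn,
    h.prod_P1, h.neg_left.prod_P1, theta_crossing, wZ]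
  simp only [pair_add, pair_neg]
  rw [show -pair lam p + pair lam p + ℏ + crossing ℏ - u = -2 * ℏ - u by rw [crossing]; ring,
    show -pair lam p + pair lam p + ℏ = ℏ by ring,
    show 2 * -pair lam p + 2 * ℏ = 2 * ℏ - 2 * pair lam p by ring,
    show -pair lam p + pair lam q + ℏ = ℏ - pair lam p + pair lam q by ring,
    show -pair lam p + -pair lam q + ℏ = ℏ - pair lam p - pair lam q by ring, ← sub_eq_add_neg]
  simp only [div_eq_mul_inv, mul_inv]
  ring

theorem W11_stay (h : Orth p q) (u : ℂ) :
    W11 τ ℏ lam p (-p) p (-p) u = wY (theta τ) ℏ (pair lam p) (pair lam q) u := by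
  have hn := neg_ne_self_of_mem_P1 h.1
  rw [W11, if_neg (by simp [h.1, h.neg_left.1]), if_neg hn, if_neg (by simp), if_neg (by simp),
    h.prod_P1, theta_crossing_sub, theta_crossing, wY]
  simp only [pair_add, pair_neg]
  rw [show 2 * pair lam p + ℏ + crossing ℏ - u = 2 * pair lam p - 2 * ℏ - u by rw [crossing]; ring,
    ← sub_eq_add_neg]
  simp only [neg_mul, div_eq_mul_inv, mul_inv]
  ring

end W11

/-! ### The face operators on paths with three and four steps -/

section paths

variable {τ ℏ : ℂ} {lam : Space}

theorem faceOp_three_zero (u : ℂ) (φ : PathVec 3) (x : Fin 3 → Wt) :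
    faceOp τ ℏ (k := 1) 0 u lam φ x =
      ∑ p ∈ P1, ∑ q ∈ P1, W11 τ ℏ lam p q (x 0) (x 1) u * φ ![p, q, x 2] := by
  simp only [faceOp, LinearMap.coe_mk, AddHom.coe_mk]
  refine Finset.sum_congr rfl fun p _ => Finset.sum_congr rfl fun q _ => ?_
  congr 2
  · simp [shift_zero]
  · ext i <;> fin_cases i <;> simp [Function.update]

theorem faceOp_three_one (u : ℂ) (φ : PathVec 3) (x : Fin 3 → Wt) :
    faceOp τ ℏ (k := 1) 1 u lam φ x =
      ∑ p ∈ P1, ∑ q ∈ P1, W11 τ ℏ (shift ℏ lam (x 0)) p q (x 1) (x 2) u * φ ![x 0, p, q] := by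
  have h0 : (Finset.univ.filter fun i : Fin 3 => i < 1) = {0} := by decide
  simp only [faceOp, LinearMap.coe_mk, AddHom.coe_mk]
  refine Finset.sum_congr rfl fun p _ => Finset.sum_congr rfl fun q _ => ?_
  congr 2
  · change shift ℏ lam (∑ i with i < (1 : Fin 3), x i) = _
    rw [h0, Finset.sum_singleton]
  · ext i <;> fin_cases i <;> simp [Function.update]

theorem faceOp_four_zero (u : ℂ) (φ : PathVec 4) (x : Fin 4 → Wt) :
    faceOp τ ℏ (k := 2) 0 u lam φ x =
      ∑ p ∈ P1, ∑ q ∈ P1, W11 τ ℏ lam p q (x 0) (x 1) u * φ ![p, q, x 2, x 3] := by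
  simp only [faceOp, LinearMap.coe_mk, AddHom.coe_mk]
  refine Finset.sum_congr rfl fun p _ => Finset.sum_congr rfl fun q _ => ?_
  congr 2
  · simp [shift_zero]
  · ext i <;> fin_cases i <;> simp [Function.update]

theorem faceOp_four_one (u : ℂ) (φ : PathVec 4) (x : Fin 4 → Wt) :
    faceOp τ ℏ (k := 2) 1 u lam φ x =
      ∑ p ∈ P1, ∑ q ∈ P1,
        W11 τ ℏ (shift ℏ lam (x 0)) p q (x 1) (x 2) u * φ ![x 0, p, q, x 3] := by
  have h0 : (Finset.univ.filter fun i : Fin 4 => i < 1) = {0} := by decide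
  simp only [faceOp, LinearMap.coe_mk, AddHom.coe_mk]
  refine Finset.sum_congr rfl fun p _ => Finset.sum_congr rfl fun q _ => ?_
  congr 2
  · change shift ℏ lam (∑ i with i < (1 : Fin 4), x i) = _
    rw [h0, Finset.sum_singleton]
  · ext i <;> fin_cases i <;> simp [Function.update]

theorem faceOp_four_two (u : ℂ) (φ : PathVec 4) (x : Fin 4 → Wt) :
    faceOp τ ℏ (k := 2) 2 u lam φ x =
      ∑ p ∈ P1, ∑ q ∈ P1,
        W11 τ ℏ (shift ℏ lam (x 0 + x 1)) p q (x 2) (x 3) u * φ ![x 0, x 1, p, q] := by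
  have h0 : (Finset.univ.filter fun i : Fin 4 => i < 2) = {0, 1} := by decide
  simp only [faceOp, LinearMap.coe_mk, AddHom.coe_mk]
  refine Finset.sum_congr rfl fun p _ => Finset.sum_congr rfl fun q _ => ?_
  congr 2
  · simp [h0]
  · ext i <;> fin_cases i <;> simp [Function.update]

end paths

/-! ### Restriction of a theta function to a lattice -/

/-- The two properties of the theta function used below: oddness and the three-term identity. -/
structure ThetaLike (t : ℂ → ℂ) : Prop where
  odd : ∀ x, t (-x) = -t x
  three : ThreeTerm t

theorem thetaLike_theta {τ : ℂ} (hτ : 0 < τ.im) : ThetaLike (theta τ) :=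
  ⟨theta_neg, threeTerm_theta hτ⟩

/-- Non-vanishing of the denominators for an orthogonal pair with coordinates `a, b`. -/
structure NonVanishing (t : ℂ → ℂ) (h a b : ℂ) : Prop where
  step : ∀ k : ℤ, k ≠ 0 → t (k * h) ≠ 0
  left : ∀ k : ℤ, t (2 * a + k * h) ≠ 0
  right : ∀ k : ℤ, t (2 * b + k * h) ≠ 0
  plus : ∀ k : ℤ, t (a + b + k * h) ≠ 0
  minus : ∀ k : ℤ, t (a - b + k * h) ≠ 0

/-- The lattice of integral combinations of the four variables `u, a, b, h`. -/
abbrev Lat : Type := ℤ × ℤ × ℤ × ℤ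

/-- The homomorphism `ℤ⁴ → ℂ` with values `u, a, b, h` at the standard basis. -/
noncomputable def latticeHom (u a b h : ℂ) : Lat →+ ℂ where
  toFun v := v.1 * u + v.2.1 * a + v.2.2.1 * b + v.2.2.2 * h
  map_zero' := by simp
  map_add' v w := by simp only [Prod.fst_add, Prod.snd_add]; push_cast; ring

section lattice

variable (ev : Lat →+ ℂ)

theorem ev_two (i j k l : ℤ) : 2 * ev (i, j, k, l) = ev (2 * i, 2 * j, 2 * k, 2 * l) := by
  rw [show ((2 * i, 2 * j, 2 * k, 2 * l) : Lat) = 2 • (i, j, k, l) by simp, map_nsmul]; simp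

theorem ev_three (i j k l : ℤ) : 3 * ev (i, j, k, l) = ev (3 * i, 3 * j, 3 * k, 3 * l) := by
  rw [show ((3 * i, 3 * j, 3 * k, 3 * l) : Lat) = 3 • (i, j, k, l) by simp, map_nsmul]; simp

theorem ev_four (i j k l : ℤ) : 4 * ev (i, j, k, l) = ev (4 * i, 4 * j, 4 * k, 4 * l) := by
  rw [show ((4 * i, 4 * j, 4 * k, 4 * l) : Lat) = 4 • (i, j, k, l) by simp, map_nsmul]; simp

theorem ev_five (i j k l : ℤ) : 5 * ev (i, j, k, l) = ev (5 * i, 5 * j, 5 * k, 5 * l) := by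
  rw [show ((5 * i, 5 * j, 5 * k, 5 * l) : Lat) = 5 • (i, j, k, l) by simp, map_nsmul]; simp

theorem ev_six (i j k l : ℤ) : 6 * ev (i, j, k, l) = ev (6 * i, 6 * j, 6 * k, 6 * l) := by
  rw [show ((6 * i, 6 * j, 6 * k, 6 * l) : Lat) = 6 • (i, j, k, l) by simp, map_nsmul]; simp

theorem ev_add (i j k l i' j' k' l' : ℤ) : ev (i, j, k, l) + ev (i', j', k', l') =
    ev (i + i', j + j', k + k', l + l') := by
  rw [← map_add]; rfl

theorem ev_sub (i j k l i' j' k' l' : ℤ) : ev (i, j, k, l) - ev (i', j', k', l') =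
    ev (i - i', j - j', k - k', l - l') := by
  rw [← map_sub]; rfl

theorem ev_neg (i j k l : ℤ) : -ev (i, j, k, l) = ev (-i, -j, -k, -l) := by
  rw [← map_neg]; rfl

end lattice

/-- A function on the lattice that is the restriction of a theta function with the
non-vanishing property. -/
structure LatticeTheta (L : Lat → ℂ) : Prop where
  odd : ∀ i j k l, L (i, j, k, l) = -L (-i, -j, -k, -l)
  three : ∀ α p r m : Lat,
    L α * L (m - α) * L (r + p - m) * L (r - p) - L p * L (m - p) * L (r + α - m) * L (r - α) -
      L r * L (m - r) * L (α + p - m) * L (α - p) = 0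
  step : ∀ k : ℤ, k ≠ 0 → L (0, 0, 0, k) ≠ 0
  left : ∀ k : ℤ, L (0, 2, 0, k) ≠ 0
  right : ∀ k : ℤ, L (0, 0, 2, k) ≠ 0
  plus : ∀ k : ℤ, L (0, 1, 1, k) ≠ 0
  minus : ∀ k : ℤ, L (0, 1, -1, k) ≠ 0

namespace LatticeTheta

variable {L : Lat → ℂ} (hL : LatticeTheta L)

/-- Together with its three companions this makes the first non-zero coordinate positive, so that v
and −v are represented by the same atom. The sign condition keeps the rewriting from looping. -/
theorem neg₁ (hL : LatticeTheta L) (i j k l : ℤ) (_ : i < 0) :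
    L (i, j, k, l) = -L (-i, -j, -k, -l) := hL.odd i j k l

theorem neg₂ (hL : LatticeTheta L) (j k l : ℤ) (_ : j < 0) :
    L (0, j, k, l) = -L (0, -j, -k, -l) := by
  simpa using hL.odd 0 j k l

theorem neg₃ (hL : LatticeTheta L) (k l : ℤ) (_ : k < 0) : L (0, 0, k, l) = -L (0, 0, -k, -l) := by
  simpa using hL.odd 0 0 k l

theorem neg₄ (hL : LatticeTheta L) (l : ℤ) (_ : l < 0) : L (0, 0, 0, l) = -L (0, 0, 0, -l) := by
  simpa using hL.odd 0 0 0 l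

end LatticeTheta

/-- Once u, a, b, h are values at basis vectors, every theta argument evaluates to a literal integer
vector. Equal arguments become syntactically equal, and a theta identity becomes a rational identity
in finitely many atoms. -/
theorem ThetaLike.lattice {t : ℂ → ℂ} (ht : ThetaLike t) {h a b : ℂ} (nv : NonVanishing t h a b)
    (u : ℂ) : ∃ (ev : Lat →+ ℂ) (L : Lat → ℂ), ev (1, 0, 0, 0) = u ∧ ev (0, 1, 0, 0) = a ∧
      ev (0, 0, 1, 0) = b ∧ ev (0, 0, 0, 1) = h ∧ (∀ v, t (ev v) = L v) ∧ LatticeTheta L := by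
  refine ⟨latticeHom u a b h, fun v => t (latticeHom u a b h v), by simp [latticeHom],
    by simp [latticeHom], by simp [latticeHom], by simp [latticeHom], fun _ => rfl, ?_⟩
  constructor
  · intro i j k l
    rw [← ht.odd, ← map_neg]; simp
  · intro α p r m
    simpa only [map_add, map_sub] using ht.three (latticeHom u a b h α) (latticeHom u a b h p)
      (latticeHom u a b h r) (latticeHom u a b h m)
  · simpa [latticeHom] using nv.step
  · simpa [latticeHom] using nv.left
  · simpa [latticeHom] using nv.right
  · simpa [latticeHom] using nv.plus
  · simpa [latticeHom, sub_eq_add_neg] using nv.minus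

/-! ### Action of the face operators on basis paths -/

/-- The basis path with steps `x, y, z`. -/
def e3 (x y z : Wt) : PathVec 3 := fun w => eVec x (w 0) * eVec y (w 1) * eVec z (w 2)

section

variable {τ ℏ : ℂ} {lam : Space}

theorem sum_P1_mul_eVec {x : Wt} (hx : x ∈ P1) (F : Wt → ℂ) :
    ∑ p ∈ P1, F p * eVec x p = F x := by
  simp [eVec, hx]

/-- The bottom edge is forced by the other three, so a column of the matrix of weights is a single
sum over the left edge. -/
theorem sum_W11 {p q : Wt} (u : ℂ) (x y : Wt) :
    W11 τ ℏ lam p q x y u = ∑ s ∈ P1, W11 τ ℏ lam p q s (p + q - s) u *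
      (eVec s x * eVec (p + q - s) y) := by
  by_cases hx : x ∈ P1
  · rw [Finset.sum_eq_single x]
    · by_cases hy : y = p + q - x
      · simp [eVec, hy]
      · rw [show eVec (p + q - x) y = 0 by simp [eVec, hy], mul_zero, mul_zero, W11, if_pos]
        rintro ⟨-, -, -, -, h⟩
        exact hy (by rw [h]; abel)
    · intro s _ hs
      simp [eVec, Ne.symm hs]
    · exact fun h => absurd hx h
  · rw [Finset.sum_eq_zero]
    · simp [W11, hx]
    · intro s hs
      have : x ≠ s := fun h => hx (h ▸ hs)
      simp [eVec, this]

theorem faceOp_zero_e3 {p q : Wt} (hp : p ∈ P1) (hq : q ∈ P1) (r : Wt) (u : ℂ) :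
    faceOp τ ℏ (k := 1) 0 u lam (e3 p q r) =
      ∑ s ∈ P1, W11 τ ℏ lam p q s (p + q - s) u • e3 s (p + q - s) r := by
  ext x
  rw [faceOp_three_zero]
  have : ∀ p' q', W11 τ ℏ lam p' q' (x 0) (x 1) u * e3 p q r ![p', q', x 2] =
      (W11 τ ℏ lam p' q' (x 0) (x 1) u * eVec r (x 2) * eVec p p') * eVec q q' := fun p' q' => by
    simp [e3]; ring
  simp only [this, sum_P1_mul_eVec hq]
  rw [sum_P1_mul_eVec hp (fun p' => W11 τ ℏ lam p' q (x 0) (x 1) u * eVec r (x 2)), sum_W11,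
    Finset.sum_mul, Finset.sum_apply]
  exact Finset.sum_congr rfl fun s _ => by simp only [Pi.smul_apply, smul_eq_mul, e3]; ring

theorem faceOp_one_e3 {p q : Wt} (hp : p ∈ P1) (hq : q ∈ P1) (r : Wt) (u : ℂ) :
    faceOp τ ℏ (k := 1) 1 u lam (e3 r p q) =
      ∑ s ∈ P1, W11 τ ℏ (shift ℏ lam r) p q s (p + q - s) u • e3 r s (p + q - s) := by
  ext x
  rw [faceOp_three_one]
  have : ∀ p' q', W11 τ ℏ (shift ℏ lam (x 0)) p' q' (x 1) (x 2) u * e3 r p q ![x 0, p', q'] =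
      (W11 τ ℏ (shift ℏ lam r) p' q' (x 1) (x 2) u * eVec r (x 0) * eVec p p') * eVec q q' :=
    fun p' q' => by
      by_cases hr : x 0 = r
      · simp [e3, hr]; ring
      · simp [e3, eVec, hr]
  simp only [this, sum_P1_mul_eVec hq]
  rw [sum_P1_mul_eVec hp (fun p' => W11 τ ℏ (shift ℏ lam r) p' q (x 1) (x 2) u * eVec r (x 0)),
    sum_W11, Finset.sum_mul, Finset.sum_apply]
  exact Finset.sum_congr rfl fun s _ => by simp only [Pi.smul_apply, smul_eq_mul, e3]; ring

section expand

variable {V : Type*} [AddCommGroup V] [Module ℂ V] {p q : Wt} (E : Wt → Wt → V) (u : ℂ)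

theorem Orth.two_add_notMem (h : Orth p q) : p + q + p ∉ P1 :=
  orth_cases h (C := fun p q => p + q + p ∉ P1) (by decide) (by decide) (by decide) (by decide)
    (by decide) (by decide) (by decide) (by decide)

theorem Orth.add_self_sub_notMem (h : Orth p q) :
    p + p - -p ∉ P1 ∧ p + p - q ∉ P1 ∧ p + p - -q ∉ P1 :=
  orth_cases h (C := fun p q => p + p - -p ∉ P1 ∧ p + p - q ∉ P1 ∧ p + p - -q ∉ P1) (by decide)
    (by decide) (by decide) (by decide) (by decide) (by decide) (by decide) (by decide)

theorem sum_W11_orth (h : Orth p q) :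
    ∑ s ∈ P1, W11 τ ℏ lam p q s (p + q - s) u • E s (p + q - s) =
      wD (theta τ) ℏ (pair lam p) (pair lam q) u • E p q +
        wE (theta τ) ℏ (pair lam p) (pair lam q) u • E q p := by
  rw [h.sum_P1, sub_neg_eq_add, sub_neg_eq_add, W11_eq_zero u h.two_add_notMem,
    W11_eq_zero (r := p + q + q) u (by rw [add_comm p q]; exact h.symm.two_add_notMem),
    add_sub_cancel_left, add_sub_cancel_right, W11_diag h, W11_exch h]
  simp

theorem sum_W11_same (h : Orth p q) :
    ∑ s ∈ P1, W11 τ ℏ lam p p s (p + p - s) u • E s (p + p - s) =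
      wA (theta τ) ℏ u • E p p := by
  obtain ⟨h1, h2, h3⟩ := h.add_self_sub_notMem
  rw [h.sum_P1, W11_eq_zero u h1, W11_eq_zero u h2, W11_eq_zero u h3, add_sub_cancel_right,
    W11_same h.1]
  simp

theorem sum_W11_opp (h : Orth p q) (h1 : theta τ (pair lam p + pair lam q + ℏ) ≠ 0)
    (h2 : theta τ (pair lam p + -pair lam q + ℏ) ≠ 0) :
    ∑ s ∈ P1, W11 τ ℏ lam p (-p) s (p + -p - s) u • E s (p + -p - s) =
      wY (theta τ) ℏ (pair lam p) (pair lam q) u • E p (-p) +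
        (wZ (theta τ) ℏ (pair lam p) (pair lam q) u • E (-p) p +
        (wX (theta τ) ℏ (pair lam p) (pair lam q) u • E q (-q) +
        wX (theta τ) ℏ (pair lam p) (-pair lam q) u • E (-q) q)) := by
  rw [← pair_neg] at h2
  have h3 := W11_cross h.neg_right u h2
  simp only [neg_neg] at h3
  rw [h.sum_P1]
  simp only [add_neg_cancel, zero_sub, neg_neg]
  rw [W11_stay h, W11_flip h, W11_cross h u h1, h3, pair_neg]

end expand

theorem fVec_zero (x y : Wt) : fVec τ ℏ lam 0 x y =
    ∑ a ∈ P1, theta τ (2 * pair lam a + 2 * ℏ) * (eVec a x * eVec (-a) y) := by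
  have hneg : ∀ a ∈ P1, -a ∈ P1 := by decide
  by_cases hx : x ∈ P1
  · rw [Finset.sum_eq_single x]
    · by_cases hy : y = -x
      · subst hy
        simp [fVec, eVec, hx, hneg x hx]
      · have : x + y ≠ 0 := fun h => hy (eq_neg_of_add_eq_zero_right h)
        simp [fVec, eVec, hy, this]
    · intro s _ hs
      simp [eVec, Ne.symm hs]
    · exact fun h => absurd hx h
  · rw [Finset.sum_eq_zero]
    · simp [fVec, hx]
    · intro s hs
      have : x ≠ s := fun h => hx (h ▸ hs)
      simp [eVec, this]

theorem fVec_add {p q : Wt} (h : Orth p q) (x y : Wt) : fVec τ ℏ lam (p + q) x y =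
    theta τ (pair lam p - pair lam q + ℏ) * (eVec p x * eVec q y) +
      theta τ (pair lam q - pair lam p + ℏ) * (eVec q x * eVec p y) := by
  have hne : p + q ≠ 0 ∧ (∀ x ∈ P1, ∀ y ∈ P1, x + y = p + q → (x = p ∧ y = q) ∨ (x = q ∧ y = p)) ∧
      p ≠ q :=
    orth_cases h (C := fun p q => p + q ≠ 0 ∧
      (∀ x ∈ P1, ∀ y ∈ P1, x + y = p + q → (x = p ∧ y = q) ∨ (x = q ∧ y = p)) ∧ p ≠ q)
      (by decide) (by decide) (by decide) (by decide) (by decide) (by decide) (by decide)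
      (by decide)
  obtain ⟨h0, h1, h2⟩ := hne
  rw [fVec]
  split_ifs with hc
  · obtain ⟨hx, hy, hxy⟩ := hc
    rcases h1 x hx y hy hxy with ⟨rfl, rfl⟩ | ⟨rfl, rfl⟩
    · simp [eVec, h2, pair_sub]
    · simp [eVec, h2.symm, pair_sub]
  · by_cases c1 : x = p ∧ y = q
    · exact absurd ⟨c1.1 ▸ h.1, c1.2 ▸ h.2.1, by rw [c1.1, c1.2]⟩ hc
    · by_cases c2 : x = q ∧ y = p
      · exact absurd ⟨c2.1 ▸ h.2.1, c2.2 ▸ h.1, by rw [c2.1, c2.2, add_comm]⟩ hc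
      · simp only [eVec]
        split_ifs <;> simp_all

end

set_option linter.unusedSimpArgs false

/-! ### The coefficients of the fused operator on `e ⊗ f̄`, in coordinates `a = λ_p`, `b = λ_q` -/

section coefficients

variable (t : ℂ → ℂ) (h : ℂ)

/-- The common factor of all fused coefficients. -/
noncomputable def g (u : ℂ) : ℂ := t u * t (u + 2 * h) * t (u + 4 * h) / (t h ^ 2 * t (3 * h) ^ 2)

/-- The coefficient of `e_p ⊗ f̄_0 ↦ f̄_0 ⊗ e_p`. -/
noncomputable def c00 (a b u : ℂ) : ℂ :=
  t (u + 2 * h) * t (a + b - h) * t (a - b - h) / (t (a + b) * t (a - b))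

/-- The coefficient of `e_p ⊗ f̄_0 ↦ f̄_{p+q} ⊗ e_{-q}`. -/
noncomputable def c0p (a b u : ℂ) : ℂ :=
  t (u + h - a - b) * t (2 * h) * t (2 * b + 2 * h) / (t (a + b) * t (a - b))

/-- The coefficient of `e_p ⊗ f̄_{q-p} ↦ f̄_0 ⊗ e_q`. -/
noncomputable def cm0 (a b u : ℂ) : ℂ :=
  -(t (u + 2 * h - a + b) * t h * t (a + b - h)) / (t (a - b) * t (2 * a))

/-- The coefficient of `e_p ⊗ f̄_{q-p} ↦ f̄_{q-p} ⊗ e_p`. -/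
noncomputable def cmm (a b u : ℂ) : ℂ :=
  t (u + h) * t (a - b - 2 * h) * t (2 * a - 2 * h) / (t (a - b) * t (2 * a))

/-- The coefficient of `e_p ⊗ f̄_{q-p} ↦ f̄_{p+q} ⊗ e_{-p}`. -/
noncomputable def cmp (a b u : ℂ) : ℂ :=
  t (u + h - 2 * a) * t (2 * h) * t (a + b + 2 * h) / (t (a - b) * t (2 * a))

end coefficients

/-! ### Theta identities for the image of e ⊗ f̄ -/

/-- The suffix of these lemmas names a path, with `n` for a minus sign: the component of the image
of e_p ⊗ f̄_0 along that path is compared with the expected one. `fuseAdd` and `fuseSub` do the same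
for f̄_{p+q} and f̄_{q−p}. Here only one intermediate path contributes and both sides are equal
products. -/
theorem fuseZero_np_p_p {t : ℂ → ℂ} (ht : ThetaLike t) {h a b : ℂ}
    (nv : NonVanishing t h a b) (u : ℂ) :
    t (2 * (-(a + h)) + 2 * h) * wZ t h a b u * wA t h (u + h) = g t h u * c00 t h a b u *
      t (2 * (-a) + 2 * h) := by
  obtain ⟨ev, L, rfl, rfl, rfl, rfl, hv, hL⟩ := ht.lattice nv u
  simp only [c00, g, wA, wZ, neg_mul, mul_neg, ev_two, ev_three, ev_four,
    ev_five, ev_six, ev_add, ev_sub, ev_neg, hv, Int.reduceMul, Int.reduceAdd, Int.reduceSub,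
    Int.reduceNeg, Int.reduceLT, neg_zero, hL.neg₁, hL.neg₂, hL.neg₃, hL.neg₄]
  have n0_0_1 := hL.step 1 (by norm_num)
  have n0_0_3 := hL.step 3 (by norm_num)
  have n1_m1_0 := hL.minus 0
  have n1_1_0 := hL.plus 0
  have n2_0_0 := hL.left 0
  field_simp

theorem fuseZero_p_np_p {t : ℂ → ℂ} (ht : ThetaLike t) {h a b : ℂ}
    (nv : NonVanishing t h a b) (u : ℂ) :
    t (2 * (a + h) + 2 * h) * wA t h u * wZ t h (a + h) b (u + h) + t (2 * (-(a + h)) + 2 * h) *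
      wY t h a b u * wY t h (-(a + h)) b (u + h) + t (2 * b + 2 * h) * wD t h a b u *
      wX t h b (-(a + h)) (u + h) + t (2 * (-b) + 2 * h) * wD t h a (-b) u *
      wX t h (-b) (-(a + h)) (u + h) = g t h u * c00 t h a b u * t (2 * a + 2 * h) := by
  obtain ⟨ev, L, rfl, rfl, rfl, rfl, hv, hL⟩ := ht.lattice nv u
  simp only [c00, g, wA, wD, wX, wY, wZ, neg_mul, mul_neg, ev_two, ev_three, ev_four,
    ev_five, ev_six, ev_add, ev_sub, ev_neg, hv, Int.reduceMul, Int.reduceAdd, Int.reduceSub,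
    Int.reduceNeg, Int.reduceLT, neg_zero, hL.neg₁, hL.neg₂, hL.neg₃, hL.neg₄]
  -- Instances of the three-term identity, with arguments written in the basis u, a, b, h. They form
  -- a certificate: the cofactors in the proof of `key` express the cleared identity through them.
  -- The later theta identities follow the same scheme.
  have r1 := hL.three (0, 1, -1, 2) (0, 1, -1, 1) (1, 2, 0, 5) (0, 3, -1, 3)
  have r2 := hL.three (0, 0, 0, 1) (0, -2, 0, -1) (1, 0, 0, 4) (0, 0, 0, 2)
  have r3 := hL.three (0, 2, 0, 1) (0, 2, 0, 2) (1, 2, 0, 4) (0, 4, 0, 5)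
  have r4 := hL.three (0, 1, -1, 0) (0, 1, -1, -1) (1, 1, -1, 2) (0, 2, -2, 0)
  have r5 := hL.three (0, 0, 2, 2) (0, 0, 2, 0) (1, 1, 1, 4) (0, 2, 2, 4)
  have r6 := hL.three (0, 0, 2, -2) (0, 0, 0, -2) (0, 2, 0, 0) (0, 1, 1, -2)
  have r7 := hL.three (0, 1, 1, -1) (0, 1, 1, 0) (0, 3, 1, 1) (0, 2, 2, 0)
  have r8 := hL.three (0, 1, 1, 1) (0, -1, 1, 1) (1, 1, 1, 3) (0, 2, 2, 2)
  have r9 := hL.three (0, 0, 0, 1) (0, -1, 1, -1) (1, 0, 0, 1) (0, 1, 1, 1)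
  have r10 := hL.three (0, 1, -1, 0) (0, 0, 0, 1) (1, 2, 0, 3) (0, 2, 0, 1)
  have r11 := hL.three (0, 0, 0, 1) (0, 0, 0, 2) (1, 2, 0, 5) (0, 2, 0, 3)
  have r12 := hL.three (0, 1, -1, 0) (0, 0, 0, 1) (1, 0, 0, 2) (0, 2, 0, 1)
  simp only [Prod.mk_sub_mk, Prod.mk_add_mk, Int.reduceAdd, Int.reduceSub, Int.reduceNeg,
    Int.reduceLT, neg_zero, hL.neg₁, hL.neg₂, hL.neg₃, hL.neg₄]
    at r1 r2 r3 r4 r5 r6 r7 r8 r9 r10 r11 r12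
  have n0_0_1 := hL.step 1 (by norm_num)
  have n0_0_3 := hL.step 3 (by norm_num)
  have n0_2_0 := hL.right 0
  have n1_m1_0 := hL.minus 0
  have n1_m1_1 := hL.minus 1
  have n1_1_0 := hL.plus 0
  have n1_1_1 := hL.plus 1
  have n2_0_0 := hL.left 0
  have n2_0_1 := hL.left 1
  have n2_0_2 := hL.left 2
  -- The claim after clearing denominators and removing common factors.
  have key : L (0, 0, 2, 0) * L (0, 1, -1, 0) ^ 2 * L (0, 1, 1, 0) ^ 2 * L (0, 2, 0, 0) *
    L (0, 2, 0, 1) ^ 2 * L (0, 2, 0, 4) * L (1, 0, 0, 1) ^ 2 * L (1, 0, 0, 3) ^ 2 +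
    L (0, 0, 0, 1) ^ 2 * L (0, 0, 2, 0) * L (0, 1, -1, 0) * L (0, 1, -1, 1) * L (0, 1, 1, 0) *
    L (0, 1, 1, 1) * L (0, 2, 0, 0) * L (0, 2, 0, 2) * L (1, -2, 0, -1) * L (1, 0, 0, 3) *
    L (1, 0, 0, 4) * L (1, 2, 0, 2) + L (0, 0, 0, 1) ^ 2 * L (0, 0, 2, 0) * L (0, 1, -1, 0) ^ 2 *
    L (0, 1, 1, 0) ^ 2 * L (0, 2, 0, 0) ^ 2 * L (1, -2, 0, -1) * L (1, 0, 0, 1) *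
    L (1, 0, 0, 3) * L (1, 2, 0, 5) + L (0, 0, 0, 1) ^ 2 * L (0, 0, 2, 0) * L (0, 1, -1, 1) ^ 2 *
    L (0, 1, 1, 1) ^ 2 * L (0, 2, 0, 2) ^ 2 * L (1, -2, 0, 2) * L (1, 0, 0, 0) * L (1, 0, 0, 4) *
    L (1, 2, 0, 2) + L (0, 0, 0, 1) ^ 2 * L (0, 0, 2, 0) * L (0, 1, -1, 0) * L (0, 1, -1, 1) *
    L (0, 1, 1, 0) * L (0, 1, 1, 1) * L (0, 2, 0, 0) * L (0, 2, 0, 2) * L (1, -2, 0, 2) *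
    L (1, 0, 0, 0) * L (1, 0, 0, 1) * L (1, 2, 0, 5) - L (0, 0, 0, 1) ^ 2 * L (0, 0, 2, 2) *
    L (0, 1, 1, 0) ^ 2 * L (0, 2, 0, 0) * L (0, 2, 0, 1) ^ 2 * L (0, 2, 0, 2) * L (1, -1, 1, 0) *
    L (1, 0, 0, 1) * L (1, 0, 0, 3) * L (1, 1, -1, 4) - L (0, 0, 0, 1) ^ 2 * L (0, 0, 2, -2) *
    L (0, 1, -1, 0) ^ 2 * L (0, 2, 0, 0) * L (0, 2, 0, 1) ^ 2 * L (0, 2, 0, 2) *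
    L (1, -1, -1, 0) * L (1, 0, 0, 1) * L (1, 0, 0, 3) * L (1, 1, 1, 4) - L (0, 0, 2, 0) *
    L (0, 1, -1, -1) * L (0, 1, -1, 1) * L (0, 1, 1, -1) * L (0, 1, 1, 1) * L (0, 2, 0, 1) ^ 2 *
    L (0, 2, 0, 2) ^ 2 * L (1, 0, 0, 0) * L (1, 0, 0, 2) ^ 2 * L (1, 0, 0, 4) = 0 := by
    linear_combination -L (0, 0, 0, 1) ^ 2 * L (0, 0, 2, 0) * L (0, 1, -1, 2) *
      L (0, 2, 0, 0) ^ 2 * L (0, 2, 0, 1) * L (1, -1, -1, 0) * L (1, 0, 0, 1) * r1 +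
      L (0, 0, 2, 0) * L (0, 1, -1, -1) * L (0, 1, -1, 1) * L (0, 1, 1, 0) ^ 2 * L (0, 2, 0, 0) *
      L (0, 2, 0, 2) * L (1, 0, 0, 0) * L (1, 0, 0, 2) * r2 + L (0, 0, 2, 0) * L (0, 1, -1, -1) *
      L (0, 1, -1, 1) * L (0, 1, 1, 0) ^ 2 * L (0, 2, 0, 0) * L (0, 2, 0, 1) * L (1, 0, 0, 2) *
      L (1, 0, 0, 3) * r3 + L (0, 0, 2, 0) * L (0, 1, 1, 0) ^ 2 * L (0, 2, 0, 0) *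
      L (0, 2, 0, 1) ^ 2 * L (0, 2, 0, 4) * L (1, 0, 0, 1) * L (1, 0, 0, 3) * r4 -
      L (0, 0, 0, 1) ^ 2 * L (0, 1, 1, 0) ^ 2 * L (0, 2, 0, 0) * L (0, 2, 0, 1) ^ 2 *
      L (1, 0, 0, 1) * L (1, 0, 0, 3) * r5 - L (0, 0, 0, 1) ^ 2 * L (0, 2, 0, 0) *
      L (0, 2, 0, 1) ^ 2 * L (1, -1, -1, 0) * L (1, 0, 0, 1) * L (1, 0, 0, 3) * L (1, 1, 1, 4) *
      r6 - L (0, 0, 2, 0) * L (0, 1, -1, -1) * L (0, 1, -1, 1) * L (0, 2, 0, 2) ^ 2 *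
      L (1, 0, 0, 0) * L (1, 0, 0, 2) ^ 2 * L (1, 0, 0, 4) * r7 + L (0, 0, 0, 1) ^ 2 *
      L (0, 0, 2, 0) * L (0, 1, -1, 1) ^ 2 * L (0, 2, 0, 2) ^ 2 * L (1, 0, 0, 0) *
      L (1, 0, 0, 4) * r8 + L (0, 0, 0, 1) ^ 2 * L (0, 0, 2, 0) * L (0, 1, -1, 1) *
      L (0, 2, 0, 0) ^ 2 * L (0, 2, 0, 2) * L (1, 0, 0, 4) * L (1, 1, 1, 3) * r9 +
      L (0, 0, 0, 1) ^ 2 * L (0, 0, 2, 0) * L (0, 1, -1, 1) * L (0, 1, 1, 0) * L (0, 2, 0, 0) *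
      L (0, 2, 0, 2) * L (1, -2, 0, -1) * L (1, 0, 0, 4) * r10 + L (0, 0, 0, 1) *
      L (0, 0, 2, 0) * L (0, 1, -1, -1) * L (0, 1, -1, 1) * L (0, 1, 1, 0) ^ 2 * L (0, 2, 0, 0) *
      L (1, -2, 0, -1) * L (1, 0, 0, 2) * r11 + L (0, 0, 0, 1) ^ 2 * L (0, 0, 2, 0) *
      L (0, 1, 1, 0) ^ 2 * L (0, 2, 0, 0) ^ 2 * L (1, -2, 0, -1) * L (1, 2, 0, 5) * r4 +
      L (0, 0, 0, 1) ^ 3 * L (0, 0, 2, 0) * L (0, 1, 1, 0) * L (0, 2, 0, 0) ^ 2 *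
      L (1, -1, 1, 2) * L (1, 2, 0, 5) * r9 + L (0, 0, 0, 1) ^ 2 * L (0, 0, 2, 0) *
      L (0, 1, -1, 1) * L (0, 1, 1, 0) * L (0, 2, 0, 0) * L (0, 2, 0, 2) * L (1, 0, 0, 0) *
      L (1, 2, 0, 5) * r12
  linear_combination (norm := skip) 1 / (L (0, 0, 0, 1) ^ 2 * L (0, 0, 0, 3) ^ 2 * L (0, 0, 2, 0) * L (0, 1, -1, 0) * L (0, 1, -1, 1) * L (0, 1, 1, 0) * L (0, 1, 1, 1) * L (0, 2, 0, 1) ^ 2 * L (0, 2, 0, 2)) *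
    key
  field_simp
  ring

/-- The first two steps add up to 2p, which is not a weight in P₂, so this component has to cancel
for the image to be fused again. -/
theorem fuseZero_p_p_np {t : ℂ → ℂ} (ht : ThetaLike t) {h a b : ℂ}
    (nv : NonVanishing t h a b) (u : ℂ) :
    t (2 * (a + h) + 2 * h) * wA t h u * wY t h (a + h) b (u + h) + t (2 * (-(a + h)) + 2 * h) *
      wY t h a b u * wZ t h (-(a + h)) b (u + h) + t (2 * b + 2 * h) * wD t h a b u *
      wX t h b (a + h) (u + h) + t (2 * (-b) + 2 * h) * wD t h a (-b) u *
      wX t h (-b) (a + h) (u + h) = 0 := by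
  obtain ⟨ev, L, rfl, rfl, rfl, rfl, hv, hL⟩ := ht.lattice nv u
  simp only [wA, wD, wX, wY, wZ, neg_mul, mul_neg, ev_two, ev_three, ev_four,
    ev_five, ev_six, ev_add, ev_sub, ev_neg, hv, Int.reduceMul, Int.reduceAdd, Int.reduceSub,
    Int.reduceNeg, Int.reduceLT, neg_zero, hL.neg₁, hL.neg₂, hL.neg₃, hL.neg₄]
  have r1 := hL.three (0, 0, 2, 0) (0, 0, 0, 2) (0, 2, 0, 2) (0, 1, 1, 2)
  have r2 := hL.three (0, 0, 0, 1) (0, 0, 0, -1) (0, 2, 0, 2) (0, 1, -1, 1)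
  have r3 := hL.three (0, 0, 2, 0) (0, 0, 0, -2) (0, 2, 0, 2) (0, 1, 1, 0)
  have r4 := hL.three (0, 1, -1, 2) (0, 0, 0, 2) (1, 0, 0, 3) (0, 2, 0, 4)
  have r5 := hL.three (0, 1, -1, 1) (0, 0, 0, -2) (1, 0, 0, 2) (0, 2, 0, 2)
  have r6 := hL.three (0, 0, 0, 1) (0, 0, 0, 2) (0, 1, 1, 2) (0, 0, 2, 1)
  have r7 := hL.three (0, 0, 0, 3) (0, 0, 0, 1) (0, 1, 1, 3) (0, 0, 2, 3)
  have r8 := hL.three (0, 0, 0, 1) (0, 0, 0, 3) (1, 0, 0, 3) (0, 2, 0, 4)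
  have r9 := hL.three (0, 0, 0, 1) (0, 1, -1, 3) (1, 0, 0, 3) (0, 2, 0, 4)
  have r10 := hL.three (0, 0, 0, 1) (0, 1, -1, 1) (1, 0, 0, 3) (0, 2, 0, 4)
  simp only [Prod.mk_sub_mk, Prod.mk_add_mk, Int.reduceAdd, Int.reduceSub, Int.reduceNeg,
    Int.reduceLT, neg_zero, hL.neg₁, hL.neg₂, hL.neg₃, hL.neg₄]
    at r1 r2 r3 r4 r5 r6 r7 r8 r9 r10
  have n0_0_1 := hL.step 1 (by norm_num)
  have n0_0_3 := hL.step 3 (by norm_num)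
  have n0_2_0 := hL.right 0
  have n1_m1_0 := hL.minus 0
  have n1_m1_1 := hL.minus 1
  have n1_1_0 := hL.plus 0
  have n1_1_1 := hL.plus 1
  have n2_0_0 := hL.left 0
  have n2_0_1 := hL.left 1
  have n2_0_2 := hL.left 2
  have n2_0_3 := hL.left 3
  have key : -L (0, 0, 0, 1) * L (0, 0, 2, 0) * L (0, 1, -1, 0) * L (0, 1, -1, 1) *
    L (0, 1, 1, 0) * L (0, 1, 1, 1) * L (0, 2, 0, 1) * L (0, 2, 0, 2) * L (1, -2, 0, -2) *
    L (1, 0, 0, 4) - L (0, 0, 0, 1) * L (0, 0, 2, 0) * L (0, 1, -1, 0) * L (0, 1, -1, 2) *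
    L (0, 1, 1, 0) * L (0, 1, 1, 2) * L (0, 2, 0, 1) * L (0, 2, 0, 4) * L (1, -2, 0, 1) *
    L (1, 0, 0, 1) + L (0, 0, 0, 1) * L (0, 0, 2, 0) * L (0, 1, -1, 0) * L (0, 1, -1, 2) *
    L (0, 1, 1, 0) * L (0, 1, 1, 2) * L (0, 2, 0, 0) * L (0, 2, 0, 3) * L (1, -2, 0, -1) *
    L (1, 0, 0, 3) + L (0, 0, 0, 1) * L (0, 0, 2, 0) * L (0, 1, -1, 1) * L (0, 1, -1, 2) *
    L (0, 1, 1, 1) * L (0, 1, 1, 2) * L (0, 2, 0, 2) * L (0, 2, 0, 3) * L (1, -2, 0, 2) *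
    L (1, 0, 0, 0) - L (0, 0, 0, 1) ^ 2 * L (0, 0, 2, 2) * L (0, 1, -1, 2) * L (0, 1, 1, 0) *
    L (0, 2, 0, 1) * L (0, 2, 0, 2) * L (0, 2, 0, 3) * L (1, -1, -1, 2) * L (1, -1, 1, 0) -
    L (0, 0, 0, 1) ^ 2 * L (0, 0, 2, -2) * L (0, 1, -1, 0) * L (0, 1, 1, 2) * L (0, 2, 0, 1) *
    L (0, 2, 0, 2) * L (0, 2, 0, 3) * L (1, -1, -1, 0) * L (1, -1, 1, 2) = 0 := by
    linear_combination -L (0, 0, 0, 1) * L (0, 1, 1, 2) ^ 2 * L (0, 2, 0, 1) * L (1, -2, 0, -1) *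
      L (1, 0, 0, 3) * r1 + L (0, 0, 2, 0) * L (0, 1, -1, 2) * L (0, 1, 1, 2) * L (0, 2, 0, 0) *
      L (1, -2, 0, -1) * L (1, 0, 0, 3) * r2 - L (0, 0, 0, 1) * L (0, 1, 1, 0) ^ 2 *
      L (0, 2, 0, 1) * L (1, -2, 0, -1) * L (1, 0, 0, 3) * r3 - L (0, 0, 0, 1) * L (0, 0, 2, 0) *
      L (0, 1, -1, 0) * L (0, 1, 1, 0) * L (0, 2, 0, 1) * L (0, 2, 0, 4) * r4 - L (0, 0, 0, 1) *
      L (0, 0, 2, 0) * L (0, 1, -1, 0) * L (0, 1, 1, 0) * L (0, 2, 0, 1) * L (0, 2, 0, 2) * r5 -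
      L (0, 1, -1, 0) * L (0, 1, 1, 3) * L (0, 2, 0, 1) * L (0, 2, 0, 2) * L (1, -2, 0, 0) *
      L (1, 0, 0, 2) * r6 + L (0, 1, -1, 2) * L (0, 1, 1, 1) * L (0, 2, 0, 1) * L (0, 2, 0, 2) *
      L (1, -2, 0, 0) * L (1, 0, 0, 2) * r7 + L (0, 0, 2, 0) * L (0, 1, -1, 1) *
      L (0, 1, -1, 2) * L (0, 1, 1, 1) * L (0, 1, 1, 2) * L (0, 2, 0, 2) * r8 - L (0, 0, 0, 1) *
      L (0, 0, 2, 2) * L (0, 1, -1, 2) * L (0, 1, 1, 0) * L (0, 2, 0, 1) * L (0, 2, 0, 2) * r9 -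
      L (0, 0, 0, 1) * L (0, 0, 2, -2) * L (0, 1, -1, 0) * L (0, 1, 1, 2) * L (0, 2, 0, 1) *
      L (0, 2, 0, 2) * r10
  linear_combination (norm := skip) L (1, 0, 0, 3) * L (0, 2, 0, 4) *
    L (1, 0, 0, 1) / (L (0, 0, 0, 1) ^ 2 * L (0, 0, 0, 3) ^ 2 * L (0, 0, 2, 0) * L (0, 1, -1, 0) * L (0, 1, -1, 1) * L (0, 1, 1, 0) * L (0, 1, 1, 1) * L (0, 2, 0, 1) * L (0, 2, 0, 2) * L (0, 2, 0, 3)) *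
    key
  field_simp
  ring

theorem fuseZero_p_q_nq {t : ℂ → ℂ} (ht : ThetaLike t) {h a b : ℂ}
    (nv : NonVanishing t h a b) (u : ℂ) :
    t (2 * (a + h) + 2 * h) * wA t h u * wX t h (a + h) b (u + h) + t (2 * (-(a + h)) + 2 * h) *
      wY t h a b u * wX t h (-(a + h)) b (u + h) + t (2 * b + 2 * h) * wD t h a b u *
      wY t h b (a + h) (u + h) + t (2 * (-b) + 2 * h) * wD t h a (-b) u *
      wZ t h (-b) (a + h) (u + h) = g t h u * c0p t h a b u * t (a - b + h) := by
  obtain ⟨ev, L, rfl, rfl, rfl, rfl, hv, hL⟩ := ht.lattice nv u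
  simp only [c0p, g, wA, wD, wX, wY, wZ, neg_mul, mul_neg, ev_two, ev_three, ev_four,
    ev_five, ev_six, ev_add, ev_sub, ev_neg, hv, Int.reduceMul, Int.reduceAdd, Int.reduceSub,
    Int.reduceNeg, Int.reduceLT, neg_zero, hL.neg₁, hL.neg₂, hL.neg₃, hL.neg₄]
  have r1 := hL.three (0, 0, 0, 1) (0, 0, 0, -1) (1, 1, -1, 3) (0, 1, -1, 1)
  have r2 := hL.three (0, 0, 2, 0) (0, 1, 1, 1) (1, 1, 1, 4) (0, 2, 2, 4)
  have r3 := hL.three (0, 0, 2, 0) (0, 0, 0, -1) (1, 0, 0, 3) (0, 1, 1, 1)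
  have r4 := hL.three (0, 0, 0, 1) (0, 1, -1, 0) (1, 1, -1, 3) (0, 2, 0, 3)
  have r5 := hL.three (0, 0, 2, 2) (0, 1, 1, 1) (1, 1, 1, 4) (0, 2, 2, 4)
  have r6 := hL.three (0, 1, 1, 0) (0, 1, 1, 1) (1, 2, 0, 4) (0, 3, 1, 1)
  have r7 := hL.three (0, 1, 1, 0) (0, 1, -1, 0) (1, 2, 0, 4) (0, 3, 1, 1)
  have r8 := hL.three (0, 0, 2, 0) (0, 1, 1, 0) (1, 1, 1, 3) (0, 2, 2, 3)
  have r9 := hL.three (0, 1, -1, 1) (0, 1, -1, 0) (1, 1, -1, 4) (0, 3, -1, 3)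
  have r10 := hL.three (0, 0, 2, 1) (0, 1, 1, 0) (1, 1, 1, 2) (0, 2, 2, 2)
  have r11 := hL.three (0, 0, 0, 1) (0, 0, 0, -1) (1, 1, 1, 3) (0, 1, 1, 1)
  have r12 := hL.three (0, 0, 2, 0) (0, 0, 2, 1) (0, 2, 2, 1) (0, 1, 3, 0)
  have r13 := hL.three (0, 0, 0, 1) (0, -1, 1, 0) (1, -1, 1, 1) (0, 0, 2, 2)
  have r14 := hL.three (0, 0, 2, -2) (0, 1, 1, -1) (1, 1, 1, 2) (0, 2, 2, 0)
  have r15 := hL.three (0, 1, -1, 0) (0, 1, -1, -2) (1, 1, -1, 1) (0, 3, -1, 0)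
  have r16 := hL.three (0, 0, 0, 1) (0, -1, 1, 2) (1, -1, 1, 2) (0, 0, 2, 2)
  have r17 := hL.three (0, 1, 1, -1) (0, 1, 1, 1) (1, 1, 1, 2) (0, 3, 1, 1)
  simp only [Prod.mk_sub_mk, Prod.mk_add_mk, Int.reduceAdd, Int.reduceSub, Int.reduceNeg,
    Int.reduceLT, neg_zero, hL.neg₁, hL.neg₂, hL.neg₃, hL.neg₄]
    at r1 r2 r3 r4 r5 r6 r7 r8 r9 r10 r11 r12 r13 r14 r15 r16 r17
  have n0_0_1 := hL.step 1 (by norm_num)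
  have n0_0_3 := hL.step 3 (by norm_num)
  have n0_2_0 := hL.right 0
  have n0_2_1 := hL.right 1
  have n1_m1_0 := hL.minus 0
  have n1_m1_1 := hL.minus 1
  have n1_1_0 := hL.plus 0
  have n1_1_1 := hL.plus 1
  have n2_0_0 := hL.left 0
  have n2_0_1 := hL.left 1
  have n2_0_2 := hL.left 2
  have key : L (0, 0, 0, 1) * L (0, 0, 2, 0) * L (0, 0, 2, 1) * L (0, 1, -1, 0) ^ 2 *
    L (0, 1, 1, 0) * L (0, 2, 0, 1) * L (0, 2, 0, 4) * L (1, -1, -1, 2) * L (1, 0, 0, 1) ^ 2 *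
    L (1, 0, 0, 3) + L (0, 0, 0, 1) ^ 2 * L (0, 0, 2, 0) * L (0, 0, 2, 1) * L (0, 1, -1, 0) *
    L (0, 1, 1, 0) * L (0, 1, 1, 2) * L (0, 2, 0, 0) * L (1, -2, 0, -1) * L (1, 0, 0, 1) *
    L (1, 0, 0, 3) * L (1, 1, -1, 4) + L (0, 0, 0, 1) ^ 2 * L (0, 0, 2, 0) * L (0, 0, 2, 1) *
    L (0, 1, -1, 1) * L (0, 1, 1, 1) * L (0, 1, 1, 2) * L (0, 2, 0, 2) * L (1, -2, 0, 2) *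
    L (1, 0, 0, 0) * L (1, 0, 0, 1) * L (1, 1, -1, 4) + L (0, 0, 0, 1) ^ 2 * L (0, 0, 2, 0) *
    L (0, 1, -1, 1) * L (0, 1, 1, 0) * L (0, 1, 1, 1) * L (0, 2, 0, 1) * L (0, 2, 0, 2) *
    L (1, -1, 1, 0) * L (1, 0, -2, 0) * L (1, 0, 0, 3) * L (1, 0, 0, 4) + L (0, 0, 0, 1) ^ 2 *
    L (0, 0, 2, 2) * L (0, 1, -1, 0) * L (0, 1, 1, 0) * L (0, 1, 1, 2) * L (0, 2, 0, 1) *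
    L (0, 2, 0, 2) * L (1, -1, 1, 0) * L (1, 0, -2, 3) * L (1, 0, 0, 1) * L (1, 0, 0, 3) +
    L (0, 0, 0, 1) * L (0, 0, 2, -2) * L (0, 0, 2, 1) * L (0, 1, -1, 0) ^ 2 * L (0, 1, 1, 2) *
    L (0, 2, 0, 1) * L (0, 2, 0, 2) * L (1, -1, -1, 0) * L (1, 0, 0, 1) * L (1, 0, 0, 3) ^ 2 -
    L (0, 0, 0, 2) * L (0, 0, 2, 0) * L (0, 0, 2, 1) * L (0, 1, -1, 1) ^ 2 * L (0, 1, 1, 1) *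
    L (0, 2, 0, 1) * L (0, 2, 0, 2) * L (1, -1, -1, 1) * L (1, 0, 0, 0) * L (1, 0, 0, 2) *
    L (1, 0, 0, 4) = 0 := by
    linear_combination L (0, 0, 2, 1) * L (0, 1, -1, 0) * L (0, 1, 1, 0) * L (0, 1, 1, 1) *
      L (0, 1, 1, 3) * L (0, 2, 0, 1) * L (1, -1, -1, 2) * L (1, -1, 1, 0) * r1 +
      L (0, 0, 0, 1) * L (0, 0, 2, 1) * L (0, 1, -1, 0) ^ 2 * L (0, 1, 1, 0) * L (0, 2, 0, 1) *
      L (1, -1, -1, 2) * L (1, 0, 0, 1) * r2 + L (0, 0, 0, 1) * L (0, 1, -1, 0) *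
      L (0, 1, 1, 0) * L (0, 1, 1, 1) * L (0, 1, 1, 3) * L (0, 2, 0, 1) * L (1, -1, 1, 0) *
      L (1, 1, -1, 2) * r3 + L (0, 0, 0, 1) * L (0, 0, 2, 0) * L (0, 1, -1, 1) * L (0, 1, 1, 0) *
      L (0, 1, 1, 1) * L (0, 2, 0, 1) * L (1, -1, 1, 0) * L (1, 0, 0, 4) * r4 +
      L (0, 0, 0, 1) ^ 2 * L (0, 1, -1, 0) * L (0, 1, 1, 0) * L (0, 1, 1, 2) * L (0, 2, 0, 1) *
      L (1, -1, 1, 0) * L (1, 0, -2, 3) * r5 - L (0, 0, 0, 1) * L (0, 0, 2, 0) *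
      L (0, 1, -1, -1) * L (0, 1, -1, 1) * L (0, 1, 1, 1) * L (0, 1, 1, 2) * L (1, -1, -1, 0) *
      L (1, -1, 1, 0) * r6 - L (0, 0, 0, 1) ^ 2 * L (0, 1, -1, -1) * L (0, 1, -1, 0) *
      L (0, 1, -1, 1) * L (0, 1, 1, 2) * L (1, -1, -1, 0) * L (1, -1, 1, 0) * r7 -
      L (0, 0, 0, 2) * L (0, 0, 2, 1) * L (0, 1, -1, 0) * L (0, 1, -1, 1) * L (0, 1, 1, 1) *
      L (0, 2, 0, 1) * L (1, -1, -1, 2) * L (1, 0, 0, 2) * r8 - L (0, 0, 0, 2) * L (0, 0, 2, 0) *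
      L (0, 0, 2, 1) * L (0, 1, -1, 1) * L (0, 1, 1, 1) * L (0, 2, 0, 1) * L (1, 0, 0, 0) *
      L (1, 0, 0, 2) * r9 - L (0, 0, 0, 1) * L (0, 0, 0, 2) * L (0, 0, 2, 0) * L (0, 1, -1, 1) *
      L (0, 1, 1, 1) * L (0, 1, 1, 2) * L (1, -2, 0, 1) * L (1, 1, -1, 4) * r10 -
      L (0, 0, 2, 1) * L (0, 1, -1, 0) ^ 2 * L (0, 1, -1, 1) * L (0, 1, -1, 3) * L (0, 2, 0, 1) *
      L (1, -1, -1, 0) * L (1, -1, -1, 2) * r11 - L (0, 0, 0, 1) * L (0, 1, -1, 0) ^ 2 *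
      L (0, 1, 1, 2) * L (1, -1, -1, 0) * L (1, -1, 1, 0) * L (1, 0, 0, 3) * L (1, 1, -1, 4) *
      r12 + L (0, 0, 0, 1) * L (0, 0, 2, 0) * L (0, 1, -1, 0) * L (0, 1, 1, 0) * L (0, 1, 1, 2) *
      L (0, 2, 0, 0) * L (1, 0, 0, 3) * L (1, 1, -1, 4) * r13 + L (0, 0, 0, 1) * L (0, 0, 2, 1) *
      L (0, 1, -1, 0) ^ 2 * L (0, 1, 1, 2) * L (0, 2, 0, 1) * L (1, -1, -1, 0) * L (1, 0, 0, 3) *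
      r14 + L (0, 0, 0, 1) * L (0, 0, 2, 0) * L (0, 1, -1, 1) * L (0, 1, 1, 0) * L (0, 1, 1, 1) *
      L (0, 1, 1, 2) * L (1, -1, 1, 1) * L (1, 1, -1, 4) * r15 + L (0, 0, 0, 1) *
      L (0, 0, 2, 0) * L (0, 1, -1, 1) * L (0, 1, 1, 1) * L (0, 1, 1, 2) * L (0, 2, 0, 2) *
      L (1, 0, 0, 1) * L (1, 1, -1, 4) * r16 + L (0, 0, 0, 1) * L (0, 0, 2, 0) *
      L (0, 1, -1, -1) * L (0, 1, -1, 1) * L (0, 1, 1, 1) * L (0, 1, 1, 2) * L (1, -1, -1, 0) *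
      L (1, 1, -1, 4) * r17
  linear_combination (norm := skip) L (0, 0, 2, 2) / (L (0, 0, 0, 1) ^ 2 * L (0, 0, 0, 3) ^ 2 * L (0, 0, 2, 0) * L (0, 0, 2, 1) * L (0, 1, -1, 0) * L (0, 1, -1, 1) * L (0, 1, 1, 0) * L (0, 1, 1, 1) * L (0, 2, 0, 1) * L (0, 2, 0, 2)) *
    key
  field_simp
  ring

theorem fuseZero_q_nq_p {t : ℂ → ℂ} (ht : ThetaLike t) {h a b : ℂ}
    (nv : NonVanishing t h a b) (u : ℂ) :
    t (2 * (-(a + h)) + 2 * h) * wX t h a b u * wD t h (-(b + h)) a (u + h) + t (2 * b + 2 * h) *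
      wE t h a b u * wE t h a (-(b + h)) (u + h) = g t h u * c00 t h a b u * t (2 * b + 2 * h) :=
      by
  obtain ⟨ev, L, rfl, rfl, rfl, rfl, hv, hL⟩ := ht.lattice nv u
  simp only [c00, g, wD, wE, wX, neg_mul, mul_neg, ev_two, ev_three, ev_four,
    ev_five, ev_six, ev_add, ev_sub, ev_neg, hv, Int.reduceMul, Int.reduceAdd, Int.reduceSub,
    Int.reduceNeg, Int.reduceLT, neg_zero, hL.neg₁, hL.neg₂, hL.neg₃, hL.neg₄]
  have r1 := hL.three (0, 0, 0, 1) (0, -1, -1, 1) (1, 0, 0, 3) (0, 0, 0, 2)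
  simp only [Prod.mk_sub_mk, Prod.mk_add_mk, Int.reduceAdd, Int.reduceSub, Int.reduceNeg,
    Int.reduceLT, neg_zero, hL.neg₁, hL.neg₂, hL.neg₃, hL.neg₄]
    at r1
  have n0_0_1 := hL.step 1 (by norm_num)
  have n0_0_3 := hL.step 3 (by norm_num)
  have n1_m1_0 := hL.minus 0
  have n1_1_0 := hL.plus 0
  have n1_1_1 := hL.plus 1
  have n2_0_0 := hL.left 0
  have key : -L (0, 0, 0, 1) ^ 2 * L (1, -1, -1, 2) * L (1, 1, 1, 2) + L (0, 1, 1, 0) ^ 2 *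
    L (1, 0, 0, 1) * L (1, 0, 0, 3) - L (0, 1, 1, -1) * L (0, 1, 1, 1) * L (1, 0, 0, 2) ^ 2 =
    0 := by
    linear_combination -1 * r1
  linear_combination (norm := skip) L (1, 0, 0, 4) * L (0, 1, -1, -1) * L (1, 0, 0, 0) *
    L (0, 0, 2, 2) / (L (0, 0, 0, 1) ^ 2 * L (0, 0, 0, 3) ^ 2 * L (0, 1, -1, 0) * L (0, 1, 1, 0) * L (0, 1, 1, 1)) *
    key
  field_simp
  ring

/-- Companion of `fuseZero_p_q_nq`: the same `c0p` has to appear with the other coefficient of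
f̄_{p+q}, which makes the two components proportional to f̄_{p+q}. -/
theorem fuseZero_q_p_nq {t : ℂ → ℂ} (ht : ThetaLike t) {h a b : ℂ}
    (nv : NonVanishing t h a b) (u : ℂ) :
    t (2 * (-(a + h)) + 2 * h) * wX t h a b u * wE t h (-(b + h)) a (u + h) + t (2 * b + 2 * h) *
      wE t h a b u * wD t h a (-(b + h)) (u + h) = g t h u * c0p t h a b u * t (b - a + h) := by
  obtain ⟨ev, L, rfl, rfl, rfl, rfl, hv, hL⟩ := ht.lattice nv u
  simp only [c0p, g, wD, wE, wX, neg_mul, mul_neg, ev_two, ev_three, ev_four,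
    ev_five, ev_six, ev_add, ev_sub, ev_neg, hv, Int.reduceMul, Int.reduceAdd, Int.reduceSub,
    Int.reduceNeg, Int.reduceLT, neg_zero, hL.neg₁, hL.neg₂, hL.neg₃, hL.neg₄]
  have r1 := hL.three (0, 0, 0, 1) (0, 0, 0, 2) (1, 0, 0, 3) (0, 1, 1, 3)
  simp only [Prod.mk_sub_mk, Prod.mk_add_mk, Int.reduceAdd, Int.reduceSub, Int.reduceNeg,
    Int.reduceLT, neg_zero, hL.neg₁, hL.neg₂, hL.neg₃, hL.neg₄]
    at r1
  have n0_0_1 := hL.step 1 (by norm_num)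
  have n0_0_3 := hL.step 3 (by norm_num)
  have n1_m1_0 := hL.minus 0
  have n1_1_0 := hL.plus 0
  have n1_1_1 := hL.plus 1
  have n2_0_0 := hL.left 0
  have key : -L (0, 0, 0, 1) * L (0, 1, 1, 2) * L (1, -1, -1, 2) * L (1, 0, 0, 1) -
    L (0, 0, 0, 1) * L (0, 1, 1, 0) * L (1, -1, -1, 0) * L (1, 0, 0, 3) + L (0, 0, 0, 2) *
    L (0, 1, 1, 1) * L (1, -1, -1, 1) * L (1, 0, 0, 2) = 0 := by
    linear_combination -1 * r1
  linear_combination (norm := skip) L (1, 0, 0, 4) * L (0, 1, -1, -1) * L (1, 0, 0, 0) *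
    L (0, 0, 2, 2) / (L (0, 0, 0, 1) ^ 2 * L (0, 0, 0, 3) ^ 2 * L (0, 1, -1, 0) * L (0, 1, 1, 0) * L (0, 1, 1, 1)) *
    key
  field_simp
  ring

/-- Again 2p is not in P₂. The two terms are opposite already by oddness, without the three-term
identity. -/
theorem fuseAdd_p_p_q {t : ℂ → ℂ} (ht : ThetaLike t) {h a b : ℂ}
    (nv : NonVanishing t h a b) (u : ℂ) :
    t (a + h - b + h) * wA t h u * wD t h (a + h) b (u + h) + t (b - (a + h) + h) *
      wD t h a b u * wE t h b (a + h) (u + h) = 0 := by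
  obtain ⟨ev, L, rfl, rfl, rfl, rfl, hv, hL⟩ := ht.lattice nv u
  simp only [wA, wD, wE, neg_mul, mul_neg, ev_two, ev_three, ev_four,
    ev_five, ev_six, ev_add, ev_sub, ev_neg, hv, Int.reduceMul, Int.reduceAdd, Int.reduceSub,
    Int.reduceNeg, Int.reduceLT, neg_zero, hL.neg₁, hL.neg₂, hL.neg₃, hL.neg₄]
  have n0_0_1 := hL.step 1 (by norm_num)
  have n0_0_3 := hL.step 3 (by norm_num)
  have n1_m1_0 := hL.minus 0
  have n1_m1_1 := hL.minus 1
  field_simp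
  ring

theorem fuseAdd_p_q_p {t : ℂ → ℂ} (ht : ThetaLike t) {h a b : ℂ}
    (nv : NonVanishing t h a b) (u : ℂ) :
    t (a + h - b + h) * wA t h u * wE t h (a + h) b (u + h) + t (b - (a + h) + h) *
      wD t h a b u * wD t h b (a + h) (u + h) = g t h u * t (u + 3 * h) * t (a - b + h) := by
  obtain ⟨ev, L, rfl, rfl, rfl, rfl, hv, hL⟩ := ht.lattice nv u
  simp only [g, wA, wD, wE, neg_mul, mul_neg, ev_two, ev_three, ev_four,
    ev_five, ev_six, ev_add, ev_sub, ev_neg, hv, Int.reduceMul, Int.reduceAdd, Int.reduceSub,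
    Int.reduceNeg, Int.reduceLT, neg_zero, hL.neg₁, hL.neg₂, hL.neg₃, hL.neg₄]
  have r1 := hL.three (0, 1, -1, 0) (0, 1, -1, 1) (1, 1, -1, 2) (0, 2, -2, 2)
  simp only [Prod.mk_sub_mk, Prod.mk_add_mk, Int.reduceAdd, Int.reduceSub, Int.reduceNeg,
    Int.reduceLT, neg_zero, hL.neg₁, hL.neg₂, hL.neg₃, hL.neg₄]
    at r1
  have n0_0_1 := hL.step 1 (by norm_num)
  have n0_0_3 := hL.step 3 (by norm_num)
  have n1_m1_0 := hL.minus 0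
  have n1_m1_1 := hL.minus 1
  have key : L (0, 1, -1, 0) * L (0, 1, -1, 2) * L (1, 0, 0, 1) ^ 2 + L (0, 0, 0, 1) ^ 2 *
    L (1, -1, 1, 0) * L (1, 1, -1, 2) - L (0, 1, -1, 1) ^ 2 * L (1, 0, 0, 0) * L (1, 0, 0, 2) =
    0 := by
    linear_combination 1 * r1
  linear_combination (norm := skip) L (1, 0, 0, 4) *
    L (1, 0, 0, 3) / (L (0, 0, 0, 1) ^ 2 * L (0, 0, 0, 3) ^ 2 * L (0, 1, -1, 1)) * key
  field_simp
  ring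

theorem fuseAdd_q_p_p {t : ℂ → ℂ} (ht : ThetaLike t) {h a b : ℂ}
    (nv : NonVanishing t h a b) (u : ℂ) :
    t (b - (a + h) + h) * wE t h a b u * wA t h (u + h) = g t h u * t (u + 3 * h) *
      t (b - a + h) := by
  obtain ⟨ev, L, rfl, rfl, rfl, rfl, hv, hL⟩ := ht.lattice nv u
  simp only [g, wA, wE, neg_mul, mul_neg, ev_two, ev_three, ev_four,
    ev_five, ev_six, ev_add, ev_sub, ev_neg, hv, Int.reduceMul, Int.reduceAdd, Int.reduceSub,
    Int.reduceNeg, Int.reduceLT, neg_zero, hL.neg₁, hL.neg₂, hL.neg₃, hL.neg₄]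
  have n0_0_1 := hL.step 1 (by norm_num)
  have n0_0_3 := hL.step 3 (by norm_num)
  have n1_m1_0 := hL.minus 0
  field_simp

/-- One of the four components along f̄_0 ⊗ e_q, on the paths beginning with −q, q or −p, p or p, −p
or q, −q; all of them have to produce the same `cm0`. -/
theorem fuseSub_nq_q_q {t : ℂ → ℂ} (ht : ThetaLike t) {h a b : ℂ}
    (nv : NonVanishing t h a b) (u : ℂ) :
    t (-(a + h) - b + h) * wX t h a (-b) u * wA t h (u + h) = g t h u * cm0 t h a b u *
      t (2 * (-b) + 2 * h) := by
  obtain ⟨ev, L, rfl, rfl, rfl, rfl, hv, hL⟩ := ht.lattice nv u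
  simp only [cm0, g, wA, wX, neg_mul, mul_neg, ev_two, ev_three, ev_four,
    ev_five, ev_six, ev_add, ev_sub, ev_neg, hv, Int.reduceMul, Int.reduceAdd, Int.reduceSub,
    Int.reduceNeg, Int.reduceLT, neg_zero, hL.neg₁, hL.neg₂, hL.neg₃, hL.neg₄]
  have n0_0_1 := hL.step 1 (by norm_num)
  have n0_0_3 := hL.step 3 (by norm_num)
  have n1_m1_0 := hL.minus 0
  have n1_1_0 := hL.plus 0
  have n2_0_0 := hL.left 0
  field_simp

theorem fuseSub_np_p_q {t : ℂ → ℂ} (ht : ThetaLike t) {h a b : ℂ}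
    (nv : NonVanishing t h a b) (u : ℂ) :
    t (-(a + h) - b + h) * wZ t h a b u * wD t h (a - h) b (u + h) = g t h u * cm0 t h a b u *
      t (2 * (-a) + 2 * h) := by
  obtain ⟨ev, L, rfl, rfl, rfl, rfl, hv, hL⟩ := ht.lattice nv u
  simp only [cm0, g, wD, wZ, neg_mul, mul_neg, ev_two, ev_three, ev_four,
    ev_five, ev_six, ev_add, ev_sub, ev_neg, hv, Int.reduceMul, Int.reduceAdd, Int.reduceSub,
    Int.reduceNeg, Int.reduceLT, neg_zero, hL.neg₁, hL.neg₂, hL.neg₃, hL.neg₄]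
  have n0_0_1 := hL.step 1 (by norm_num)
  have n0_0_3 := hL.step 3 (by norm_num)
  have n1_m1_m1 := hL.minus (-1)
  have n1_m1_0 := hL.minus 0
  have n1_1_0 := hL.plus 0
  have n2_0_0 := hL.left 0
  field_simp

theorem fuseSub_np_q_p {t : ℂ → ℂ} (ht : ThetaLike t) {h a b : ℂ}
    (nv : NonVanishing t h a b) (u : ℂ) :
    t (-(a + h) - b + h) * wZ t h a b u * wE t h (a - h) b (u + h) = g t h u * cmm t h a b u *
      t (-a - b + h) := by
  obtain ⟨ev, L, rfl, rfl, rfl, rfl, hv, hL⟩ := ht.lattice nv u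
  simp only [cmm, g, wE, wZ, neg_mul, mul_neg, ev_two, ev_three, ev_four,
    ev_five, ev_six, ev_add, ev_sub, ev_neg, hv, Int.reduceMul, Int.reduceAdd, Int.reduceSub,
    Int.reduceNeg, Int.reduceLT, neg_zero, hL.neg₁, hL.neg₂, hL.neg₃, hL.neg₄]
  have n0_0_1 := hL.step 1 (by norm_num)
  have n0_0_3 := hL.step 3 (by norm_num)
  have n1_m1_m1 := hL.minus (-1)
  have n1_m1_0 := hL.minus 0
  have n1_1_0 := hL.plus 0
  have n2_0_0 := hL.left 0
  field_simp

theorem fuseSub_p_np_q {t : ℂ → ℂ} (ht : ThetaLike t) {h a b : ℂ}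
    (nv : NonVanishing t h a b) (u : ℂ) :
    t (-(a + h) - b + h) * wY t h a b u * wD t h (-(a + h)) b (u + h) + t (b - (-(a + h)) + h) *
      wD t h a b u * wE t h b (-(a + h)) (u + h) = g t h u * cm0 t h a b u * t (2 * a + 2 * h) :=
      by
  obtain ⟨ev, L, rfl, rfl, rfl, rfl, hv, hL⟩ := ht.lattice nv u
  simp only [cm0, g, wD, wE, wY, neg_mul, mul_neg, ev_two, ev_three, ev_four,
    ev_five, ev_six, ev_add, ev_sub, ev_neg, hv, Int.reduceMul, Int.reduceAdd, Int.reduceSub,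
    Int.reduceNeg, Int.reduceLT, neg_zero, hL.neg₁, hL.neg₂, hL.neg₃, hL.neg₄]
  have r1 := hL.three (0, 0, 0, 1) (0, -1, -1, 1) (1, 0, 0, 3) (0, 1, -1, 2)
  have r2 := hL.three (0, 0, 0, 1) (0, -1, -1, -1) (1, 0, 0, 1) (0, 1, -1, 1)
  simp only [Prod.mk_sub_mk, Prod.mk_add_mk, Int.reduceAdd, Int.reduceSub, Int.reduceNeg,
    Int.reduceLT, neg_zero, hL.neg₁, hL.neg₂, hL.neg₃, hL.neg₄]
    at r1 r2
  have n0_0_1 := hL.step 1 (by norm_num)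
  have n0_0_3 := hL.step 3 (by norm_num)
  have n1_m1_0 := hL.minus 0
  have n1_1_0 := hL.plus 0
  have n1_1_1 := hL.plus 1
  have n2_0_0 := hL.left 0
  have n2_0_1 := hL.left 1
  have key : L (0, 0, 0, 1) * L (0, 1, -1, 0) * L (0, 1, 1, 0) * L (0, 2, 0, 0) *
    L (1, -2, 0, -1) * L (1, 0, 0, 3) * L (1, 1, 1, 2) + L (0, 0, 0, 1) * L (0, 1, -1, 1) *
    L (0, 1, 1, 1) * L (0, 2, 0, 2) * L (1, -2, 0, 2) * L (1, 0, 0, 0) * L (1, 1, 1, 2) -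
    L (0, 1, 1, 0) * L (0, 1, 1, 2) * L (0, 2, 0, 0) * L (0, 2, 0, 1) * L (1, -1, 1, 0) *
    L (1, 0, 0, 1) * L (1, 0, 0, 3) + L (0, 1, 1, -1) * L (0, 1, 1, 1) * L (0, 2, 0, 1) *
    L (0, 2, 0, 2) * L (1, -1, 1, 2) * L (1, 0, 0, 0) * L (1, 0, 0, 2) = 0 := by
    linear_combination L (0, 1, 1, 1) * L (0, 2, 0, 2) * L (1, 0, 0, 0) * r1 + L (0, 1, 1, 0) *
      L (0, 2, 0, 0) * L (1, 0, 0, 3) * r2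
  linear_combination (norm := skip) L (1, 0, 0, 4) / (L (0, 0, 0, 1) * L (0, 0, 0, 3) ^ 2 * L (0, 1, -1, 0) * L (0, 1, 1, 1) * L (0, 2, 0, 0) * L (0, 2, 0, 1)) *
    key
  field_simp
  ring

theorem fuseSub_p_q_np {t : ℂ → ℂ} (ht : ThetaLike t) {h a b : ℂ}
    (nv : NonVanishing t h a b) (u : ℂ) :
    t (-(a + h) - b + h) * wY t h a b u * wE t h (-(a + h)) b (u + h) + t (b - (-(a + h)) + h) *
      wD t h a b u * wD t h b (-(a + h)) (u + h) = g t h u * cmp t h a b u * t (a - b + h) := by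
  obtain ⟨ev, L, rfl, rfl, rfl, rfl, hv, hL⟩ := ht.lattice nv u
  simp only [cmp, g, wD, wE, wY, neg_mul, mul_neg, ev_two, ev_three, ev_four,
    ev_five, ev_six, ev_add, ev_sub, ev_neg, hv, Int.reduceMul, Int.reduceAdd, Int.reduceSub,
    Int.reduceNeg, Int.reduceLT, neg_zero, hL.neg₁, hL.neg₂, hL.neg₃, hL.neg₄]
  have r1 := hL.three (0, 0, 0, 1) (0, 0, 0, 2) (1, 0, 0, 3) (0, 2, 0, 3)
  have r2 := hL.three (0, 1, -1, 0) (0, 0, 0, -1) (1, 0, 0, 0) (0, 2, 0, 0)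
  simp only [Prod.mk_sub_mk, Prod.mk_add_mk, Int.reduceAdd, Int.reduceSub, Int.reduceNeg,
    Int.reduceLT, neg_zero, hL.neg₁, hL.neg₂, hL.neg₃, hL.neg₄]
    at r1 r2
  have n0_0_1 := hL.step 1 (by norm_num)
  have n0_0_3 := hL.step 3 (by norm_num)
  have n1_m1_0 := hL.minus 0
  have n1_1_0 := hL.plus 0
  have n1_1_1 := hL.plus 1
  have n2_0_0 := hL.left 0
  have n2_0_1 := hL.left 1
  have key : L (0, 0, 0, 1) * L (0, 1, -1, 0) * L (0, 1, 1, 0) * L (0, 2, 0, 0) *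
    L (1, -2, 0, -1) * L (1, 0, 0, 1) * L (1, 0, 0, 3) + L (0, 0, 0, 1) * L (0, 1, -1, 1) *
    L (0, 1, 1, 1) * L (0, 2, 0, 2) * L (1, -2, 0, 2) * L (1, 0, 0, 0) * L (1, 0, 0, 1) +
    L (0, 0, 0, 1) ^ 2 * L (0, 2, 0, 0) * L (0, 2, 0, 1) * L (1, -1, -1, 0) * L (1, -1, 1, 0) *
    L (1, 0, 0, 3) - L (0, 0, 0, 2) * L (0, 1, -1, 1) * L (0, 1, 1, 1) * L (0, 2, 0, 1) *
    L (1, -2, 0, 1) * L (1, 0, 0, 0) * L (1, 0, 0, 2) = 0 := by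
    linear_combination L (0, 1, -1, 1) * L (0, 1, 1, 1) * L (1, 0, 0, 0) * r1 + L (0, 0, 0, 1) *
      L (0, 2, 0, 0) * L (1, 0, 0, 3) * r2
  linear_combination (norm := skip) L (0, 1, 1, 2) *
    L (1, 0, 0, 4) / (L (0, 0, 0, 1) ^ 2 * L (0, 0, 0, 3) ^ 2 * L (0, 1, -1, 0) * L (0, 1, 1, 1) * L (0, 2, 0, 0) * L (0, 2, 0, 1)) *
    key
  field_simp
  ring

theorem fuseSub_q_nq_q {t : ℂ → ℂ} (ht : ThetaLike t) {h a b : ℂ}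
    (nv : NonVanishing t h a b) (u : ℂ) :
    t (-(a + h) - b + h) * wX t h a b u * wY t h (-(b + h)) a (u + h) + t (b - (-(a + h)) + h) *
      wE t h a b u * wX t h a (-(b + h)) (u + h) = g t h u * cm0 t h a b u * t (2 * b + 2 * h) :=
      by
  obtain ⟨ev, L, rfl, rfl, rfl, rfl, hv, hL⟩ := ht.lattice nv u
  simp only [cm0, g, wE, wX, wY, neg_mul, mul_neg, ev_two, ev_three, ev_four,
    ev_five, ev_six, ev_add, ev_sub, ev_neg, hv, Int.reduceMul, Int.reduceAdd, Int.reduceSub,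
    Int.reduceNeg, Int.reduceLT, neg_zero, hL.neg₁, hL.neg₂, hL.neg₃, hL.neg₄]
  have r1 := hL.three (0, 0, 0, 1) (0, 0, -2, -1) (1, 0, 0, 4) (0, 1, -1, 1)
  have r2 := hL.three (0, 0, 0, 1) (0, 0, -2, 0) (1, 0, 0, 2) (0, 1, -1, 0)
  simp only [Prod.mk_sub_mk, Prod.mk_add_mk, Int.reduceAdd, Int.reduceSub, Int.reduceNeg,
    Int.reduceLT, neg_zero, hL.neg₁, hL.neg₂, hL.neg₃, hL.neg₄]
    at r1 r2
  have n0_0_1 := hL.step 1 (by norm_num)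
  have n0_0_3 := hL.step 3 (by norm_num)
  have n0_2_1 := hL.right 1
  have n0_2_2 := hL.right 2
  have n1_m1_m1 := hL.minus (-1)
  have n1_m1_0 := hL.minus 0
  have n1_1_0 := hL.plus 0
  have n1_1_1 := hL.plus 1
  have n2_0_0 := hL.left 0
  have key : -L (0, 0, 0, 1) * L (0, 0, 2, 2) * L (0, 1, -1, -1) * L (0, 1, 1, 1) *
    L (1, -1, -1, 2) * L (1, 0, 0, 4) * L (1, 0, 2, 2) - L (0, 0, 0, 1) * L (0, 0, 2, 0) *
    L (0, 1, -1, 0) * L (0, 1, 1, 0) * L (1, -1, -1, 2) * L (1, 0, 0, 1) * L (1, 0, 2, 5) -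
    L (0, 0, 2, 0) * L (0, 0, 2, 1) * L (0, 1, 1, 0) * L (0, 1, 1, 2) * L (1, -1, 1, 4) *
    L (1, 0, 0, 1) * L (1, 0, 0, 3) + L (0, 0, 2, 1) * L (0, 0, 2, 2) * L (0, 1, 1, -1) *
    L (0, 1, 1, 1) * L (1, -1, 1, 2) * L (1, 0, 0, 2) * L (1, 0, 0, 4) = 0 := by
    linear_combination -L (0, 0, 2, 0) * L (0, 1, 1, 0) * L (1, 0, 0, 1) * r1 - L (0, 0, 2, 2) *
      L (0, 1, 1, 1) * L (1, 0, 0, 4) * r2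
  linear_combination (norm := skip) L (1, 0, 0, 0) / (L (0, 0, 0, 1) * L (0, 0, 0, 3) ^ 2 * L (0, 0, 2, 1) * L (0, 1, -1, 0) * L (0, 1, 1, 1) * L (0, 2, 0, 0)) *
    key
  field_simp
  ring

theorem fuseSub_q_np_p {t : ℂ → ℂ} (ht : ThetaLike t) {h a b : ℂ}
    (nv : NonVanishing t h a b) (u : ℂ) :
    t (-(a + h) - b + h) * wX t h a b u * wX t h (-(b + h)) (-a) (u + h) +
      t (b - (-(a + h)) + h) * wE t h a b u * wZ t h a (b + h) (u + h) = g t h u *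
      cmm t h a b u * t (b - (-a) + h) := by
  obtain ⟨ev, L, rfl, rfl, rfl, rfl, hv, hL⟩ := ht.lattice nv u
  simp only [cmm, g, wE, wX, wZ, neg_mul, mul_neg, ev_two, ev_three, ev_four,
    ev_five, ev_six, ev_add, ev_sub, ev_neg, hv, Int.reduceMul, Int.reduceAdd, Int.reduceSub,
    Int.reduceNeg, Int.reduceLT, neg_zero, hL.neg₁, hL.neg₂, hL.neg₃, hL.neg₄]
  have r1 := hL.three (0, 0, 0, 1) (0, -1, -1, 0) (1, 0, 0, 4) (0, 0, 0, 2)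
  simp only [Prod.mk_sub_mk, Prod.mk_add_mk, Int.reduceAdd, Int.reduceSub, Int.reduceNeg,
    Int.reduceLT, neg_zero, hL.neg₁, hL.neg₂, hL.neg₃, hL.neg₄]
    at r1
  have n0_0_1 := hL.step 1 (by norm_num)
  have n0_0_3 := hL.step 3 (by norm_num)
  have n0_2_2 := hL.right 2
  have n1_m1_m1 := hL.minus (-1)
  have n1_m1_0 := hL.minus 0
  have n1_1_0 := hL.plus 0
  have n1_1_1 := hL.plus 1
  have n2_0_0 := hL.left 0
  have key : L (0, 0, 0, 1) ^ 2 * L (1, -1, -1, 2) * L (1, 1, 1, 4) + L (0, 1, 1, 0) *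
    L (0, 1, 1, 2) * L (1, 0, 0, 3) ^ 2 - L (0, 1, 1, 1) ^ 2 * L (1, 0, 0, 2) * L (1, 0, 0, 4) =
    0 := by
    linear_combination 1 * r1
  linear_combination (norm := skip) L (0, 2, 0, -2) * L (1, 0, 0, 1) * L (0, 1, -1, -2) *
    L (1, 0, 0, 0) / (L (0, 0, 0, 1) ^ 2 * L (0, 0, 0, 3) ^ 2 * L (0, 1, -1, 0) * L (0, 1, 1, 1) * L (0, 2, 0, 0)) *
    key
  field_simp
  ring

theorem fuseSub_q_p_np {t : ℂ → ℂ} (ht : ThetaLike t) {h a b : ℂ}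
    (nv : NonVanishing t h a b) (u : ℂ) :
    t (-(a + h) - b + h) * wX t h a b u * wX t h (-(b + h)) a (u + h) + t (b - (-(a + h)) + h) *
      wE t h a b u * wY t h a (b + h) (u + h) = g t h u * cmp t h a b u * t (b - a + h) := by
  obtain ⟨ev, L, rfl, rfl, rfl, rfl, hv, hL⟩ := ht.lattice nv u
  simp only [cmp, g, wE, wX, wY, neg_mul, mul_neg, ev_two, ev_three, ev_four,
    ev_five, ev_six, ev_add, ev_sub, ev_neg, hv, Int.reduceMul, Int.reduceAdd, Int.reduceSub,
    Int.reduceNeg, Int.reduceLT, neg_zero, hL.neg₁, hL.neg₂, hL.neg₃, hL.neg₄]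
  have r1 := hL.three (0, 0, 0, 1) (0, 0, 0, -1) (1, 0, 0, 2) (0, 2, 0, 1)
  have r2 := hL.three (0, 0, 0, 1) (0, 1, -1, 0) (1, 0, 0, 4) (0, 2, 0, 2)
  simp only [Prod.mk_sub_mk, Prod.mk_add_mk, Int.reduceAdd, Int.reduceSub, Int.reduceNeg,
    Int.reduceLT, neg_zero, hL.neg₁, hL.neg₂, hL.neg₃, hL.neg₄]
    at r1 r2
  have n0_0_1 := hL.step 1 (by norm_num)
  have n0_0_3 := hL.step 3 (by norm_num)
  have n0_2_2 := hL.right 2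
  have n1_m1_m1 := hL.minus (-1)
  have n1_m1_0 := hL.minus 0
  have n1_1_0 := hL.plus 0
  have n1_1_1 := hL.plus 1
  have n2_0_0 := hL.left 0
  have n2_0_1 := hL.left 1
  have key : L (0, 0, 0, 1) ^ 2 * L (0, 2, 0, 1) * L (0, 2, 0, 2) * L (1, -1, -1, 2) *
    L (1, -1, 1, 4) * L (1, 0, 0, 1) - L (0, 0, 0, 1) * L (0, 1, -1, -1) * L (0, 1, 1, 1) *
    L (0, 2, 0, 0) * L (1, -2, 0, 0) * L (1, 0, 0, 3) * L (1, 0, 0, 4) - L (0, 0, 0, 1) *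
    L (0, 1, -1, 0) * L (0, 1, 1, 2) * L (0, 2, 0, 2) * L (1, -2, 0, 3) * L (1, 0, 0, 1) *
    L (1, 0, 0, 3) + L (0, 0, 0, 2) * L (0, 1, -1, -1) * L (0, 1, 1, 1) * L (0, 2, 0, 1) *
    L (1, -2, 0, 1) * L (1, 0, 0, 2) * L (1, 0, 0, 4) = 0 := by
    linear_combination -L (0, 1, -1, -1) * L (0, 1, 1, 1) * L (1, 0, 0, 4) * r1 +
      L (0, 0, 0, 1) * L (0, 2, 0, 2) * L (1, 0, 0, 1) * r2
  linear_combination (norm := skip) L (1, 0, 0, 0) *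
    L (0, 1, 1, 2) / (L (0, 0, 0, 1) ^ 2 * L (0, 0, 0, 3) ^ 2 * L (0, 1, -1, 0) * L (0, 1, 1, 1) * L (0, 2, 0, 0) * L (0, 2, 0, 1)) *
    key
  field_simp
  ring

/-- The vanishing component for this input: 2q is not in P₂, and the two terms cancel by oddness. -/
theorem fuseSub_q_q_nq {t : ℂ → ℂ} (ht : ThetaLike t) {h a b : ℂ}
    (nv : NonVanishing t h a b) (u : ℂ) :
    t (-(a + h) - b + h) * wX t h a b u * wZ t h (-(b + h)) a (u + h) + t (b - (-(a + h)) + h) *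
      wE t h a b u * wX t h a (b + h) (u + h) = 0 := by
  obtain ⟨ev, L, rfl, rfl, rfl, rfl, hv, hL⟩ := ht.lattice nv u
  simp only [wE, wX, wZ, neg_mul, mul_neg, ev_two, ev_three, ev_four,
    ev_five, ev_six, ev_add, ev_sub, ev_neg, hv, Int.reduceMul, Int.reduceAdd, Int.reduceSub,
    Int.reduceNeg, Int.reduceLT, neg_zero, hL.neg₁, hL.neg₂, hL.neg₃, hL.neg₄]
  have n0_0_1 := hL.step 1 (by norm_num)
  have n0_0_3 := hL.step 3 (by norm_num)
  have n0_2_2 := hL.right 2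
  have n1_m1_m1 := hL.minus (-1)
  have n1_m1_0 := hL.minus 0
  have n1_1_0 := hL.plus 0
  have n1_1_1 := hL.plus 1
  have n2_0_0 := hL.left 0
  field_simp
  ring

/-! ### The fused operator on e ⊗ f̄ -/

theorem pair_shift (ℏ : ℂ) (lam : Space) (p α : Wt) :
    pair (shift ℏ lam p) α = pair lam α + (p.1 * α.1 + p.2 * α.2 : ℤ) * ℏ := by
  simp only [pair, shift]; push_cast; ring

theorem Regular.shift {τ ℏ : ℂ} {lam : Space} (hr : Regular τ ℏ lam) (p : Wt) :
    Regular τ ℏ (shift ℏ lam p) := by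
  intro α hα k
  have := hr α hα (p.1 * α.1 + p.2 * α.2 + k)
  rw [pair_shift]
  push_cast at this ⊢
  rwa [add_assoc, ← add_mul]

theorem Orth.mem_roots {p q : Wt} (h : Orth p q) :
    p + p ∈ roots ∧ q + q ∈ roots ∧ p + q ∈ roots ∧ p - q ∈ roots :=
  orth_cases h (C := fun p q => p + p ∈ roots ∧ q + q ∈ roots ∧ p + q ∈ roots ∧ p - q ∈ roots)
    (by decide) (by decide) (by decide) (by decide) (by decide) (by decide) (by decide) (by decide)

theorem Regular.nonVanishing {τ ℏ : ℂ} (hℏ : GenericStep τ ℏ) {lam : Space}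
    (hr : Regular τ ℏ lam) {p q : Wt} (h : Orth p q) :
    NonVanishing (theta τ) ℏ (pair lam p) (pair lam q) := by
  obtain ⟨h1, h2, h3, h4⟩ := h.mem_roots
  refine ⟨hℏ, fun k => ?_, fun k => ?_, fun k => ?_, fun k => ?_⟩
  · rw [two_mul, ← pair_add]; exact hr _ h1 k
  · rw [two_mul, ← pair_add]; exact hr _ h2 k
  · rw [← pair_add]; exact hr _ h3 k
  · rw [← pair_sub]; exact hr _ h4 k

theorem wY_neg (t : ℂ → ℂ) (h a b u : ℂ) : wY t h a (-b) u = wY t h a b u := by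
  simp only [wY, sub_neg_eq_add, ← sub_eq_add_neg]; ring

theorem c00_neg (t : ℂ → ℂ) (h a b u : ℂ) : c00 t h a (-b) u = c00 t h a b u := by
  simp only [c00, sub_neg_eq_add, ← sub_eq_add_neg]; ring

section

variable {τ ℏ : ℂ} {lam : Space} {p q : Wt}

theorem Regular.opp_ne_zero (hr : Regular τ ℏ lam) (h : Orth p q) :
    theta τ (pair lam p + pair lam q + ℏ) ≠ 0 ∧ theta τ (pair lam p + -pair lam q + ℏ) ≠ 0 := by
  obtain ⟨-, -, h3, h4⟩ := h.mem_roots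
  have h5 := hr _ h3 1
  have h6 := hr _ h4 1
  rw [pair_add] at h5
  rw [pair_sub] at h6
  exact ⟨by simpa using h5, by simpa [sub_eq_add_neg] using h6⟩

theorem faceOp_zero_orth (h : Orth p q) (r : Wt) (u : ℂ) :
    faceOp τ ℏ (k := 1) 0 u lam (e3 p q r) =
      wD (theta τ) ℏ (pair lam p) (pair lam q) u • e3 p q r +
        wE (theta τ) ℏ (pair lam p) (pair lam q) u • e3 q p r := by
  rw [faceOp_zero_e3 h.1 h.2.1, sum_W11_orth (fun s t => e3 s t r) u h]

theorem faceOp_zero_same (h : Orth p q) (r : Wt) (u : ℂ) :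
    faceOp τ ℏ (k := 1) 0 u lam (e3 p p r) = wA (theta τ) ℏ u • e3 p p r := by
  rw [faceOp_zero_e3 h.1 h.1, sum_W11_same (fun s t => e3 s t r) u h]

theorem faceOp_zero_opp (hr : Regular τ ℏ lam) (h : Orth p q) (r : Wt) (u : ℂ) :
    faceOp τ ℏ (k := 1) 0 u lam (e3 p (-p) r) =
      wY (theta τ) ℏ (pair lam p) (pair lam q) u • e3 p (-p) r +
        (wZ (theta τ) ℏ (pair lam p) (pair lam q) u • e3 (-p) p r +
        (wX (theta τ) ℏ (pair lam p) (pair lam q) u • e3 q (-q) r +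
        wX (theta τ) ℏ (pair lam p) (-pair lam q) u • e3 (-q) q r)) := by
  rw [faceOp_zero_e3 h.1 h.neg_left.1, sum_W11_opp (fun s t => e3 s t r) u h (hr.opp_ne_zero h).1
    (hr.opp_ne_zero h).2]

theorem faceOp_one_orth (h : Orth p q) (r : Wt) (u : ℂ) :
    faceOp τ ℏ (k := 1) 1 u lam (e3 r p q) =
      wD (theta τ) ℏ (pair (shift ℏ lam r) p) (pair (shift ℏ lam r) q) u • e3 r p q +
        wE (theta τ) ℏ (pair (shift ℏ lam r) p) (pair (shift ℏ lam r) q) u • e3 r q p := by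
  rw [faceOp_one_e3 h.1 h.2.1, sum_W11_orth (fun s t => e3 r s t) u h]

theorem faceOp_one_same (h : Orth p q) (r : Wt) (u : ℂ) :
    faceOp τ ℏ (k := 1) 1 u lam (e3 r p p) = wA (theta τ) ℏ u • e3 r p p := by
  rw [faceOp_one_e3 h.1 h.1, sum_W11_same (fun s t => e3 r s t) u h]

theorem faceOp_one_opp (hr : Regular τ ℏ lam) (h : Orth p q) (r : Wt) (u : ℂ) :
    faceOp τ ℏ (k := 1) 1 u lam (e3 r p (-p)) =
      wY (theta τ) ℏ (pair (shift ℏ lam r) p) (pair (shift ℏ lam r) q) u • e3 r p (-p) +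
        (wZ (theta τ) ℏ (pair (shift ℏ lam r) p) (pair (shift ℏ lam r) q) u • e3 r (-p) p +
        (wX (theta τ) ℏ (pair (shift ℏ lam r) p) (pair (shift ℏ lam r) q) u • e3 r q (-q) +
        wX (theta τ) ℏ (pair (shift ℏ lam r) p) (-pair (shift ℏ lam r) q) u • e3 r (-q) q)) := by
  rw [faceOp_one_e3 h.1 h.neg_left.1, sum_W11_opp (fun s t => e3 r s t) u h
    ((hr.shift r).opp_ne_zero h).1 ((hr.shift r).opp_ne_zero h).2]

theorem faceOp_one_neg_opp (hr : Regular τ ℏ lam) (h : Orth p q) (r : Wt) (u : ℂ) :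
    faceOp τ ℏ (k := 1) 1 u lam (e3 r (-p) p) =
      wY (theta τ) ℏ (-pair (shift ℏ lam r) p) (pair (shift ℏ lam r) q) u • e3 r (-p) p +
        (wZ (theta τ) ℏ (-pair (shift ℏ lam r) p) (pair (shift ℏ lam r) q) u • e3 r p (-p) +
        (wX (theta τ) ℏ (-pair (shift ℏ lam r) p) (pair (shift ℏ lam r) q) u • e3 r q (-q) +
        wX (theta τ) ℏ (-pair (shift ℏ lam r) p) (-pair (shift ℏ lam r) q) u • e3 r (-q) q)) := by
  simpa only [neg_neg, pair_neg] using faceOp_one_opp hr h.neg_left r u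

theorem efVec_zero (h : Orth p q) : efVec τ ℏ lam p 0 =
    theta τ (2 * pair (shift ℏ lam p) p + 2 * ℏ) • e3 p p (-p) +
      (theta τ (2 * -pair (shift ℏ lam p) p + 2 * ℏ) • e3 p (-p) p +
      (theta τ (2 * pair (shift ℏ lam p) q + 2 * ℏ) • e3 p q (-q) +
      theta τ (2 * -pair (shift ℏ lam p) q + 2 * ℏ) • e3 p (-q) q)) := by
  ext x
  simp only [efVec, fVec_zero, h.sum_P1, Pi.add_apply, Pi.smul_apply, smul_eq_mul, e3, pair_neg,
    neg_neg]
  ring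

theorem feVec_zero (h : Orth p q) (r : Wt) : feVec τ ℏ lam 0 r =
    theta τ (2 * pair lam p + 2 * ℏ) • e3 p (-p) r +
      (theta τ (2 * -pair lam p + 2 * ℏ) • e3 (-p) p r +
      (theta τ (2 * pair lam q + 2 * ℏ) • e3 q (-q) r +
      theta τ (2 * -pair lam q + 2 * ℏ) • e3 (-q) q r)) := by
  ext x
  simp only [feVec, fVec_zero, h.sum_P1, Pi.add_apply, Pi.smul_apply, smul_eq_mul, e3, pair_neg,
    neg_neg]
  ring

theorem efVec_add (h : Orth p q) (r : Wt) : efVec τ ℏ lam r (p + q) =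
    theta τ (pair (shift ℏ lam r) p - pair (shift ℏ lam r) q + ℏ) • e3 r p q +
      theta τ (pair (shift ℏ lam r) q - pair (shift ℏ lam r) p + ℏ) • e3 r q p := by
  ext x
  simp only [efVec, fVec_add h, Pi.add_apply, Pi.smul_apply, smul_eq_mul, e3]
  ring

theorem feVec_add (h : Orth p q) (r : Wt) : feVec τ ℏ lam (p + q) r =
    theta τ (pair lam p - pair lam q + ℏ) • e3 p q r +
      theta τ (pair lam q - pair lam p + ℏ) • e3 q p r := by
  ext x
  simp only [feVec, fVec_add h, Pi.add_apply, Pi.smul_apply, smul_eq_mul, e3]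
  ring

theorem pair_shift_neg_self (ℏ : ℂ) (lam : Space) {p : Wt} (hp : p ∈ P1) :
    pair (shift ℏ lam (-p)) p = pair lam p - ℏ := by
  simp only [P1, Finset.mem_insert, Finset.mem_singleton] at hp
  rcases hp with rfl | rfl | rfl | rfl <;> simp [pair, shift] <;> ring

/-- The total weight 2p + q is a sum of an element of P₂ and one of P₁ in only one way, so a single
coefficient survives. -/
theorem fusedOp12_add (hτ : 0 < τ.im) (hℏ : GenericStep τ ℏ) (hr : Regular τ ℏ lam) (h : Orth p q)
    (u : ℂ) : fusedOp12 τ ℏ u lam (efVec τ ℏ lam p (p + q)) =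
      (g (theta τ) ℏ u * theta τ (u + 3 * ℏ)) • feVec τ ℏ lam (p + q) p := by
  have ht := thetaLike_theta hτ
  have nv := hr.nonVanishing hℏ h
  rw [efVec_add h, feVec_add h]
  simp only [fusedOp12, LinearMap.comp_apply, map_add, map_smul, faceOp_zero_same h,
    faceOp_zero_orth h, faceOp_one_orth h, faceOp_one_orth h.symm, faceOp_one_same h,
    pair_shift_self _ _ h.1, pair_shift_orth _ _ h]
  match_scalars
  · linear_combination fuseAdd_p_p_q ht nv u
  · linear_combination fuseAdd_p_q_p ht nv u
  · linear_combination fuseAdd_q_p_p ht nv u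

/-- The total weight p splits as 0 + p, (p+q) − q and (p−q) + q. The components involving −q follow
from those for q by replacing b with −b. -/
theorem fusedOp12_zero (hτ : 0 < τ.im) (hℏ : GenericStep τ ℏ) (hr : Regular τ ℏ lam) (h : Orth p q)
    (u : ℂ) : fusedOp12 τ ℏ u lam (efVec τ ℏ lam p 0) =
      g (theta τ) ℏ u • (c00 (theta τ) ℏ (pair lam p) (pair lam q) u • feVec τ ℏ lam 0 p +
        c0p (theta τ) ℏ (pair lam p) (pair lam q) u • feVec τ ℏ lam (p + q) (-q) +
        c0p (theta τ) ℏ (pair lam p) (-pair lam q) u • feVec τ ℏ lam (p + -q) q) := by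
  have ht := thetaLike_theta hτ
  have nv := hr.nonVanishing hℏ h
  have nv' := hr.nonVanishing hℏ h.neg_right
  rw [pair_neg] at nv'
  rw [efVec_zero h, feVec_zero h, feVec_add h, feVec_add h.neg_right]
  simp only [fusedOp12, LinearMap.comp_apply, map_add, map_smul, faceOp_zero_same h,
    faceOp_zero_orth h, faceOp_zero_orth h.neg_right, faceOp_zero_opp hr h,
    faceOp_one_opp hr h, faceOp_one_opp hr h.symm, faceOp_one_neg_opp hr h,
    faceOp_one_neg_opp hr h.symm, faceOp_one_same h,
    faceOp_one_orth h.symm, faceOp_one_orth h.neg_right, faceOp_one_orth h.symm.neg_left,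
    faceOp_one_orth h,
    pair_neg, pair_shift_self _ _ h.1, pair_shift_self _ _ h.2.1, pair_shift_orth _ _ h,
    pair_shift_orth _ _ h.symm,
    pair_shift_neg_self _ _ h.2.1, pair_shift_orth _ _ h.symm.neg_left]
  match_scalars
  · linear_combination fuseZero_p_p_np ht nv u
  · linear_combination fuseZero_p_np_p ht nv u
  · linear_combination fuseZero_p_q_nq ht nv u
  -- The pair (p, −q) is also orthogonal; `wY` is even in b, which matches the weight that occurs
  -- here.
  · have e := fuseZero_p_q_nq ht nv' u
    rw [wY_neg] at e
    simp only [neg_neg] at e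
    linear_combination e
  · linear_combination fuseZero_np_p_p ht nv u
  · linear_combination fuseZero_q_nq_p ht nv u
  · linear_combination fuseZero_q_p_nq ht nv u
  · have e := fuseZero_q_nq_p ht nv' u
    rw [c00_neg, show -(-pair lam q + ℏ) = pair lam q - ℏ by ring] at e
    linear_combination e
  · have e := fuseZero_q_p_nq ht nv' u
    rw [show -(-pair lam q + ℏ) = pair lam q - ℏ by ring] at e
    linear_combination e

/-- The total weight q splits as 0 + q, (q−p) + p and (q+p) − p. -/
theorem fusedOp12_sub (hτ : 0 < τ.im) (hℏ : GenericStep τ ℏ) (hr : Regular τ ℏ lam) (h : Orth p q)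
    (u : ℂ) : fusedOp12 τ ℏ u lam (efVec τ ℏ lam p (-p + q)) =
      g (theta τ) ℏ u • (cm0 (theta τ) ℏ (pair lam p) (pair lam q) u • feVec τ ℏ lam 0 q +
        cmm (theta τ) ℏ (pair lam p) (pair lam q) u • feVec τ ℏ lam (-p + q) p +
        cmp (theta τ) ℏ (pair lam p) (pair lam q) u • feVec τ ℏ lam (p + q) (-p)) := by
  have ht := thetaLike_theta hτ
  have nv := hr.nonVanishing hℏ h
  rw [efVec_add h.neg_left, feVec_zero h, feVec_add h, feVec_add h.neg_left]
  simp only [fusedOp12, LinearMap.comp_apply, map_add, map_smul,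
    faceOp_zero_orth h, faceOp_zero_opp hr h,
    faceOp_one_opp hr h, faceOp_one_neg_opp hr h.symm, faceOp_one_same h.symm,
    faceOp_one_orth h.symm.neg_right, faceOp_one_orth h.neg_left,
    faceOp_one_orth h,
    pair_neg, pair_shift_self _ _ h.1, pair_shift_self _ _ h.2.1, pair_shift_orth _ _ h,
    pair_shift_orth _ _ h.symm,
    pair_shift_neg_self _ _ h.1, pair_shift_orth _ _ h.neg_left]
  match_scalars
  · linear_combination fuseSub_p_np_q ht nv u
  · linear_combination fuseSub_p_q_np ht nv u
  · linear_combination fuseSub_np_p_q ht nv u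
  · linear_combination fuseSub_np_q_p ht nv u
  · linear_combination fuseSub_q_nq_q ht nv u
  · linear_combination fuseSub_q_q_nq ht nv u
  · linear_combination fuseSub_q_p_np ht nv u
  · linear_combination fuseSub_q_np_p ht nv u
  · linear_combination fuseSub_nq_q_q ht nv u

end

set_option linter.unusedSimpArgs false

/-! ### The coefficients of the fused operator on `f̄ ⊗ f̄`, in coordinates `a = λ_p`, `b = λ_q` -/

section coefficients

variable (t : ℂ → ℂ) (h : ℂ)

/-- The coefficient of `f̄_{p+q} ⊗ f̄_0 ↦ f̄_0 ⊗ f̄_{p+q}`. -/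
noncomputable def cp0 (a b u : ℂ) : ℂ := t u * t (u + 3 * h) * t (a + b - h) / t (a + b + h)

/-- The coefficient of `f̄_{p+q} ⊗ f̄_0 ↦ f̄_{p+q} ⊗ f̄_0`. -/
noncomputable def cpp (a b u : ℂ) : ℂ :=
  -(t (2 * h) * t (u - a - b - h) * t (u + 3 * h)) / t (a + b + h)

/-- The non-constant part of the potential of the second difference operator, with two terms. -/
noncomputable def S (a b : ℂ) : ℂ :=
  t (2 * b + 2 * h) * t (a + b - h) * t (a - b + h) / (t (2 * b) * t (a + b + h) * t (a - b - h)) +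
    t (2 * b - 2 * h) * t (a + b + h) * t (a - b - h) /
      (t (2 * b) * t (a + b - h) * t (a - b + h))

/-- The coefficient of `f̄_0 ⊗ f̄_0 ↦ f̄_0 ⊗ f̄_0`. -/
noncomputable def c000 (a b u : ℂ) : ℂ :=
  t u * t (u + 3 * h) * (t (5 * h) * t (4 * h) / (t (6 * h) * t h) - S t h a b) -
    t (u + 6 * h) * t (u - 3 * h) * t (2 * h) / t (6 * h)

/-- The component of the image of `f̄_0 ⊗ f̄_0` along `f̄_{p+q} ⊗ e_{-p} ⊗ e_{-q}`. -/
noncomputable def d00 (a b u : ℂ) : ℂ :=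
  t (2 * a + 2 * h) * c0p t h (-(a + h)) b (u - h) * cmp t h a b u + t (2 * (-a) + 2 * h) *
    c0p t h (-(-a + h)) b (u - h) * cmm t h (-a) b u + t (2 * b + 2 * h) *
    c00 t h (-(b + h)) a (u - h) * c0p t h b a u

/-- The summand of the potential of the second difference operator. -/
noncomputable def kTerm (a b : ℂ) : ℂ :=
  t (2 * h) / t (6 * h) * (t (2 * a + 2 * h) / t (2 * a)) * (t (2 * b + 2 * h) / t (2 * b)) *
    (t (a + b - 5 * h) / t (a + b + h)) * (t (a + b + 2 * h) / t (a + b))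

/-- The coefficient of the first difference operator. -/
noncomputable def wM (a b : ℂ) : ℂ := t (a + b - h) / t (a + b) * (t (a - b - h) / t (a - b))

/-- The coefficient of the second difference operator. -/
noncomputable def wN (a b : ℂ) : ℂ := t (a + b - h) / t (a + b + h)

end coefficients

/-! ### Theta identities for the image of f̄ ⊗ f̄ -/

/-- In `addZero_x_y_z` the component of the image of f̄_{p+q} ⊗ f̄_0 along f̄ ⊗ e_y ⊗ e_z is
computed, x telling whether the first factor has weight 0, p + q or p − q. Coefficients at u − ħ
come from the last three steps, those at u from the first three. -/
theorem addZero_zero_p_q {t : ℂ → ℂ} (ht : ThetaLike t) {h a b : ℂ}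
    (nv : NonVanishing t h a b) (u : ℂ) :
    t (a - b + h) * c00 t h b (a + h) (u - h) * c00 t h a b u + t (b - a + h) *
      c0p t h a (-(b + h)) (u - h) * cm0 t h b a u = cp0 t h a b u * t (a - b + h) := by
  obtain ⟨ev, L, rfl, rfl, rfl, rfl, hv, hL⟩ := ht.lattice nv u
  simp only [c00, c0p, cm0, cp0, neg_mul, mul_neg, ev_two, ev_three, ev_four,
    ev_five, ev_six, ev_add, ev_sub, ev_neg, hv, Int.reduceMul, Int.reduceAdd, Int.reduceSub,
    Int.reduceNeg, Int.reduceLT, neg_zero, hL.neg₁, hL.neg₂, hL.neg₃, hL.neg₄]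
  have r1 := hL.three (0, 1, -1, -1) (0, 1, -1, 0) (1, 1, -1, 2) (0, 2, -2, 1)
  simp only [Prod.mk_sub_mk, Prod.mk_add_mk, Int.reduceAdd, Int.reduceSub, Int.reduceNeg,
    Int.reduceLT, neg_zero, hL.neg₁, hL.neg₂, hL.neg₃, hL.neg₄]
    at r1
  have n0_2_0 := hL.right 0
  have n1_m1_m1 := hL.minus (-1)
  have n1_m1_0 := hL.minus 0
  have n1_m1_1 := hL.minus 1
  have n1_1_0 := hL.plus 0
  have n1_1_1 := hL.plus 1
  have key : L (0, 1, -1, -1) * L (0, 1, -1, 2) * L (1, 0, 0, 1) * L (1, 0, 0, 2) +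
    L (0, 0, 0, 1) * L (0, 0, 0, 2) * L (1, -1, 1, 1) * L (1, 1, -1, 2) - L (0, 1, -1, 0) *
    L (0, 1, -1, 1) * L (1, 0, 0, 0) * L (1, 0, 0, 3) = 0 := by
    linear_combination 1 * r1
  linear_combination (norm := skip) L (0, 1, 1, -1) / (L (0, 1, -1, 0) * L (0, 1, 1, 1)) * key
  field_simp
  ring

theorem addZero_add_p_np {t : ℂ → ℂ} (ht : ThetaLike t) {h a b : ℂ}
    (nv : NonVanishing t h a b) (u : ℂ) :
    t (a - b + h) * c0p t h b (a + h) (u - h) * t (u + 3 * h) = cpp t h a b u *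
      t (2 * (a + h) + 2 * h) := by
  obtain ⟨ev, L, rfl, rfl, rfl, rfl, hv, hL⟩ := ht.lattice nv u
  simp only [c0p, cpp, neg_mul, mul_neg, ev_two, ev_three, ev_four,
    ev_five, ev_six, ev_add, ev_sub, ev_neg, hv, Int.reduceMul, Int.reduceAdd, Int.reduceSub,
    Int.reduceNeg, Int.reduceLT, neg_zero, hL.neg₁, hL.neg₂, hL.neg₃, hL.neg₄]
  have n1_m1_1 := hL.minus 1
  have n1_1_1 := hL.plus 1
  field_simp

theorem addZero_add_np_p {t : ℂ → ℂ} (ht : ThetaLike t) {h a b : ℂ}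
    (nv : NonVanishing t h a b) (u : ℂ) :
    t (a - b + h) * c0p t h b (-(a + h)) (u - h) * cmp t h a b u + t (b - a + h) *
      c00 t h a (b + h) (u - h) * c0p t h b a u = cpp t h a b u * t (2 * (-(a + h)) + 2 * h) :=
      by
  obtain ⟨ev, L, rfl, rfl, rfl, rfl, hv, hL⟩ := ht.lattice nv u
  simp only [c00, c0p, cmp, cpp, neg_mul, mul_neg, ev_two, ev_three, ev_four,
    ev_five, ev_six, ev_add, ev_sub, ev_neg, hv, Int.reduceMul, Int.reduceAdd, Int.reduceSub,
    Int.reduceNeg, Int.reduceLT, neg_zero, hL.neg₁, hL.neg₂, hL.neg₃, hL.neg₄]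
  have r1 := hL.three (0, 0, 0, 2) (0, -1, 1, 2) (1, 0, 0, 3) (0, 1, 1, 4)
  simp only [Prod.mk_sub_mk, Prod.mk_add_mk, Int.reduceAdd, Int.reduceSub, Int.reduceNeg,
    Int.reduceLT, neg_zero, hL.neg₁, hL.neg₂, hL.neg₃, hL.neg₄]
    at r1
  have n1_m1_m1 := hL.minus (-1)
  have n1_m1_0 := hL.minus 0
  have n1_m1_1 := hL.minus 1
  have n1_1_0 := hL.plus 0
  have n1_1_1 := hL.plus 1
  have n2_0_0 := hL.left 0
  have key : L (0, 0, 0, 2) * L (0, 1, 1, 2) * L (1, -2, 0, 1) * L (1, 1, -1, 1) +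
    L (0, 1, -1, -2) * L (0, 2, 0, 2) * L (1, -1, -1, 1) * L (1, 0, 0, 1) - L (0, 1, -1, 0) *
    L (0, 2, 0, 0) * L (1, -1, -1, -1) * L (1, 0, 0, 3) = 0 := by
    linear_combination 1 * r1
  linear_combination (norm := skip) L (0, 0, 0, 2) / (L (0, 1, -1, 0) * L (0, 1, 1, 1)) * key
  field_simp
  ring

/-- The last two steps add up to 2q, which is not in P₂, so that this component has to cancel. -/
theorem addZero_sub_q_q {t : ℂ → ℂ} (ht : ThetaLike t) {h a b : ℂ}
    (nv : NonVanishing t h a b) (u : ℂ) :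
    t (a - b + h) * c00 t h b (a + h) (u - h) * c0p t h a (-b) u + t (b - a + h) *
      c0p t h a (-(b + h)) (u - h) * cmm t h b a u = 0 := by
  obtain ⟨ev, L, rfl, rfl, rfl, rfl, hv, hL⟩ := ht.lattice nv u
  simp only [c00, c0p, cmm, neg_mul, mul_neg, ev_two, ev_three, ev_four,
    ev_five, ev_six, ev_add, ev_sub, ev_neg, hv, Int.reduceMul, Int.reduceAdd, Int.reduceSub,
    Int.reduceNeg, Int.reduceLT, neg_zero, hL.neg₁, hL.neg₂, hL.neg₃, hL.neg₄]
  have n0_2_0 := hL.right 0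
  have n1_m1_m1 := hL.minus (-1)
  have n1_m1_0 := hL.minus 0
  have n1_m1_1 := hL.minus 1
  have n1_1_0 := hL.plus 0
  have n1_1_1 := hL.plus 1
  field_simp
  ring

/-- Among the instances used, `r5` involves u and ħ only. It accounts for the λ-independent part,
that is, the constant [5ħ][4ħ] / [6ħ][ħ] and the numerator of H(u). -/
theorem zeroZero_zero {t : ℂ → ℂ} (ht : ThetaLike t) {h a b : ℂ}
    (nv : NonVanishing t h a b) (u : ℂ) :
    t (2 * a + 2 * h) * c00 t h (-(a + h)) b (u - h) * c00 t h a b u + t (2 * b + 2 * h) *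
      c0p t h (-(b + h)) a (u - h) * cm0 t h b a u + t (2 * (-b) + 2 * h) *
      c0p t h (-(-b + h)) a (u - h) * cm0 t h (-b) a u = c000 t h a b u * t (2 * a + 2 * h) := by
  obtain ⟨ev, L, rfl, rfl, rfl, rfl, hv, hL⟩ := ht.lattice nv u
  simp only [S, c00, c000, c0p, cm0, neg_mul, mul_neg, ev_two, ev_three, ev_four,
    ev_five, ev_six, ev_add, ev_sub, ev_neg, hv, Int.reduceMul, Int.reduceAdd, Int.reduceSub,
    Int.reduceNeg, Int.reduceLT, neg_zero, hL.neg₁, hL.neg₂, hL.neg₃, hL.neg₄]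
  have r1 := hL.three (0, 0, 0, 1) (0, 0, 0, -2) (0, 1, 1, 0) (0, 0, 2, -1)
  have r2 := hL.three (0, 0, 0, 1) (0, -1, -1, 1) (1, 0, 0, 3) (0, 0, 0, 3)
  have r3 := hL.three (0, 0, 0, 1) (0, 0, 0, -1) (0, 1, 1, 1) (0, 0, 2, 1)
  have r4 := hL.three (0, 0, 0, 1) (0, -1, 1, 1) (1, 0, 0, 3) (0, 0, 0, 3)
  have r5 := hL.three (0, 0, 0, 4) (0, 0, 0, 3) (1, 0, 0, 6) (0, 0, 0, 9)
  simp only [Prod.mk_sub_mk, Prod.mk_add_mk, Int.reduceAdd, Int.reduceSub, Int.reduceNeg,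
    Int.reduceLT, neg_zero, hL.neg₁, hL.neg₂, hL.neg₃, hL.neg₄]
    at r1 r2 r3 r4 r5
  have n0_0_1 := hL.step 1 (by norm_num)
  have n0_0_6 := hL.step 6 (by norm_num)
  have n0_2_0 := hL.right 0
  have n1_m1_m1 := hL.minus (-1)
  have n1_m1_0 := hL.minus 0
  have n1_m1_1 := hL.minus 1
  have n1_1_m1 := hL.plus (-1)
  have n1_1_0 := hL.plus 0
  have n1_1_1 := hL.plus 1
  have key : L (0, 0, 0, 1) * L (0, 0, 0, 6) * L (0, 0, 2, 0) * L (0, 1, -1, -1) ^ 2 *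
    L (0, 1, -1, 2) * L (0, 1, 1, -1) ^ 2 * L (0, 1, 1, 2) * L (1, 0, 0, 1) * L (1, 0, 0, 2) -
    L (0, 0, 0, 1) ^ 2 * L (0, 0, 0, 2) * L (0, 0, 0, 6) * L (0, 0, 2, 2) * L (0, 1, -1, 1) *
    L (0, 1, 1, -1) ^ 2 * L (0, 1, 1, 0) * L (1, -1, 1, 1) * L (1, 1, -1, 2) -
    L (0, 0, 0, 1) ^ 2 * L (0, 0, 0, 2) * L (0, 0, 0, 6) * L (0, 0, 2, -2) *
    L (0, 1, -1, -1) ^ 2 * L (0, 1, -1, 0) * L (0, 1, 1, 1) * L (1, -1, -1, 1) * L (1, 1, 1, 2) -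
    L (0, 0, 0, 4) * L (0, 0, 0, 5) * L (0, 0, 2, 0) * L (0, 1, -1, -1) * L (0, 1, -1, 0) *
    L (0, 1, -1, 1) * L (0, 1, 1, -1) * L (0, 1, 1, 0) * L (0, 1, 1, 1) * L (1, 0, 0, 0) *
    L (1, 0, 0, 3) + L (0, 0, 0, 1) * L (0, 0, 0, 6) * L (0, 0, 2, 2) * L (0, 1, -1, 0) *
    L (0, 1, -1, 1) ^ 2 * L (0, 1, 1, -1) ^ 2 * L (0, 1, 1, 0) * L (1, 0, 0, 0) *
    L (1, 0, 0, 3) + L (0, 0, 0, 1) * L (0, 0, 0, 6) * L (0, 0, 2, -2) * L (0, 1, -1, -1) ^ 2 *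
    L (0, 1, -1, 0) * L (0, 1, 1, 0) * L (0, 1, 1, 1) ^ 2 * L (1, 0, 0, 0) * L (1, 0, 0, 3) +
    L (0, 0, 0, 1) * L (0, 0, 0, 2) * L (0, 0, 2, 0) * L (0, 1, -1, -1) * L (0, 1, -1, 0) *
    L (0, 1, -1, 1) * L (0, 1, 1, -1) * L (0, 1, 1, 0) * L (0, 1, 1, 1) * L (1, 0, 0, -3) *
    L (1, 0, 0, 6) = 0 := by
    linear_combination L (0, 0, 0, 6) * L (0, 1, -1, -1) * L (0, 1, -1, 0) * L (0, 1, 1, -1) *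
      L (0, 1, 1, 1) * L (1, 0, 0, 1) * L (1, 0, 0, 2) * r1 - L (0, 0, 0, 1) * L (0, 0, 0, 6) *
      L (0, 0, 2, -2) * L (0, 1, -1, -1) ^ 2 * L (0, 1, -1, 0) * L (0, 1, 1, 1) * r2 +
      L (0, 0, 0, 6) * L (0, 1, -1, -1) * L (0, 1, -1, 2) * L (0, 1, 1, -1) ^ 2 *
      L (1, 0, 0, 1) * L (1, 0, 0, 2) * r3 - L (0, 0, 0, 1) * L (0, 0, 0, 6) * L (0, 0, 2, 2) *
      L (0, 1, -1, 1) * L (0, 1, 1, -1) ^ 2 * L (0, 1, 1, 0) * r4 - L (0, 0, 2, 0) *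
      L (0, 1, -1, -1) * L (0, 1, -1, 0) * L (0, 1, -1, 1) * L (0, 1, 1, -1) * L (0, 1, 1, 0) *
      L (0, 1, 1, 1) * r5
  linear_combination (norm := skip) L (0, 2, 0, 2) / (L (0, 0, 0, 1) * L (0, 0, 0, 6) * L (0, 0, 2, 0) * L (0, 1, -1, -1) * L (0, 1, -1, 0) * L (0, 1, -1, 1) * L (0, 1, 1, -1) * L (0, 1, 1, 0) * L (0, 1, 1, 1)) *
    key
  field_simp
  ring

/-- The components with last steps −p, −q and −q, −p have to be in the ratio of the two coefficients
of f̄_{−p−q}. No closed form of `d00` is needed, since it does not enter the difference operators.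
-/
theorem zeroZero_add {t : ℂ → ℂ} (ht : ThetaLike t) {h a b : ℂ}
    (nv : NonVanishing t h a b) (u : ℂ) :
    t (a - b + h) * d00 t h a b u = t (b - a + h) * d00 t h b a u := by
  obtain ⟨ev, L, rfl, rfl, rfl, rfl, hv, hL⟩ := ht.lattice nv u
  simp only [c00, c0p, cmm, cmp, d00, neg_mul, mul_neg, ev_two, ev_three, ev_four,
    ev_five, ev_six, ev_add, ev_sub, ev_neg, hv, Int.reduceMul, Int.reduceAdd, Int.reduceSub,
    Int.reduceNeg, Int.reduceLT, neg_zero, hL.neg₁, hL.neg₂, hL.neg₃, hL.neg₄]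
  have r1 := hL.three (0, 0, 0, 1) (0, 0, 2, 0) (1, 0, 0, 1) (0, 1, 1, 0)
  have r2 := hL.three (0, 0, 0, 1) (0, -1, 1, 0) (1, 0, 0, 1) (0, 1, 1, 0)
  have r3 := hL.three (0, 0, 0, 1) (0, 0, 0, 2) (0, 2, 0, 0) (0, 1, -1, 1)
  have r4 := hL.three (0, 0, 0, 1) (0, 0, 0, -1) (0, 1, 1, 0) (0, 0, 2, -1)
  simp only [Prod.mk_sub_mk, Prod.mk_add_mk, Int.reduceAdd, Int.reduceSub, Int.reduceNeg,
    Int.reduceLT, neg_zero, hL.neg₁, hL.neg₂, hL.neg₃, hL.neg₄]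
    at r1 r2 r3 r4
  have n0_0_1 := hL.step 1 (by norm_num)
  have n0_2_0 := hL.right 0
  have n1_m1_m1 := hL.minus (-1)
  have n1_m1_0 := hL.minus 0
  have n1_m1_1 := hL.minus 1
  have n1_1_m1 := hL.plus (-1)
  have n1_1_0 := hL.plus 0
  have n1_1_1 := hL.plus 1
  have n2_0_0 := hL.left 0
  have key : L (0, 0, 0, 1) * L (0, 0, 0, 2) * L (0, 0, 2, 0) * L (0, 1, -1, -1) *
    L (0, 1, -1, 1) * L (0, 1, 1, -1) * L (0, 1, 1, 0) * L (1, -2, 0, 1) * L (1, 1, -1, 1) -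
    L (0, 0, 0, 1) * L (0, 0, 2, 0) * L (0, 1, -1, 0) * L (0, 1, -1, 1) ^ 2 * L (0, 1, 1, 1) *
    L (0, 2, 0, -2) * L (1, -1, -1, 1) * L (1, 0, 0, 1) - L (0, 0, 0, 1) * L (0, 0, 2, 0) *
    L (0, 1, -1, -2) * L (0, 1, -1, 1) ^ 2 * L (0, 1, 1, -1) * L (0, 2, 0, 0) *
    L (1, -1, -1, 1) * L (1, 0, 0, 1) + L (0, 0, 0, 1) * L (0, 0, 0, 2) * L (0, 1, -1, -1) *
    L (0, 1, -1, 1) * L (0, 1, 1, -1) * L (0, 1, 1, 0) * L (0, 2, 0, 0) * L (1, -1, 1, 1) *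
    L (1, 0, -2, 1) + L (0, 0, 0, 1) * L (0, 0, 2, -2) * L (0, 1, -1, -1) ^ 2 * L (0, 1, -1, 0) *
    L (0, 1, 1, 1) * L (0, 2, 0, 0) * L (1, -1, -1, 1) * L (1, 0, 0, 1) + L (0, 0, 0, 1) *
    L (0, 0, 2, 0) * L (0, 1, -1, -1) ^ 2 * L (0, 1, -1, 2) * L (0, 1, 1, -1) * L (0, 2, 0, 0) *
    L (1, -1, -1, 1) * L (1, 0, 0, 1) = 0 := by
    linear_combination L (0, 0, 0, 2) * L (0, 1, -1, -1) * L (0, 1, -1, 1) * L (0, 1, 1, 0) *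
      L (0, 2, 0, 0) * r1 + L (0, 0, 0, 2) * L (0, 0, 2, 0) * L (0, 1, -1, -1) *
      L (0, 1, -1, 1) * L (0, 1, 1, 0) * r2 - L (0, 0, 2, 0) * L (0, 1, -1, 1) ^ 2 *
      L (1, -1, -1, 1) * L (1, 0, 0, 1) * r3 + L (0, 1, -1, -1) ^ 2 * L (0, 2, 0, 0) *
      L (1, -1, -1, 1) * L (1, 0, 0, 1) * r4
  linear_combination (norm := skip) L (0, 0, 0, 2) * L (0, 0, 2, 2) * L (0, 2, 0, 2) *
    L (0, 1, 1, 2) / (L (0, 0, 0, 1) * L (0, 0, 2, 0) * L (0, 1, -1, -1) * L (0, 1, -1, 0) * L (0, 1, -1, 1) * L (0, 1, 1, -1) * L (0, 1, 1, 0) * L (0, 1, 1, 1) * L (0, 2, 0, 0)) *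
    key
  field_simp
  ring

/-! ### The potential and the identities behind commutativity -/

/-- Passes between two forms of the potential: the sum of four terms shows its symmetry under sign
changes and exchange of a and b, whereas the two-term `S` is the one that arises from fusion and
enters the commutator. -/
theorem sum_kTerm {t : ℂ → ℂ} (ht : ThetaLike t) {h a b : ℂ}
    (nv : NonVanishing t h a b) :
    kTerm t h a b + kTerm t h a (-b) + kTerm t h (-a) b + kTerm t h (-a) (-b) = t (5 * h) *
      t (4 * h) / (t (6 * h) * t h) - S t h a b := by
  obtain ⟨ev, L, -, rfl, rfl, rfl, hv, hL⟩ := ht.lattice nv 0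
  simp only [S, kTerm, neg_mul, mul_neg, ev_two, ev_three, ev_four,
    ev_five, ev_six, ev_add, ev_sub, ev_neg, hv, Int.reduceMul, Int.reduceAdd, Int.reduceSub,
    Int.reduceNeg, Int.reduceLT, neg_zero, hL.neg₁, hL.neg₂, hL.neg₃, hL.neg₄]
  have r1 := hL.three (0, 0, 2, -3) (0, 0, 2, 0) (0, 2, 2, 0) (0, 1, 3, -2)
  have r2 := hL.three (0, 0, 0, 2) (0, 0, 0, 1) (0, 1, 1, 0) (0, 0, 0, 5)
  have r3 := hL.three (0, 1, -1, -2) (0, 1, -1, 0) (0, 2, 0, 1) (0, 2, -2, 1)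
  have r4 := hL.three (0, 0, 0, 2) (0, 0, 0, 4) (0, 2, 0, 2) (0, 1, -1, 7)
  have r5 := hL.three (0, 1, -1, -1) (0, 1, -1, 0) (0, 2, 0, 1) (0, 2, -2, 1)
  have r6 := hL.three (0, 0, 0, 5) (0, 0, 0, 3) (0, 1, 1, 2) (0, 0, 2, 5)
  have r7 := hL.three (0, 0, 0, 1) (0, 0, 0, 3) (0, 1, 1, 3) (0, 0, 0, 7)
  have r8 := hL.three (0, 0, 0, 2) (0, 0, 0, 1) (0, 2, 0, 2) (0, 1, -1, 1)
  have r9 := hL.three (0, 0, 2, 2) (0, 0, 2, -1) (0, 2, 2, 0) (0, 1, 3, -3)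
  have r10 := hL.three (0, 0, 0, 1) (0, 0, 0, -1) (0, 1, 1, 1) (0, 0, 2, 0)
  have r11 := hL.three (0, 0, 0, 2) (0, 0, 0, 5) (0, 1, 1, 0) (0, 0, 2, 4)
  have r12 := hL.three (0, 0, 0, 1) (0, 0, 0, 5) (0, 2, 0, 3) (0, 1, -1, 3)
  have r13 := hL.three (0, 0, 0, 1) (0, 0, 0, -1) (0, 1, 1, 0) (0, 0, 2, -1)
  have r14 := hL.three (0, 0, 0, 3) (0, 0, 0, -3) (0, 1, 1, -1) (0, 0, 2, 0)
  have r15 := hL.three (0, 0, 0, 2) (0, 0, 0, -3) (0, 1, 1, -2) (0, 0, 2, 0)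
  have r16 := hL.three (0, 0, 2, -2) (0, 0, 2, 0) (0, 2, 2, 0) (0, 1, 3, -1)
  have r17 := hL.three (0, 0, 0, 1) (0, 0, 0, 3) (0, 1, -1, 3) (0, 0, 0, 7)
  simp only [Prod.mk_sub_mk, Prod.mk_add_mk, Int.reduceAdd, Int.reduceSub, Int.reduceNeg,
    Int.reduceLT, neg_zero, hL.neg₁, hL.neg₂, hL.neg₃, hL.neg₄]
    at r1 r2 r3 r4 r5 r6 r7 r8 r9 r10 r11 r12 r13 r14 r15 r16 r17
  have n0_0_1 := hL.step 1 (by norm_num)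
  have n0_0_6 := hL.step 6 (by norm_num)
  have n0_2_0 := hL.right 0
  have n1_m1_m1 := hL.minus (-1)
  have n1_m1_0 := hL.minus 0
  have n1_m1_1 := hL.minus 1
  have n1_1_m1 := hL.plus (-1)
  have n1_1_0 := hL.plus 0
  have n1_1_1 := hL.plus 1
  have n2_0_0 := hL.left 0
  have key : L (0, 0, 0, 1) * L (0, 0, 0, 2) * L (0, 0, 2, 2) * L (0, 1, -1, -1) *
    L (0, 1, -1, 0) * L (0, 1, -1, 1) * L (0, 1, 1, -5) * L (0, 1, 1, -1) * L (0, 1, 1, 2) *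
    L (0, 2, 0, 2) + L (0, 0, 0, 1) * L (0, 0, 0, 2) * L (0, 0, 2, -2) * L (0, 1, -1, -5) *
    L (0, 1, -1, -1) * L (0, 1, -1, 2) * L (0, 1, 1, -1) * L (0, 1, 1, 0) * L (0, 1, 1, 1) *
    L (0, 2, 0, 2) + L (0, 0, 0, 1) * L (0, 0, 0, 2) * L (0, 0, 2, 2) * L (0, 1, -1, -2) *
    L (0, 1, -1, 1) * L (0, 1, -1, 5) * L (0, 1, 1, -1) * L (0, 1, 1, 0) * L (0, 1, 1, 1) *
    L (0, 2, 0, -2) + L (0, 0, 0, 1) * L (0, 0, 0, 2) * L (0, 0, 2, -2) * L (0, 1, -1, -1) *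
    L (0, 1, -1, 0) * L (0, 1, -1, 1) * L (0, 1, 1, -2) * L (0, 1, 1, 1) * L (0, 1, 1, 5) *
    L (0, 2, 0, -2) - L (0, 0, 0, 4) * L (0, 0, 0, 5) * L (0, 0, 2, 0) * L (0, 1, -1, -1) *
    L (0, 1, -1, 0) * L (0, 1, -1, 1) * L (0, 1, 1, -1) * L (0, 1, 1, 0) * L (0, 1, 1, 1) *
    L (0, 2, 0, 0) + L (0, 0, 0, 1) * L (0, 0, 0, 6) * L (0, 0, 2, 2) * L (0, 1, -1, 0) *
    L (0, 1, -1, 1) ^ 2 * L (0, 1, 1, -1) ^ 2 * L (0, 1, 1, 0) * L (0, 2, 0, 0) +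
    L (0, 0, 0, 1) * L (0, 0, 0, 6) * L (0, 0, 2, -2) * L (0, 1, -1, -1) ^ 2 * L (0, 1, -1, 0) *
    L (0, 1, 1, 0) * L (0, 1, 1, 1) ^ 2 * L (0, 2, 0, 0) = 0 := by
    linear_combination -L (0, 0, 0, 2) * L (0, 0, 0, 4) * L (0, 1, -1, -3) * L (0, 1, -1, -1) *
      L (0, 1, -1, 1) * L (0, 1, 1, 0) * r1 - L (0, 0, 2, 2) * L (0, 1, -1, 0) *
      L (0, 1, -1, 1) ^ 2 * L (0, 1, 1, 3) * L (0, 2, 0, 0) * r2 + L (0, 0, 0, 1) *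
      L (0, 0, 0, 4) * L (0, 0, 2, 2) * L (0, 1, -1, 1) * L (0, 1, 1, -3) * L (0, 2, 0, 0) * r3 +
      L (0, 0, 0, 1) * L (0, 0, 2, 2) * L (0, 1, -1, -2) * L (0, 1, -1, 1) * L (0, 1, 1, 0) *
      L (0, 1, 1, 1) * r4 - L (0, 0, 0, 3) * L (0, 0, 0, 4) * L (0, 0, 2, 2) * L (0, 1, -1, 1) *
      L (0, 1, 1, -3) * L (0, 2, 0, 0) * r5 - L (0, 0, 0, 4) * L (0, 1, -1, -1) *
      L (0, 1, -1, 1) * L (0, 1, 1, 0) * L (0, 1, 1, 1) * L (0, 2, 0, 0) * r6 + L (0, 0, 2, 2) *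
      L (0, 1, -1, 0) * L (0, 1, -1, 1) ^ 2 * L (0, 1, 1, -1) * L (0, 2, 0, 0) * r7 +
      L (0, 0, 0, 2) * L (0, 0, 2, 2) * L (0, 1, -1, 1) ^ 2 * L (0, 1, 1, -5) * L (0, 1, 1, 0) *
      r8 - L (0, 0, 0, 2) ^ 2 * L (0, 1, -1, -1) * L (0, 1, -1, 1) ^ 2 * L (0, 1, 1, 0) * r9 +
      L (0, 0, 0, 5) * L (0, 1, -1, -2) * L (0, 1, -1, -1) * L (0, 1, 1, -2) * L (0, 1, 1, -1) *
      L (0, 2, 0, 2) * r10 + L (0, 0, 0, 1) * L (0, 1, -1, -1) * L (0, 1, -1, 0) *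
      L (0, 1, 1, -1) * L (0, 1, 1, 2) * L (0, 2, 0, 2) * r11 - L (0, 0, 0, 2) * L (0, 0, 2, 0) *
      L (0, 1, -1, -1) * L (0, 1, -1, 1) * L (0, 1, 1, -2) * L (0, 1, 1, -1) * r12 +
      L (0, 0, 0, 2) * L (0, 1, -1, -1) * L (0, 1, -1, 1) * L (0, 1, 1, -2) * L (0, 1, 1, 5) *
      L (0, 2, 0, -2) * r13 - L (0, 0, 0, 1) * L (0, 1, -1, -1) * L (0, 1, -1, 0) *
      L (0, 1, 1, -1) * L (0, 1, 1, 0) * L (0, 2, 0, 2) * r14 + L (0, 0, 0, 1) *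
      L (0, 1, -1, -1) * L (0, 1, -1, 2) * L (0, 1, 1, -1) * L (0, 1, 1, 0) * L (0, 2, 0, 2) *
      r15 + L (0, 0, 0, 1) * L (0, 0, 0, 6) * L (0, 1, -1, -1) ^ 2 * L (0, 1, -1, 0) *
      L (0, 1, 1, 0) * r16 - L (0, 0, 0, 2) * L (0, 1, -1, -1) * L (0, 1, -1, 1) ^ 2 *
      L (0, 1, 1, 0) * L (0, 2, 2, 0) * r17
  linear_combination (norm := skip) 1 / (L (0, 0, 0, 1) * L (0, 0, 0, 6) * L (0, 0, 2, 0) * L (0, 1, -1, -1) * L (0, 1, -1, 0) * L (0, 1, -1, 1) * L (0, 1, 1, -1) * L (0, 1, 1, 0) * L (0, 1, 1, 1) * L (0, 2, 0, 0)) *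
    key
  field_simp
  ring

/-- This is the coefficient of the shift by q in the commutator of the two operators: the difference
of the potential along q, and the routes through p and through −p in both orders. -/
theorem wM_commute {t : ℂ → ℂ} (ht : ThetaLike t) {h a b : ℂ}
    (nv : NonVanishing t h a b) :
    wM t h b a * (S t h a b - S t h a (b + h)) + wM t h a b * wN t h (-(a + h)) b - wN t h a b *
      wM t h (-(a + h)) (b + h) + wM t h (-a) b * wN t h (-(-a + h)) b - wN t h (-a) b *
      wM t h (-(-a + h)) (b + h) = 0 := by
  obtain ⟨ev, L, -, rfl, rfl, rfl, hv, hL⟩ := ht.lattice nv 0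
  simp only [S, wM, wN, neg_mul, mul_neg, ev_two, ev_three, ev_four,
    ev_five, ev_six, ev_add, ev_sub, ev_neg, hv, Int.reduceMul, Int.reduceAdd, Int.reduceSub,
    Int.reduceNeg, Int.reduceLT, neg_zero, hL.neg₁, hL.neg₂, hL.neg₃, hL.neg₄]
  have r1 := hL.three (0, 0, 0, 1) (0, 0, 0, -2) (0, 1, 1, 0) (0, 0, 2, -1)
  have r2 := hL.three (0, 0, 0, 1) (0, 0, 0, -1) (0, 1, 1, 1) (0, 0, 2, 1)
  have r3 := hL.three (0, 1, -1, 0) (0, 1, -1, -1) (0, 2, 0, 1) (0, 2, -2, 1)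
  have r4 := hL.three (0, 0, 0, 1) (0, 0, 0, 3) (0, 1, 1, 2) (0, 0, 2, 5)
  have r5 := hL.three (0, 1, -1, -1) (0, 1, -1, -2) (0, 2, 0, 1) (0, 2, -2, -1)
  have r6 := hL.three (0, 1, -1, -1) (0, 1, -1, -2) (0, 2, 0, -1) (0, 2, -2, -1)
  have r7 := hL.three (0, 0, 0, 1) (0, 0, 0, 2) (0, 1, 1, 1) (0, 0, 2, 3)
  have r8 := hL.three (0, 1, -1, -2) (0, 1, -1, -3) (0, 2, 0, -1) (0, 2, -2, -3)
  simp only [Prod.mk_sub_mk, Prod.mk_add_mk, Int.reduceAdd, Int.reduceSub, Int.reduceNeg,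
    Int.reduceLT, neg_zero, hL.neg₁, hL.neg₂, hL.neg₃, hL.neg₄]
    at r1 r2 r3 r4 r5 r6 r7 r8
  have n0_0_1 := hL.step 1 (by norm_num)
  have n0_2_0 := hL.right 0
  have n0_2_2 := hL.right 2
  have n1_m1_m2 := hL.minus (-2)
  have n1_m1_m1 := hL.minus (-1)
  have n1_m1_0 := hL.minus 0
  have n1_m1_1 := hL.minus 1
  have n1_1_m1 := hL.plus (-1)
  have n1_1_0 := hL.plus 0
  have n1_1_1 := hL.plus 1
  have n1_1_2 := hL.plus 2
  have key : L (0, 0, 0, 1) * L (0, 0, 2, 2) ^ 2 * L (0, 1, -1, -2) * L (0, 1, -1, 0) *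
    L (0, 1, -1, 1) ^ 2 * L (0, 1, 1, -1) ^ 2 * L (0, 1, 1, 0) * L (0, 1, 1, 2) +
    L (0, 0, 0, 1) * L (0, 0, 2, -2) * L (0, 0, 2, 2) * L (0, 1, -1, -2) * L (0, 1, -1, -1) ^ 2 *
    L (0, 1, -1, 0) * L (0, 1, 1, 0) * L (0, 1, 1, 1) ^ 2 * L (0, 1, 1, 2) - L (0, 0, 0, 1) *
    L (0, 0, 2, 0) * L (0, 0, 2, 4) * L (0, 1, -1, -1) * L (0, 1, -1, 0) ^ 2 * L (0, 1, -1, 1) *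
    L (0, 1, 1, -1) * L (0, 1, 1, 0) ^ 2 * L (0, 1, 1, 1) - L (0, 0, 0, 1) * L (0, 0, 2, 0) ^ 2 *
    L (0, 1, -1, -2) ^ 2 * L (0, 1, -1, -1) * L (0, 1, -1, 1) * L (0, 1, 1, -1) *
    L (0, 1, 1, 1) * L (0, 1, 1, 2) ^ 2 + L (0, 0, 0, 1) * L (0, 0, 2, 0) * L (0, 0, 2, 2) *
    L (0, 1, -1, -2) * L (0, 1, -1, -1) ^ 2 * L (0, 1, -1, 2) * L (0, 1, 1, -1) *
    L (0, 1, 1, 0) * L (0, 1, 1, 1) * L (0, 1, 1, 2) - L (0, 0, 0, 1) * L (0, 0, 2, 0) *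
    L (0, 0, 2, 2) * L (0, 1, -1, -2) * L (0, 1, -1, -1) * L (0, 1, -1, 0) * L (0, 1, -1, 1) *
    L (0, 1, 1, -1) * L (0, 1, 1, 0) ^ 2 * L (0, 1, 1, 3) + L (0, 0, 0, 1) * L (0, 0, 2, 0) *
    L (0, 0, 2, 2) * L (0, 1, -1, -2) * L (0, 1, -1, -1) * L (0, 1, -1, 0) * L (0, 1, -1, 1) *
    L (0, 1, 1, -2) * L (0, 1, 1, 1) ^ 2 * L (0, 1, 1, 2) - L (0, 0, 0, 1) * L (0, 0, 2, 0) *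
    L (0, 0, 2, 2) * L (0, 1, -1, -3) * L (0, 1, -1, 0) ^ 2 * L (0, 1, -1, 1) * L (0, 1, 1, -1) *
    L (0, 1, 1, 0) * L (0, 1, 1, 1) * L (0, 1, 1, 2) = 0 := by
    linear_combination L (0, 0, 2, 2) * L (0, 1, -1, -2) * L (0, 1, -1, -1) * L (0, 1, -1, 0) *
      L (0, 1, 1, 0) * L (0, 1, 1, 1) ^ 2 * r1 + L (0, 0, 2, 2) * L (0, 1, -1, -2) *
      L (0, 1, -1, -1) * L (0, 1, -1, 2) * L (0, 1, 1, -1) * L (0, 1, 1, 0) * L (0, 1, 1, 1) *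
      r2 + L (0, 0, 0, 1) * L (0, 0, 2, 2) ^ 2 * L (0, 1, -1, -2) * L (0, 1, -1, 1) *
      L (0, 1, 1, -1) * L (0, 1, 1, 0) * r3 - L (0, 0, 2, 0) * L (0, 1, -1, -1) *
      L (0, 1, -1, 0) * L (0, 1, -1, 1) * L (0, 1, 1, 0) ^ 2 * L (0, 1, 1, 1) * r4 -
      L (0, 0, 0, 1) * L (0, 0, 2, 0) * L (0, 0, 2, 2) * L (0, 1, -1, -2) * L (0, 1, -1, 1) *
      L (0, 1, 1, -1) * L (0, 1, 1, 0) * r5 + L (0, 0, 0, 1) * L (0, 0, 2, 0) * L (0, 0, 2, 2) *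
      L (0, 1, -1, -2) * L (0, 1, -1, 1) * L (0, 1, 1, 1) * L (0, 1, 1, 2) * r6 -
      L (0, 0, 2, 0) * L (0, 1, -1, -3) * L (0, 1, -1, 0) * L (0, 1, -1, 1) * L (0, 1, 1, 0) *
      L (0, 1, 1, 1) * L (0, 1, 1, 2) * r7 - L (0, 0, 0, 1) * L (0, 0, 2, 0) ^ 2 *
      L (0, 1, -1, -2) * L (0, 1, -1, 1) * L (0, 1, 1, 1) * L (0, 1, 1, 2) * r8
  linear_combination (norm := skip) 1 / (L (0, 0, 0, 1) * L (0, 0, 2, 0) * L (0, 0, 2, 2) * L (0, 1, -1, -2) * L (0, 1, -1, -1) * L (0, 1, -1, 0) ^ 2 * L (0, 1, 1, 0) ^ 2 * L (0, 1, 1, 1) * L (0, 1, 1, 2)) *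
    key
  field_simp
  ring

/-- The coefficient of the shift by p + 2q, which either order of the operators reaches by one route
only: q, then p + q, or the reverse. -/
theorem wM_mul_wN {t : ℂ → ℂ} (ht : ThetaLike t) {h a b : ℂ}
    (nv : NonVanishing t h a b) :
    wM t h b a * wN t h a (b + h) = wN t h a b * wM t h (b + h) (a + h) := by
  obtain ⟨ev, L, -, rfl, rfl, rfl, hv, hL⟩ := ht.lattice nv 0
  simp only [wM, wN, neg_mul, mul_neg, ev_two, ev_three, ev_four,
    ev_five, ev_six, ev_add, ev_sub, ev_neg, hv, Int.reduceMul, Int.reduceAdd, Int.reduceSub,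
    Int.reduceNeg, Int.reduceLT, neg_zero, hL.neg₁, hL.neg₂, hL.neg₃, hL.neg₄]
  have n1_m1_0 := hL.minus 0
  have n1_1_0 := hL.plus 0
  have n1_1_1 := hL.plus 1
  have n1_1_2 := hL.plus 2
  field_simp

/-! ### Reduction of the fused operator on four steps to the one on three steps -/

section

variable {τ ℏ : ℂ} {lam : Space} {p q : Wt}

/-- Extension of a path vector by a fixed first step. -/
def consL (a : Wt) : PathVec 3 →ₗ[ℂ] PathVec 4 where
  toFun φ := fun x => eVec a (x 0) * φ ![x 1, x 2, x 3]
  map_add' φ ψ := by ext x; simp [mul_add]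
  map_smul' c φ := by ext x; simp [mul_left_comm]

/-- Extension of a path vector by a fixed last step. -/
def snocL (c : Wt) : PathVec 3 →ₗ[ℂ] PathVec 4 where
  toFun φ := fun x => φ ![x 0, x 1, x 2] * eVec c (x 3)
  map_add' φ ψ := by ext x; simp [add_mul]
  map_smul' c φ := by ext x; simp [mul_assoc]

theorem consL_apply (a : Wt) (φ : PathVec 3) (x : Fin 4 → Wt) :
    consL a φ x = eVec a (x 0) * φ ![x 1, x 2, x 3] := rfl

theorem snocL_apply (c : Wt) (φ : PathVec 3) (x : Fin 4 → Wt) :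
    snocL c φ x = φ ![x 0, x 1, x 2] * eVec c (x 3) := rfl

theorem faceOp_one_consL (a : Wt) (u : ℂ) (φ : PathVec 3) :
    faceOp τ ℏ (k := 2) 1 u lam (consL a φ) =
      consL a (faceOp τ ℏ (k := 1) 0 u (shift ℏ lam a) φ) := by
  ext x
  rw [faceOp_four_one, consL_apply, faceOp_three_zero]
  by_cases h : x 0 = a <;> simp [consL_apply, eVec, h]

theorem faceOp_two_consL (a : Wt) (u : ℂ) (φ : PathVec 3) :
    faceOp τ ℏ (k := 2) 2 u lam (consL a φ) =
      consL a (faceOp τ ℏ (k := 1) 1 u (shift ℏ lam a) φ) := by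
  ext x
  rw [faceOp_four_two, consL_apply, faceOp_three_one]
  by_cases h : x 0 = a <;> simp [consL_apply, eVec, h, shift_shift]

theorem faceOp_zero_snocL (c : Wt) (u : ℂ) (φ : PathVec 3) :
    faceOp τ ℏ (k := 2) 0 u lam (snocL c φ) = snocL c (faceOp τ ℏ (k := 1) 0 u lam φ) := by
  ext x
  rw [faceOp_four_zero, snocL_apply, faceOp_three_zero]
  simp [snocL_apply, Finset.sum_mul, mul_assoc]

theorem faceOp_one_snocL (c : Wt) (u : ℂ) (φ : PathVec 3) :
    faceOp τ ℏ (k := 2) 1 u lam (snocL c φ) = snocL c (faceOp τ ℏ (k := 1) 1 u lam φ) := by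
  ext x
  rw [faceOp_four_one, snocL_apply, faceOp_three_one]
  simp [snocL_apply, Finset.sum_mul, mul_assoc]

/-- A face on the first two steps preserves their sum, hence the vertex at which the face on the
last two steps is based. -/
theorem faceOp_two_zero_comm (u v : ℂ) (φ : PathVec 4) :
    faceOp τ ℏ (k := 2) 2 u lam (faceOp τ ℏ (k := 2) 0 v lam φ) =
      faceOp τ ℏ (k := 2) 0 v lam (faceOp τ ℏ (k := 2) 2 u lam φ) := by
  ext x
  simp only [faceOp_four_two, faceOp_four_zero, Finset.mul_sum, Matrix.cons_val]
  have key : ∀ p q p' q', W11 τ ℏ (shift ℏ lam (x 0 + x 1)) p q (x 2) (x 3) u *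
        (W11 τ ℏ lam p' q' (x 0) (x 1) v * φ ![p', q', p, q]) =
      W11 τ ℏ lam p' q' (x 0) (x 1) v *
        (W11 τ ℏ (shift ℏ lam (p' + q')) p q (x 2) (x 3) u * φ ![p', q', p, q]) := by
    intro p q p' q'
    by_cases hs : p' + q' = x 0 + x 1
    · rw [hs]; ring
    · have : W11 τ ℏ lam p' q' (x 0) (x 1) v = 0 := by simp [W11, hs]
      simp [this]
  simp only [key]
  calc _ = ∑ p ∈ P1, ∑ p' ∈ P1, ∑ q ∈ P1, ∑ q' ∈ P1, _ :=
        Finset.sum_congr rfl fun p _ => Finset.sum_comm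
    _ = ∑ p' ∈ P1, ∑ p ∈ P1, ∑ q' ∈ P1, ∑ q ∈ P1, _ := by
        rw [Finset.sum_comm]
        exact Finset.sum_congr rfl fun p' _ => Finset.sum_congr rfl fun p _ => Finset.sum_comm
    _ = _ := Finset.sum_congr rfl fun p' _ => Finset.sum_comm

/-- Exchanging the two middle factors groups the four faces as W̃₁₂(u) on the first three steps
after W̃₁₂(u − ħ) on the last three. -/
theorem fusedOp22_apply (u : ℂ) (φ : PathVec 4) : fusedOp22 τ ℏ u lam φ =
    faceOp τ ℏ (k := 2) 1 (u + ℏ) lam (faceOp τ ℏ (k := 2) 0 u lam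
      (faceOp τ ℏ (k := 2) 2 u lam (faceOp τ ℏ (k := 2) 1 (u - ℏ) lam φ))) := by
  simp only [fusedOp22, LinearMap.comp_apply, faceOp_two_zero_comm]

theorem faceOp_two_one_consL (a : Wt) (u : ℂ) (φ : PathVec 3) :
    faceOp τ ℏ (k := 2) 2 u lam (faceOp τ ℏ (k := 2) 1 (u - ℏ) lam (consL a φ)) =
      consL a (fusedOp12 τ ℏ (u - ℏ) (shift ℏ lam a) φ) := by
  rw [faceOp_one_consL, faceOp_two_consL, fusedOp12, LinearMap.comp_apply, sub_add_cancel]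

theorem faceOp_one_zero_snocL (c : Wt) (u : ℂ) (φ : PathVec 3) :
    faceOp τ ℏ (k := 2) 1 (u + ℏ) lam (faceOp τ ℏ (k := 2) 0 u lam (snocL c φ)) =
      snocL c (fusedOp12 τ ℏ u lam φ) := by
  rw [faceOp_zero_snocL, faceOp_one_snocL, fusedOp12, LinearMap.comp_apply]

/-- Both sides are e ⊗ f̄ ⊗ e. Regrouping it turns the output of the first operator into the input
of the second. -/
theorem consL_feVec (a s r : Wt) : consL a (feVec τ ℏ (shift ℏ lam a) s r) =
    snocL r (efVec τ ℏ lam a s) := by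
  ext x
  simp [consL_apply, snocL_apply, feVec, efVec, mul_assoc]

theorem ffVec_zero_left (h : Orth p q) (r : Wt) : ffVec τ ℏ lam 0 r =
    theta τ (2 * pair lam p + 2 * ℏ) • consL p (efVec τ ℏ (shift ℏ lam p) (-p) r) +
      (theta τ (2 * pair lam (-p) + 2 * ℏ) • consL (-p) (efVec τ ℏ (shift ℏ lam (-p)) p r) +
      (theta τ (2 * pair lam q + 2 * ℏ) • consL q (efVec τ ℏ (shift ℏ lam q) (-q) r) +
      theta τ (2 * pair lam (-q) + 2 * ℏ) • consL (-q) (efVec τ ℏ (shift ℏ lam (-q)) q r))) := by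
  ext x
  simp only [ffVec, fVec_zero, h.sum_P1, Pi.add_apply, Pi.smul_apply, smul_eq_mul, consL_apply,
    efVec, shift_shift, neg_neg, Matrix.cons_val]
  simp only [add_neg_cancel, neg_add_cancel]
  ring

theorem ffVec_zero_right (h : Orth p q) (s : Wt) : ffVec τ ℏ lam s 0 =
    theta τ (2 * pair (shift ℏ lam s) p + 2 * ℏ) • snocL (-p) (feVec τ ℏ lam s p) +
      (theta τ (2 * pair (shift ℏ lam s) (-p) + 2 * ℏ) • snocL p (feVec τ ℏ lam s (-p)) +
      (theta τ (2 * pair (shift ℏ lam s) q + 2 * ℏ) • snocL (-q) (feVec τ ℏ lam s q) +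
      theta τ (2 * pair (shift ℏ lam s) (-q) + 2 * ℏ) • snocL q (feVec τ ℏ lam s (-q)))) := by
  ext x
  simp only [ffVec, fVec_zero, h.sum_P1, Pi.add_apply, Pi.smul_apply, smul_eq_mul, snocL_apply,
    feVec, neg_neg, Matrix.cons_val]
  ring

theorem ffVec_add_left (h : Orth p q) (r : Wt) : ffVec τ ℏ lam (p + q) r =
    theta τ (pair lam p - pair lam q + ℏ) • consL p (efVec τ ℏ (shift ℏ lam p) q r) +
      theta τ (pair lam q - pair lam p + ℏ) • consL q (efVec τ ℏ (shift ℏ lam q) p r) := by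
  ext x
  simp only [ffVec, fVec_add h, Pi.add_apply, Pi.smul_apply, smul_eq_mul, consL_apply,
    efVec, shift_shift, Matrix.cons_val]
  rw [add_comm q p]
  ring

theorem ffVec_add_right (h : Orth p q) (s : Wt) : ffVec τ ℏ lam s (p + q) =
    theta τ (pair (shift ℏ lam s) p - pair (shift ℏ lam s) q + ℏ) • snocL q (feVec τ ℏ lam s p) +
      theta τ (pair (shift ℏ lam s) q - pair (shift ℏ lam s) p + ℏ) •
        snocL p (feVec τ ℏ lam s q) := by
  ext x
  simp only [ffVec, fVec_add h, Pi.add_apply, Pi.smul_apply, smul_eq_mul, snocL_apply,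
    feVec, Matrix.cons_val]
  ring

theorem cp0_comm (t : ℂ → ℂ) (h a b u : ℂ) : cp0 t h a b u = cp0 t h b a u := by
  rw [cp0, cp0, add_comm a b]

theorem cpp_comm (t : ℂ → ℂ) (h a b u : ℂ) : cpp t h a b u = cpp t h b a u := by
  rw [cpp, cpp, add_comm a b, sub_right_comm u a b]

/-- The coefficient of `f̄_0 ⊗ f̄_0 ↦ f̄_{p+q} ⊗ f̄_{-p-q}`. -/
noncomputable def c0pp (t : ℂ → ℂ) (h a b u : ℂ) : ℂ :=
  d00 t h a b u / t (-(a + h) - -(b + h) + h)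

/-- Within P₂ the weight p + q splits only as 0 + (p+q) and (p+q) + 0. The eight path components are
four theta identities and their images under exchange of p and q. -/
theorem fusedOp22_addZero (hτ : 0 < τ.im) (hℏ : GenericStep τ ℏ) (hr : Regular τ ℏ lam)
    (h : Orth p q) (u : ℂ) : fusedOp22 τ ℏ u lam (ffVec τ ℏ lam (p + q) 0) =
      (g (theta τ) ℏ u * g (theta τ) ℏ (u - ℏ)) •
        (cp0 (theta τ) ℏ (pair lam p) (pair lam q) u • ffVec τ ℏ lam 0 (p + q) +
        cpp (theta τ) ℏ (pair lam p) (pair lam q) u • ffVec τ ℏ lam (p + q) 0) := by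
  have ht := thetaLike_theta hτ
  have nv := hr.nonVanishing hℏ h
  have nv' := hr.nonVanishing hℏ h.symm
  have z₁ := fusedOp12_zero hτ hℏ hr h u
  have z₂ := fusedOp12_zero hτ hℏ hr h.symm u
  have a₂ := fusedOp12_add hτ hℏ hr h.symm u
  have s₂ := fusedOp12_sub hτ hℏ hr h.symm u
  rw [add_comm p (-q)] at z₁
  rw [add_comm q p, add_comm q (-p)] at z₂
  rw [add_comm q p] at a₂ s₂
  rw [fusedOp22_apply]
  -- The same vector occurs on both sides: as input it is split after its first step, as output
  -- before its last one.
  conv_lhs => rw [ffVec_add_left h]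
  rw [ffVec_zero_right h, ffVec_add_right h]
  simp only [map_add, map_smul, faceOp_two_one_consL]
  rw [fusedOp12_zero hτ hℏ (hr.shift p) h.symm, fusedOp12_zero hτ hℏ (hr.shift q) h]
  simp only [map_add, map_smul, consL_feVec, faceOp_one_zero_snocL]
  rw [add_comm q p, add_comm q (-p), add_comm p (-q)]
  simp only [z₁, z₂, a₂, s₂, fusedOp12_add hτ hℏ hr h, fusedOp12_sub hτ hℏ hr h, map_add, map_smul,
    ← shift_shift, shift_zero, pair_neg, pair_shift_self _ _ h.1, pair_shift_self _ _ h.2.1,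
    pair_shift_orth _ _ h, pair_shift_orth _ _ h.symm]
  match_scalars
  · linear_combination g (theta τ) ℏ u * g (theta τ) ℏ (u - ℏ) * addZero_zero_p_q ht nv u
  · rw [cpp_comm]
    linear_combination g (theta τ) ℏ u * g (theta τ) ℏ (u - ℏ) * addZero_add_np_p ht nv' u
  · linear_combination g (theta τ) ℏ u * g (theta τ) ℏ (u - ℏ) * addZero_sub_q_q ht nv u
  · linear_combination g (theta τ) ℏ u * g (theta τ) ℏ (u - ℏ) * addZero_add_p_np ht nv u
  · rw [cp0_comm]
    linear_combination g (theta τ) ℏ u * g (theta τ) ℏ (u - ℏ) * addZero_zero_p_q ht nv' u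
  · linear_combination g (theta τ) ℏ u * g (theta τ) ℏ (u - ℏ) * addZero_sub_q_q ht nv' u
  · linear_combination g (theta τ) ℏ u * g (theta τ) ℏ (u - ℏ) * addZero_add_np_p ht nv u
  · rw [cpp_comm]
    linear_combination g (theta τ) ℏ u * g (theta τ) ℏ (u - ℏ) * addZero_add_p_np ht nv' u

theorem kTerm_comm (t : ℂ → ℂ) (h a b : ℂ) : kTerm t h a b = kTerm t h b a := by
  simp only [kTerm, add_comm b a]; ring

/-- Exchange symmetry is hidden in `S` and becomes visible in the four-term form of the potential.
-/
theorem c000_comm (hτ : 0 < τ.im) (hℏ : GenericStep τ ℏ) (hr : Regular τ ℏ lam) (h : Orth p q)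
    (u : ℂ) : c000 (theta τ) ℏ (pair lam p) (pair lam q) u =
      c000 (theta τ) ℏ (pair lam q) (pair lam p) u := by
  have e₁ := sum_kTerm (thetaLike_theta hτ) (hr.nonVanishing hℏ h)
  have e₂ := sum_kTerm (thetaLike_theta hτ) (hr.nonVanishing hℏ h.symm)
  rw [c000, c000, ← e₁, ← e₂]
  simp only [kTerm_comm (theta τ) ℏ _ (pair lam p), kTerm_comm (theta τ) ℏ _ (-pair lam p)]
  ring

theorem c000_neg (hτ : 0 < τ.im) (hℏ : GenericStep τ ℏ) (hr : Regular τ ℏ lam) (h : Orth p q)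
    (u : ℂ) : c000 (theta τ) ℏ (pair lam (-p)) (pair lam q) u =
      c000 (theta τ) ℏ (pair lam p) (pair lam q) u := by
  have e₁ := sum_kTerm (thetaLike_theta hτ) (hr.nonVanishing hℏ h)
  have e₂ := sum_kTerm (thetaLike_theta hτ) (hr.nonVanishing hℏ h.neg_left)
  rw [c000, c000, ← e₁, ← e₂]
  simp only [pair_neg, neg_neg]
  ring

/-- The compatibility `zeroZero_add` in divided form: the coefficient of f̄_{p+q} ⊗ f̄_{−p−q} does
not depend on the order of p and q. -/
theorem c0pp_comm (hτ : 0 < τ.im) (hℏ : GenericStep τ ℏ) (hr : Regular τ ℏ lam) (h : Orth p q)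
    (u : ℂ) : c0pp (theta τ) ℏ (pair lam p) (pair lam q) u =
      c0pp (theta τ) ℏ (pair lam q) (pair lam p) u := by
  have nv := hr.nonVanishing hℏ h
  have nv' := hr.nonVanishing hℏ h.symm
  have e := zeroZero_add (thetaLike_theta hτ) nv u
  have h₁ := nv.minus 1
  have h₂ := nv'.minus 1
  simp only [Int.cast_one, one_mul] at h₁ h₂
  rw [c0pp, c0pp, show ∀ a b : ℂ, -(a + ℏ) - -(b + ℏ) + ℏ = b - a + ℏ by intros; ring,
    show ∀ a b : ℂ, -(a + ℏ) - -(b + ℏ) + ℏ = b - a + ℏ by intros; ring,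
    div_eq_div_iff h₂ h₁]
  linear_combination e

theorem c00_pair_neg (p : Wt) (a u : ℂ) :
    c00 (theta τ) ℏ a (pair lam (-p)) u = c00 (theta τ) ℏ a (pair lam p) u := by
  rw [pair_neg, c00_neg]

theorem zeroZero_zero_pair (hτ : 0 < τ.im) (hℏ : GenericStep τ ℏ) (hr : Regular τ ℏ lam)
    (h : Orth p q) (u : ℂ) :
    theta τ (2 * pair lam p + 2 * ℏ) *
          c00 (theta τ) ℏ (-(pair lam p + ℏ)) (pair lam q) (u - ℏ) *
          c00 (theta τ) ℏ (pair lam p) (pair lam q) u +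
        theta τ (2 * pair lam q + 2 * ℏ) *
          c0p (theta τ) ℏ (-(pair lam q + ℏ)) (pair lam p) (u - ℏ) *
          cm0 (theta τ) ℏ (pair lam q) (pair lam p) u +
        theta τ (2 * pair lam (-q) + 2 * ℏ) *
          c0p (theta τ) ℏ (-(pair lam (-q) + ℏ)) (pair lam p) (u - ℏ) *
          cm0 (theta τ) ℏ (pair lam (-q)) (pair lam p) u =
      c000 (theta τ) ℏ (pair lam p) (pair lam q) u * theta τ (2 * pair lam p + 2 * ℏ) := by
  rw [pair_neg]
  exact zeroZero_zero (thetaLike_theta hτ) (hr.nonVanishing hℏ h) u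

theorem zeroZero_add_pair (hℏ : GenericStep τ ℏ) (hr : Regular τ ℏ lam)
    (h : Orth p q) (u : ℂ) :
    theta τ (2 * pair lam p + 2 * ℏ) *
          c0p (theta τ) ℏ (-(pair lam p + ℏ)) (pair lam q) (u - ℏ) *
          cmp (theta τ) ℏ (pair lam p) (pair lam q) u +
        theta τ (2 * pair lam (-p) + 2 * ℏ) *
          c0p (theta τ) ℏ (-(pair lam (-p) + ℏ)) (pair lam q) (u - ℏ) *
          cmm (theta τ) ℏ (pair lam (-p)) (pair lam q) u +
        theta τ (2 * pair lam q + 2 * ℏ) *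
          c00 (theta τ) ℏ (-(pair lam q + ℏ)) (pair lam p) (u - ℏ) *
          c0p (theta τ) ℏ (pair lam q) (pair lam p) u =
      c0pp (theta τ) ℏ (pair lam p) (pair lam q) u *
        theta τ (-(pair lam p + ℏ) - -(pair lam q + ℏ) + ℏ) := by
  have h₁ := (hr.nonVanishing hℏ h.symm).minus 1
  rw [Int.cast_one, one_mul, show pair lam q - pair lam p + ℏ =
    -(pair lam p + ℏ) - -(pair lam q + ℏ) + ℏ by ring] at h₁
  rw [c0pp, div_mul_cancel₀ _ h₁, d00, pair_neg]

/-- Of the twelve components, four lie along f̄_0 and eight along f̄_{±p±q}. They are the images of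
two identities under signed exchanges of p and q; the symmetries of `c000` and `c0pp` identify the
coefficients obtained. -/
theorem fusedOp22_zeroZero (hτ : 0 < τ.im) (hℏ : GenericStep τ ℏ) (hr : Regular τ ℏ lam)
    (h : Orth p q) (u : ℂ) : fusedOp22 τ ℏ u lam (ffVec τ ℏ lam 0 0) =
      (g (theta τ) ℏ u * g (theta τ) ℏ (u - ℏ)) •
        (c000 (theta τ) ℏ (pair lam p) (pair lam q) u • ffVec τ ℏ lam 0 0 +
        c0pp (theta τ) ℏ (pair lam p) (pair lam q) u • ffVec τ ℏ lam (p + q) (-p + -q) +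
        c0pp (theta τ) ℏ (pair lam p) (pair lam (-q)) u • ffVec τ ℏ lam (p + -q) (-p + q) +
        c0pp (theta τ) ℏ (pair lam (-p)) (pair lam q) u • ffVec τ ℏ lam (-p + q) (p + -q) +
        c0pp (theta τ) ℏ (pair lam (-p)) (pair lam (-q)) u • ffVec τ ℏ lam (-p + -q) (p + q)) := by
  have z₁ := fusedOp12_zero hτ hℏ hr h u
  have z₂ := fusedOp12_zero hτ hℏ hr h.neg_left u
  have z₃ := fusedOp12_zero hτ hℏ hr h.symm u
  have z₄ := fusedOp12_zero hτ hℏ hr h.symm.neg_left u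
  have s₁ := fusedOp12_sub hτ hℏ hr h u
  have s₂ := fusedOp12_sub hτ hℏ hr h.neg_right u
  have s₃ := fusedOp12_sub hτ hℏ hr h.neg_left u
  have s₄ := fusedOp12_sub hτ hℏ hr h.neg_left.neg_right u
  have s₅ := fusedOp12_sub hτ hℏ hr h.symm u
  have s₆ := fusedOp12_sub hτ hℏ hr h.symm.neg_right u
  have s₇ := fusedOp12_sub hτ hℏ hr h.symm.neg_left u
  have s₈ := fusedOp12_sub hτ hℏ hr h.symm.neg_left.neg_right u
  have y₁ := fusedOp12_zero hτ hℏ (hr.shift p) h.neg_left (u - ℏ)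
  have y₂ := fusedOp12_zero hτ hℏ (hr.shift (-p)) h (u - ℏ)
  have y₃ := fusedOp12_zero hτ hℏ (hr.shift q) h.symm.neg_left (u - ℏ)
  have y₄ := fusedOp12_zero hτ hℏ (hr.shift (-q)) h.symm (u - ℏ)
  -- Signs are kept inside the pairing, so that the identities stated for an orthogonal pair apply
  -- verbatim when p or q is negated.
  simp only [← pair_neg, neg_neg, add_comm q p, add_comm q (-p), add_comm (-q) p,
    add_comm (-q) (-p)] at z₁ z₂ z₃ z₄ s₁ s₂ s₃ s₄ s₅ s₆ s₇ s₈ y₁ y₂ y₃ y₄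
  have h₁ : ∀ μ, pair (shift ℏ μ (-p)) p = -(pair μ (-p) + ℏ) := fun μ => by
    rw [pair_shift_neg_self _ _ h.1, pair_neg]; ring
  have h₂ : ∀ μ, pair (shift ℏ μ (-q)) q = -(pair μ (-q) + ℏ) := fun μ => by
    rw [pair_shift_neg_self _ _ h.2.1, pair_neg]; ring
  have h₃ : ∀ μ, pair (shift ℏ μ p) (-p) = -(pair μ p + ℏ) := fun μ => by
    rw [pair_neg, pair_shift_self _ _ h.1]
  have h₄ : ∀ μ, pair (shift ℏ μ q) (-q) = -(pair μ q + ℏ) := fun μ => by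
    rw [pair_neg, pair_shift_self _ _ h.2.1]
  rw [fusedOp22_apply]
  conv_lhs => rw [ffVec_zero_left h]
  rw [ffVec_zero_right h, ffVec_add_right h, ffVec_add_right h.neg_left, ffVec_add_right h.neg_right,
    ffVec_add_right h.neg_left.neg_right]
  simp only [map_add, map_smul, faceOp_two_one_consL, y₁, y₂, y₃, y₄]
  simp only [consL_feVec, faceOp_one_zero_snocL]
  simp only [z₁, z₂, z₃, z₄, s₁, s₂, s₃, s₄, s₅, s₆, s₇, s₈, map_add, map_smul, ← shift_shift,
    shift_zero, h₁, h₂, h₃, h₄, pair_shift_orth _ _ h, pair_shift_orth _ _ h.symm,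
    pair_shift_orth _ _ h.neg_left, pair_shift_orth _ _ h.symm.neg_left,
    pair_shift_orth _ _ h.neg_right, pair_shift_orth _ _ h.symm.neg_right,
    pair_shift_orth _ _ h.neg_right.neg_left, pair_shift_orth _ _ h.symm.neg_right.neg_left]
  match_scalars
  · linear_combination g (theta τ) ℏ u * g (theta τ) ℏ (u - ℏ) *
      zeroZero_zero_pair hτ hℏ hr h u
  · rw [c0pp_comm hτ hℏ hr h]
    linear_combination g (theta τ) ℏ u * g (theta τ) ℏ (u - ℏ) *
      zeroZero_add_pair hℏ hr h.symm u
  · rw [c0pp_comm hτ hℏ hr h.neg_right, ← c00_pair_neg q]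
    have e := zeroZero_add_pair hℏ hr h.symm.neg_left u
    simp only [neg_neg] at e
    linear_combination g (theta τ) ℏ u * g (theta τ) ℏ (u - ℏ) * e
  · rw [c000_comm hτ hℏ hr h]
    linear_combination g (theta τ) ℏ u * g (theta τ) ℏ (u - ℏ) *
      zeroZero_zero_pair hτ hℏ hr h.symm u
  · rw [← c00_pair_neg p]
    have e := zeroZero_add_pair hℏ hr h.neg_left u
    simp only [neg_neg] at e
    linear_combination g (theta τ) ℏ u * g (theta τ) ℏ (u - ℏ) * e
  · linear_combination g (theta τ) ℏ u * g (theta τ) ℏ (u - ℏ) *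
      zeroZero_add_pair hℏ hr h u
  · rw [c000_comm hτ hℏ hr h, ← c000_neg hτ hℏ hr h.symm]
    linear_combination g (theta τ) ℏ u * g (theta τ) ℏ (u - ℏ) *
      zeroZero_zero_pair hτ hℏ hr h.symm.neg_left u
  · rw [← c00_pair_neg p]
    have e := zeroZero_add_pair hℏ hr h.neg_left.neg_right u
    simp only [neg_neg] at e
    linear_combination g (theta τ) ℏ u * g (theta τ) ℏ (u - ℏ) * e
  · linear_combination g (theta τ) ℏ u * g (theta τ) ℏ (u - ℏ) *
      zeroZero_add_pair hℏ hr h.neg_right u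
  · rw [← c000_neg hτ hℏ hr h]
    linear_combination g (theta τ) ℏ u * g (theta τ) ℏ (u - ℏ) *
      zeroZero_zero_pair hτ hℏ hr h.neg_left u
  · rw [c0pp_comm hτ hℏ hr h.neg_left]
    linear_combination g (theta τ) ℏ u * g (theta τ) ℏ (u - ℏ) *
      zeroZero_add_pair hℏ hr h.symm.neg_right u
  · rw [c0pp_comm hτ hℏ hr h.neg_left.neg_right, ← c00_pair_neg q]
    have e := zeroZero_add_pair hℏ hr h.symm.neg_right.neg_left u
    simp only [neg_neg] at e
    linear_combination g (theta τ) ℏ u * g (theta τ) ℏ (u - ℏ) * e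

end

/-! ### The fused Boltzmann weights -/

section

variable {τ ℏ : ℂ} {lam : Space} {p q : Wt}

/-- A path beginning with p, −p is back at λ after two steps, so among the basis vectors only f̄_0 ⊗
e_p has a component there. -/
theorem IsCoeff12.apply {u : ℂ} {c : Wt → ℂ} (hc : IsCoeff12 τ ℏ lam p 0 u c) (hp : p ∈ P1) :
    fusedOp12 τ ℏ u lam (efVec τ ℏ lam p 0) ![p, -p, p] =
      c 0 * feVec τ ℏ lam 0 p ![p, -p, p] := by
  rw [hc, Finset.sum_apply, Finset.sum_eq_single 0]
  · simp
  · intro s _ hs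
    simp [feVec, fVec, Ne.symm hs]
  · intro h
    exact absurd (Finset.mem_filter.2 ⟨by decide, by simpa using hp⟩) h

/-- The weight is read off from an arbitrarily chosen expansion, but its entry at 0 is forced
because the test path has the non-zero coefficient [2λ_p + 2ħ]. -/
theorem W_one_eq {u : ℂ} {c : Wt → ℂ} (hc : IsCoeff12 τ ℏ lam p 0 u c) (hp : p ∈ P1)
    (h0 : theta τ (2 * pair lam p + 2 * ℏ) ≠ 0) : W τ ℏ .one lam p 0 0 p u = c 0 := by
  have hne : feVec τ ℏ lam 0 p ![p, -p, p] ≠ 0 := by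
    have : -p ∈ P1 := (by decide : ∀ a ∈ P1, -a ∈ P1) p hp
    simpa [feVec, fVec, eVec, hp, this] using h0
  have hex : ∃ c, IsCoeff τ ℏ .one lam p 0 u c := ⟨c, hc⟩
  rw [W, dif_pos ⟨⟨hp, by decide, by decide, hp, by abel⟩, hex⟩]
  have h1 := IsCoeff12.apply hex.choose_spec hp
  rw [hc.apply hp] at h1
  exact (mul_right_cancel₀ hne h1).symm

theorem IsCoeff22.apply {u : ℂ} {c : Wt → ℂ} (hc : IsCoeff22 τ ℏ lam p 0 u c) (hp : p ∈ P2)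
    (a x y : Wt) : fusedOp22 τ ℏ u lam (ffVec τ ℏ lam p 0) ![a, -a, x, y] =
      c 0 * ffVec τ ℏ lam 0 p ![a, -a, x, y] := by
  rw [hc, Finset.sum_apply, Finset.sum_eq_single 0]
  · simp
  · intro s _ hs
    simp [ffVec, fVec, Ne.symm hs]
  · intro h
    exact absurd (Finset.mem_filter.2 ⟨by decide, by simpa using hp⟩) h

theorem W_two_eq {u : ℂ} {c : Wt → ℂ} (hc : IsCoeff22 τ ℏ lam p 0 u c) (hp : p ∈ P2)
    {a x y : Wt} (hne : ffVec τ ℏ lam 0 p ![a, -a, x, y] ≠ 0) :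
    W τ ℏ .two lam p 0 0 p u = c 0 := by
  have hex : ∃ c, IsCoeff τ ℏ .two lam p 0 u c := ⟨c, hc⟩
  rw [W, dif_pos ⟨⟨hp, by decide, by decide, hp, by abel⟩, hex⟩]
  have h1 := IsCoeff22.apply hex.choose_spec hp a x y
  rw [hc.apply hp] at h1
  exact (mul_right_cancel₀ hne h1).symm

theorem Orth.sum_P2 {A : Type*} [AddCommMonoid A] (h : Orth p q) (F : Wt → A) :
    ∑ s ∈ P2, F s = F 0 + (F (p + q) + (F (p + -q) + (F (-p + q) + F (-p + -q)))) := by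
  have hP : P2 = {0, p + q, p + -q, -p + q, -p + -q} :=
    orth_cases h (C := fun p q => P2 = {0, p + q, p + -q, -p + q, -p + -q}) (by decide)
      (by decide) (by decide) (by decide) (by decide) (by decide) (by decide) (by decide)
  have hd : (0 : Wt) ∉ ({p + q, p + -q, -p + q, -p + -q} : Finset Wt) ∧
      p + q ∉ ({p + -q, -p + q, -p + -q} : Finset Wt) ∧
      p + -q ∉ ({-p + q, -p + -q} : Finset Wt) ∧ -p + q ∉ ({-p + -q} : Finset Wt) :=
    orth_cases h (C := fun p q => (0 : Wt) ∉ ({p + q, p + -q, -p + q, -p + -q} : Finset Wt) ∧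
      p + q ∉ ({p + -q, -p + q, -p + -q} : Finset Wt) ∧
      p + -q ∉ ({-p + q, -p + -q} : Finset Wt) ∧ -p + q ∉ ({-p + -q} : Finset Wt)) (by decide)
      (by decide) (by decide) (by decide) (by decide) (by decide) (by decide) (by decide)
  rw [hP, Finset.sum_insert hd.1, Finset.sum_insert hd.2.1, Finset.sum_insert hd.2.2.1,
    Finset.sum_insert hd.2.2.2, Finset.sum_singleton]

theorem Orth.add_ne_zero (h : Orth p q) : p + q ≠ 0 :=
  orth_cases h (C := fun p q => p + q ≠ 0) (by decide) (by decide) (by decide) (by decide)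
    (by decide) (by decide) (by decide) (by decide)

theorem Orth.add_ne_add_neg (h : Orth p q) : p + q ≠ p + -q :=
  orth_cases h (C := fun p q => p + q ≠ p + -q) (by decide) (by decide) (by decide) (by decide)
    (by decide) (by decide) (by decide) (by decide)

theorem Orth.add_ne_neg_add (h : Orth p q) : p + q ≠ -p + q :=
  orth_cases h (C := fun p q => p + q ≠ -p + q) (by decide) (by decide) (by decide) (by decide)
    (by decide) (by decide) (by decide) (by decide)

theorem Orth.add_ne_neg_add_neg (h : Orth p q) : p + q ≠ -p + -q :=
  orth_cases h (C := fun p q => p + q ≠ -p + -q) (by decide) (by decide) (by decide) (by decide)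
    (by decide) (by decide) (by decide) (by decide)

theorem Orth.add_mem_P2 (h : Orth p q) : p + q ∈ P2 :=
  orth_cases h (C := fun p q => p + q ∈ P2) (by decide) (by decide) (by decide) (by decide)
    (by decide) (by decide) (by decide) (by decide)

/-- A complete expansion is exhibited, although only its entry at 0 is wanted: without the existence
of an expansion the weight would take its default value 0. -/
theorem W_one (hτ : 0 < τ.im) (hℏ : GenericStep τ ℏ) (hr : Regular τ ℏ lam) (h : Orth p q)
    (u : ℂ) : W τ ℏ .one lam p 0 0 p u =
      g (theta τ) ℏ u * c00 (theta τ) ℏ (pair lam p) (pair lam q) u := by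
  have nv := hr.nonVanishing hℏ h
  have hc : IsCoeff12 τ ℏ lam p 0 u fun s =>
      if s = 0 then g (theta τ) ℏ u * c00 (theta τ) ℏ (pair lam p) (pair lam q) u
      else if s = p + q then g (theta τ) ℏ u * c0p (theta τ) ℏ (pair lam p) (pair lam q) u
      else g (theta τ) ℏ u * c0p (theta τ) ℏ (pair lam p) (-pair lam q) u := by
    have hf : (P2.filter fun s => p + 0 - s ∈ P1) = {0, p + q, p + -q} :=
      orth_cases h (C := fun p q => (P2.filter fun s => p + 0 - s ∈ P1) = {0, p + q, p + -q})
        (by decide) (by decide) (by decide) (by decide) (by decide) (by decide) (by decide)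
        (by decide)
    rw [IsCoeff12, fusedOp12_zero hτ hℏ hr h, hf, Finset.sum_insert, Finset.sum_pair]
    · rw [show p + 0 - 0 = p by abel, show p + 0 - (p + q) = -q by abel,
        show p + 0 - (p + -q) = q by abel]
      simp only [if_true, h.add_ne_zero, h.neg_right.add_ne_zero, h.add_ne_add_neg.symm, if_false,
        smul_add, smul_smul, add_assoc]
    · exact h.add_ne_add_neg
    · simp [h.add_ne_zero.symm, h.neg_right.add_ne_zero.symm]
  rw [W_one_eq hc h.1, if_pos rfl]
  simpa [mul_add] using nv.left 2

theorem W_two_add (hτ : 0 < τ.im) (hℏ : GenericStep τ ℏ) (hr : Regular τ ℏ lam) (h : Orth p q)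
    (u : ℂ) : W τ ℏ .two lam (p + q) 0 0 (p + q) u =
      g (theta τ) ℏ u * g (theta τ) ℏ (u - ℏ) * cp0 (theta τ) ℏ (pair lam p) (pair lam q) u := by
  have nv := hr.nonVanishing hℏ h
  have hc : IsCoeff22 τ ℏ lam (p + q) 0 u fun s =>
      if s = 0 then g (theta τ) ℏ u * g (theta τ) ℏ (u - ℏ) *
        cp0 (theta τ) ℏ (pair lam p) (pair lam q) u
      else g (theta τ) ℏ u * g (theta τ) ℏ (u - ℏ) *
        cpp (theta τ) ℏ (pair lam p) (pair lam q) u := by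
    have hf : (P2.filter fun s => p + q + 0 - s ∈ P2) = {0, p + q} :=
      orth_cases h (C := fun p q => (P2.filter fun s => p + q + 0 - s ∈ P2) = {0, p + q})
        (by decide) (by decide) (by decide) (by decide) (by decide) (by decide) (by decide)
        (by decide)
    rw [IsCoeff22, fusedOp22_addZero hτ hℏ hr h, hf, Finset.sum_pair h.add_ne_zero.symm,
      show p + q + 0 - 0 = p + q by abel, show p + q + 0 - (p + q) = 0 by abel]
    simp only [if_true, h.add_ne_zero, if_false, smul_add, smul_smul]
  -- On the test path p, −p, p, q the vector f̄_0 ⊗ f̄_{p+q} has the coefficient [2λ_p + 2ħ][λ_{p−q}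
  -- + ħ].
  rw [W_two_eq (a := p) (x := p) (y := q) hc h.add_mem_P2, if_pos rfl]
  have := h.add_ne_zero
  have := (by decide : ∀ a ∈ P1, -a ∈ P1) p h.1
  have h1 := nv.left 2
  have h2 := nv.minus 1
  simp only [Int.cast_ofNat, Int.cast_one, one_mul] at h1 h2
  simp [ffVec, fVec, shift_zero, pair_sub, h.1, h.2.1, *]

theorem W_two_zero (hτ : 0 < τ.im) (hℏ : GenericStep τ ℏ) (hr : Regular τ ℏ lam) (h : Orth p q)
    (u : ℂ) : W τ ℏ .two lam 0 0 0 0 u =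
      g (theta τ) ℏ u * g (theta τ) ℏ (u - ℏ) *
        c000 (theta τ) ℏ (pair lam p) (pair lam q) u := by
  have nv := hr.nonVanishing hℏ h
  set e := g (theta τ) ℏ u * g (theta τ) ℏ (u - ℏ) with he
  have hc : IsCoeff22 τ ℏ lam 0 0 u fun s =>
      if s = 0 then e * c000 (theta τ) ℏ (pair lam p) (pair lam q) u
      else if s = p + q then e * c0pp (theta τ) ℏ (pair lam p) (pair lam q) u
      else if s = p + -q then e * c0pp (theta τ) ℏ (pair lam p) (pair lam (-q)) u
      else if s = -p + q then e * c0pp (theta τ) ℏ (pair lam (-p)) (pair lam q) u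
      else e * c0pp (theta τ) ℏ (pair lam (-p)) (pair lam (-q)) u := by
    have hf : (P2.filter fun s => 0 + 0 - s ∈ P2) = P2 := by decide
    rw [IsCoeff22, fusedOp22_zeroZero hτ hℏ hr h, hf, h.sum_P2, ← he,
      show (0 : Wt) + 0 - 0 = 0 by abel, show 0 + 0 - (p + q) = -p + -q by abel,
      show 0 + 0 - (p + -q) = -p + q by abel, show 0 + 0 - (-p + q) = p + -q by abel,
      show 0 + 0 - (-p + -q) = p + q by abel]
    have h4 := h.neg_left.neg_right.add_ne_zero
    have h5 := h.neg_left.add_ne_zero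
    have h6 := h.neg_left.add_ne_add_neg.symm
    have h7 := h.neg_right.add_ne_neg_add.symm
    have h8 := h.neg_right.add_ne_neg_add_neg.symm
    rw [neg_neg] at h8
    simp only [if_true, h.add_ne_zero, h.neg_right.add_ne_zero, h.add_ne_add_neg.symm, if_false,
      h4, h5, h6, h7, h8, h.add_ne_neg_add.symm, h.add_ne_neg_add_neg.symm,
      smul_add, smul_smul, add_assoc]
  rw [W_two_eq (a := p) (x := p) (y := -p) hc (by decide), if_pos rfl]
  have := (by decide : ∀ a ∈ P1, -a ∈ P1) p h.1
  have h1 := nv.left 2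
  simp only [Int.cast_ofNat] at h1
  simp [ffVec, fVec, shift_zero, h.1, *]

/-! ### The difference operators `M₁(u)` and `M₂(u)` -/

theorem F_mul_wM (hτ : 0 < τ.im) (u a b : ℂ) :
    F τ ℏ u * wM (theta τ) ℏ a b = g (theta τ) ℏ u * c00 (theta τ) ℏ a b u := by
  have h3 : theta τ (-3 * ℏ) ^ 2 = theta τ (3 * ℏ) ^ 2 := by
    rw [neg_mul, (thetaLike_theta hτ).odd, neg_sq]
  rw [F, h3, wM, g, c00]
  ring

theorem G_mul_wN (hτ : 0 < τ.im) (u a b : ℂ) :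
    G τ ℏ u * wN (theta τ) ℏ a b =
      g (theta τ) ℏ u * g (theta τ) ℏ (u - ℏ) * cp0 (theta τ) ℏ a b u := by
  have h3 : theta τ (-3 * ℏ) ^ 4 = theta τ (3 * ℏ) ^ 4 := by
    rw [neg_mul, (thetaLike_theta hτ).odd, Even.neg_pow (by decide)]
  rw [G, h3, wN, g, g, cp0, show u - ℏ + 2 * ℏ = u + ℏ by ring,
    show u - ℏ + 4 * ℏ = u + 3 * ℏ by ring]
  ring

theorem G_mul_sub_H (hτ : 0 < τ.im) (u a b : ℂ) :
    G τ ℏ u * (theta τ (5 * ℏ) * theta τ (4 * ℏ) / (theta τ (6 * ℏ) * theta τ ℏ) -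
        S (theta τ) ℏ a b - H τ ℏ u) =
      g (theta τ) ℏ u * g (theta τ) ℏ (u - ℏ) * c000 (theta τ) ℏ a b u := by
  have h3 : theta τ (-3 * ℏ) ^ 4 = theta τ (3 * ℏ) ^ 4 := by
    rw [neg_mul, (thetaLike_theta hτ).odd, Even.neg_pow (by decide)]
  rw [G, h3, H, g, g, c000, show u - ℏ + 2 * ℏ = u + ℏ by ring,
    show u - ℏ + 4 * ℏ = u + 3 * ℏ by ring]
  -- At a zero of [u] or of [u + 3ħ] both G(u) and g(u) g(u − ħ) vanish, so the value that H(u)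
  -- takes by the convention on division by zero is irrelevant.
  rcases eq_or_ne (theta τ u) 0 with h0 | h0
  · simp [h0]
  rcases eq_or_ne (theta τ (u + 3 * ℏ)) 0 with h1 | h1
  · simp [h1]
  generalize theta τ (u + 3 * ℏ) = y at h1 ⊢
  generalize theta τ u = x at h0 ⊢
  field_simp

end

/-! ### Commutativity of the difference operators -/

theorem wM_neg (t : ℂ → ℂ) (h a b : ℂ) : wM t h a (-b) = wM t h a b := by
  rw [wM, wM, sub_neg_eq_add, ← sub_eq_add_neg, mul_comm]

theorem wN_comm (t : ℂ → ℂ) (h a b : ℂ) : wN t h a b = wN t h b a := by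
  rw [wN, wN, add_comm a b]

theorem ThetaLike.S_neg {t : ℂ → ℂ} (ht : ThetaLike t) (h a b : ℂ) :
    S t h a (-b) = S t h a b := by
  rw [S, S, show 2 * -b + 2 * h = -(2 * b - 2 * h) by ring,
    show 2 * -b - 2 * h = -(2 * b + 2 * h) by ring, mul_neg, ht.odd, ht.odd, ht.odd, add_comm]
  simp only [sub_neg_eq_add, ← sub_eq_add_neg, neg_mul, neg_div_neg_eq]
  congr 1 <;> ring

section

variable {τ ℏ : ℂ} {lam : Space} {p q : Wt}

theorem S_comm (hτ : 0 < τ.im) (hℏ : GenericStep τ ℏ) (hr : Regular τ ℏ lam) (h : Orth p q) :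
    S (theta τ) ℏ (pair lam p) (pair lam q) = S (theta τ) ℏ (pair lam q) (pair lam p) := by
  have h1 := sum_kTerm (thetaLike_theta hτ) (hr.nonVanishing hℏ h)
  have h2 := sum_kTerm (thetaLike_theta hτ) (hr.nonVanishing hℏ h.symm)
  simp only [kTerm_comm (theta τ) ℏ (pair lam q), kTerm_comm (theta τ) ℏ (-pair lam q)] at h2
  linear_combination h1 - h2

/-- The potential of the second difference operator. -/
noncomputable def potential (τ ℏ : ℂ) (lam : Space) : ℂ :=
  theta τ (5 * ℏ) * theta τ (4 * ℏ) / (theta τ (6 * ℏ) * theta τ ℏ) -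
    S (theta τ) ℏ (pair lam (1, 0)) (pair lam (0, 1))

theorem pair_neg_one_zero (lam : Space) : pair lam (-1, 0) = -pair lam (1, 0) := by
  rw [← pair_neg]; rfl

theorem pair_zero_neg_one (lam : Space) : pair lam (0, -1) = -pair lam (0, 1) := by
  rw [← pair_neg]; rfl

theorem Mtilde1_coeff (h : Orth p q) :
    (∏ s ∈ P1 with s ≠ p ∧ s ≠ -p,
      theta τ (pair lam (p + s) - ℏ) / theta τ (pair lam (p + s))) =
      wM (theta τ) ℏ (pair lam p) (pair lam q) := by
  rw [h.prod_P1, wM]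
  simp only [pair_add, pair_neg]
  simp only [← sub_eq_add_neg]

theorem Mtilde1_apply (f : Space → ℂ) (lam : Space) : Mtilde1 τ ℏ f lam =
    wM (theta τ) ℏ (pair lam (1, 0)) (pair lam (0, 1)) * f (shift ℏ lam (1, 0)) +
    wM (theta τ) ℏ (-pair lam (1, 0)) (pair lam (0, 1)) * f (shift ℏ lam (-1, 0)) +
    wM (theta τ) ℏ (pair lam (0, 1)) (pair lam (1, 0)) * f (shift ℏ lam (0, 1)) +
    wM (theta τ) ℏ (-pair lam (0, 1)) (pair lam (1, 0)) * f (shift ℏ lam (0, -1)) := by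
  have h : Orth (1, 0) (0, 1) := by decide
  rw [Mtilde1, h.sum_P1, Mtilde1_coeff h, Mtilde1_coeff h.neg_left, Mtilde1_coeff h.symm,
    Mtilde1_coeff h.symm.neg_left, pair_neg, pair_neg]
  simp only [Prod.neg_mk, neg_zero, add_assoc]

theorem Mtilde2_apply (hτ : 0 < τ.im) (hℏ : GenericStep τ ℏ) (hr : Regular τ ℏ lam)
    (f : Space → ℂ) : Mtilde2 τ ℏ f lam =
    wN (theta τ) ℏ (pair lam (1, 0)) (pair lam (0, 1)) * f (shift ℏ lam (1, 1)) +
    wN (theta τ) ℏ (pair lam (1, 0)) (-pair lam (0, 1)) * f (shift ℏ lam (1, -1)) +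
    wN (theta τ) ℏ (-pair lam (1, 0)) (pair lam (0, 1)) * f (shift ℏ lam (-1, 1)) +
    wN (theta τ) ℏ (-pair lam (1, 0)) (-pair lam (0, 1)) * f (shift ℏ lam (-1, -1)) +
    potential τ ℏ lam * f lam := by
  have hk := sum_kTerm (thetaLike_theta hτ)
    (hr.nonVanishing hℏ (p := (1, 0)) (q := (0, 1)) (by decide))
  rw [Mtilde2, Finset.sum_pair (by decide), Finset.sum_pair (by decide),
    Finset.sum_pair (by decide), potential, ← hk]
  simp only [kTerm, wN, pair_add, pair_neg_one_zero, pair_zero_neg_one]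
  simp only [shift_shift, Prod.mk_add_mk, Int.reduceAdd]
  ring

theorem pair_shift_fst (i j : ℤ) : pair (shift ℏ lam (i, j)) (1, 0) = pair lam (1, 0) + i * ℏ := by
  simp only [pair, shift]; push_cast; ring

theorem pair_shift_snd (i j : ℤ) : pair (shift ℏ lam (i, j)) (0, 1) = pair lam (0, 1) + j * ℏ := by
  simp only [pair, shift]; push_cast; ring

/-- The composites contain the four shifts by weights of P₁ and the eight of the form p + 2q. The
former are settled by `wM_commute`, the latter by `wM_mul_wN`. -/
theorem Mtilde_comm (hτ : 0 < τ.im) (hℏ : GenericStep τ ℏ) (hr : Regular τ ℏ lam)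
    (f : Space → ℂ) :
    Mtilde1 τ ℏ (Mtilde2 τ ℏ f) lam = Mtilde2 τ ℏ (Mtilde1 τ ℏ f) lam := by
  have key {p q : Wt} (h : Orth p q) :=
    wM_commute (thetaLike_theta hτ) (hr.nonVanishing hℏ h)
  have top {p q : Wt} (h : Orth p q) :=
    wM_mul_wN (thetaLike_theta hτ) (hr.nonVanishing hℏ h)
  have e1 := key (p := (1, 0)) (q := (0, 1)) (by decide)
  have e2 := key (p := (1, 0)) (q := (0, -1)) (by decide)
  have e3 := key (p := (0, 1)) (q := (1, 0)) (by decide)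
  have e4 := key (p := (0, 1)) (q := (-1, 0)) (by decide)
  have t1 := top (p := (1, 0)) (q := (0, 1)) (by decide)
  have t2 := top (p := (1, 0)) (q := (0, -1)) (by decide)
  have t3 := top (p := (-1, 0)) (q := (0, 1)) (by decide)
  have t4 := top (p := (-1, 0)) (q := (0, -1)) (by decide)
  have t5 := top (p := (0, 1)) (q := (1, 0)) (by decide)
  have t6 := top (p := (0, 1)) (q := (-1, 0)) (by decide)
  have t7 := top (p := (0, -1)) (q := (1, 0)) (by decide)
  have t8 := top (p := (0, -1)) (q := (-1, 0)) (by decide)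
  -- The identities for shifts along the first axis carry the arguments of `S` in the opposite order
  -- to the one used in `potential`.
  have S_symm (i j : ℤ) : S (theta τ) ℏ (pair lam (0, 1) + j * ℏ) (pair lam (1, 0) + i * ℏ) =
      S (theta τ) ℏ (pair lam (1, 0) + i * ℏ) (pair lam (0, 1) + j * ℏ) := by
    have := S_comm hτ hℏ (hr.shift (i, j)) (p := (0, 1)) (q := (1, 0)) (by decide)
    rwa [pair_shift_fst, pair_shift_snd] at this
  have s0 := S_symm 0 0
  have s1 := S_symm 1 0
  have s2 := S_symm (-1) 0
  simp only [Int.cast_zero, Int.cast_one, Int.cast_neg, zero_mul, one_mul, neg_mul, add_zero,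
    ← sub_eq_add_neg] at s0 s1 s2
  rw [Mtilde1_apply, Mtilde2_apply hτ hℏ hr]
  simp only [Mtilde1_apply, Mtilde2_apply hτ hℏ (hr.shift _), potential, pair_shift_fst,
    pair_shift_snd, shift_shift, Prod.mk_add_mk, Int.reduceAdd, Int.reduceNeg, add_zero, zero_add,
    Int.cast_zero, Int.cast_one, Int.cast_neg, zero_mul, one_mul, neg_mul]
  simp only [← sub_eq_add_neg]
  simp only [pair_neg_one_zero, pair_zero_neg_one] at e1 e2 e3 e4 t1 t2 t3 t4 t5 t6 t7 t8
  have hS := (thetaLike_theta hτ).S_neg ℏ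
  have n1 : -pair lam (1, 0) + ℏ = -(pair lam (1, 0) - ℏ) := by ring
  have n2 : -pair lam (0, 1) + ℏ = -(pair lam (0, 1) - ℏ) := by ring
  simp only [n1, n2, neg_neg, wM_neg, hS, s0, s1, s2, wN_comm _ _ (pair lam (0, 1)),
    wN_comm _ _ (-pair lam (0, 1)), wN_comm _ _ (-(pair lam (0, 1) + ℏ)),
    wN_comm _ _ (pair lam (0, 1) - ℏ)]
    at e1 e2 e3 e4 t1 t2 t3 t4 t5 t6 t7 t8
  linear_combination f (shift ℏ lam (0, 1)) * e1 + f (shift ℏ lam (0, -1)) * e2 +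
    f (shift ℏ lam (1, 0)) * e3 + f (shift ℏ lam (-1, 0)) * e4 +
    f (shift ℏ lam (1, 2)) * t1 + f (shift ℏ lam (1, -2)) * t2 + f (shift ℏ lam (-1, 2)) * t3 +
    f (shift ℏ lam (-1, -2)) * t4 + f (shift ℏ lam (2, 1)) * t5 + f (shift ℏ lam (-2, 1)) * t6 +
    f (shift ℏ lam (2, -1)) * t7 + f (shift ℏ lam (-2, -1)) * t8

theorem M_one (hτ : 0 < τ.im) (hℏ : GenericStep τ ℏ) (hr : Regular τ ℏ lam) (u : ℂ)
    (f : Space → ℂ) : M τ ℏ .one u f lam = F τ ℏ u * Mtilde1 τ ℏ f lam := by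
  rw [M, Mtilde1, Finset.mul_sum]
  refine Finset.sum_congr rfl fun p hp => ?_
  obtain ⟨q, h⟩ : ∃ q, Orth p q :=
    (by decide : ∀ p ∈ P1, Orth p (1, 0) ∨ Orth p (0, 1)) p hp |>.elim (⟨_, ·⟩) (⟨_, ·⟩)
  rw [W_one hτ hℏ hr h, Mtilde1_coeff h, ← F_mul_wM hτ, mul_assoc]

theorem M_two (hτ : 0 < τ.im) (hℏ : GenericStep τ ℏ) (hr : Regular τ ℏ lam) (u : ℂ)
    (f : Space → ℂ) :
    M τ ℏ .two u f lam = G τ ℏ u * (Mtilde2 τ ℏ f lam - H τ ℏ u * f lam) := by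
  have h : Orth (1, 0) (0, 1) := by decide
  rw [M, P, h.sum_P2, W_two_zero hτ hℏ hr h, W_two_add hτ hℏ hr h,
    W_two_add hτ hℏ hr h.neg_right, W_two_add hτ hℏ hr h.neg_left,
    W_two_add hτ hℏ hr h.neg_left.neg_right, ← G_mul_sub_H hτ, ← G_mul_wN hτ, ← G_mul_wN hτ,
    ← G_mul_wN hτ, ← G_mul_wN hτ, Mtilde2_apply hτ hℏ hr, potential, shift_zero]
  simp only [pair_neg]
  simp only [Prod.neg_mk, Prod.mk_add_mk, neg_zero, add_zero, zero_add]
  ring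

/-- Regularity persists under shifts, so the closed forms hold at every point reached. Two operators
with the same d are then affine functions of one operator and commute; the mixed case is
`Mtilde_comm`, to which the scalar H contributes nothing. -/
theorem M_comm (hτ : 0 < τ.im) (hℏ : GenericStep τ ℏ) (hr : Regular τ ℏ lam) (d d' : Fund)
    (u v : ℂ) (f : Space → ℂ) :
    M τ ℏ d u (M τ ℏ d' v f) lam = M τ ℏ d' v (M τ ℏ d u f) lam := by
  have hs := hr.shift
  have h12 (u v : ℂ) : M τ ℏ .one u (M τ ℏ .two v f) lam = M τ ℏ .two v (M τ ℏ .one u f) lam := by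
    have hc := Mtilde_comm hτ hℏ hr f
    rw [Mtilde1_apply, Mtilde2_apply hτ hℏ hr] at hc
    rw [M_one hτ hℏ hr, M_two hτ hℏ hr, Mtilde1_apply, Mtilde2_apply hτ hℏ hr, M_one hτ hℏ hr,
      M_two hτ hℏ (hs _), M_two hτ hℏ (hs _), M_two hτ hℏ (hs _), M_two hτ hℏ (hs _),
      M_one hτ hℏ (hs _), M_one hτ hℏ (hs _), M_one hτ hℏ (hs _), M_one hτ hℏ (hs _)]
    linear_combination F τ ℏ u * G τ ℏ v * hc +
      F τ ℏ u * G τ ℏ v * H τ ℏ v * Mtilde1_apply f lam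
  cases d <;> cases d'
  · rw [M_one hτ hℏ hr, M_one hτ hℏ hr, Mtilde1_apply, Mtilde1_apply]
    simp only [M_one hτ hℏ (hs _)]
    ring
  · exact h12 u v
  · exact (h12 v u).symm
  · simp only [M_two hτ hℏ hr, Mtilde2_apply hτ hℏ hr, M_two hτ hℏ (hs _)]
    ring

end

end C2Face

theorem mainTheorem1 (τ ℏ : ℂ) (hτ : 0 < τ.im) (hℏ : C2Face.GenericStep τ ℏ) :
    (∀ (d d' : C2Face.Fund) (u v : ℂ) (f : C2Face.Space → ℂ) (lam : C2Face.Space),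
      C2Face.Regular τ ℏ lam →
        C2Face.M τ ℏ d u (C2Face.M τ ℏ d' v f) lam =
          C2Face.M τ ℏ d' v (C2Face.M τ ℏ d u f) lam) ∧
    (∀ (u : ℂ) (f : C2Face.Space → ℂ) (lam : C2Face.Space), C2Face.Regular τ ℏ lam →
        C2Face.M τ ℏ .one u f lam = C2Face.F τ ℏ u * C2Face.Mtilde1 τ ℏ f lam) ∧
    (∀ (u : ℂ) (f : C2Face.Space → ℂ) (lam : C2Face.Space), C2Face.Regular τ ℏ lam →
        C2Face.M τ ℏ .two u f lam =
          C2Face.G τ ℏ u * (C2Face.Mtilde2 τ ℏ f lam - C2Face.H τ ℏ u * f lam)) :=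
  ⟨fun d d' u v f _ hr => C2Face.M_comm hτ hℏ hr d d' u v f,
    fun u f _ hr => C2Face.M_one hτ hℏ hr u f, fun u f _ hr => C2Face.M_two hτ hℏ hr u f⟩
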